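/- **Setting.** Let $X$ be a set with a distance function $\operatorname{dist}: X\times X\to\mathbb R$ (no axioms are needed), and let $r_1<r_2$, $0<p_1\le 1$, $0<p_2<1$. A distribution $\mathcal H$ over functions $h:X\to R$ is *$(r_1,r_2,p_1,p_2)$-sensitive* if for all $x,y\in X$ and $h\sim\mathcal H$: $\operatorname{dist}(x,y)\le r_1$ implies $\Pr[h(x)=h(y)]\ge p_1$, and $\operatorname{dist}(x,y)\ge r_2$ implies $\Pr[h(x)=h(y)]\le p_2$. A solution to the *$(r_1,r_2)$-near neighbor problem* for a collection $P$ of $n$ points of $X$ is a randomized static data structure such that, for every fixed query point $q\in X$ for which some $x\in P$ has $\operatorname{dist}(q,x)\le r_1$, the query returns, with probability at least $1/2$ over the randomness of preprocessing, a point $x'\in P$ with $\operatorname{dist}(q,x')<r_2$. The model is the word-RAM with words of $w$ bits, in which a query can in addition evaluate a stored function of $\mathcal H$ at $q$ and compute the distance from $q$ to a point of $P$ (to compare it with $r_2$). Function values are assumed to fit in one word. Preprocessing draws independent samples from $\mathcal H$ and uniformly random bits. **Theorem.** There are an absolute constant $C>0$ and one fixed word-RAM query program such that the following holds. Let $\mathcal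 H$ be any $(r_1,r_2,p_1,p_2)$-sensitive family, let $n\ge 1$, and put $$\rho=\frac{\log(1/p_1)}{\log(1/p_2)},\qquad k=\Big\lceil \log_{1/p_2} n\Big\rceil .$$ Let the word length satisfy $w\ge C\log_2\!\big(2n(k+1)/p_1\big)$ (this lower bound is $\Theta(\log n)$ for $n\ge2$ when $k$ and $1/p_1$ are polynomially bounded in $n$). Then there is a data structure that, for every collection $P$ of $n$ points of $X$, solves the $(r_1,r_2)$-near neighbor problem with success probability at least $1/2$, and in which * every query, for every outcome of the preprocessing, halts after at most $C k^2/p_1$ evaluations of functions from $\mathcal H$, at most $C n^{\rho}$ distance computations, and at most $C\,(n^{\rho}/p_1+k^2/p_1)$ other word-RAM operations; that is, the query complexity is dominated by $O(k^2/p_1)$ evaluations (each charged with $O(1)$ operations of overhead), $O(n^\rho)$ distance computations and $O(n^{\rho}/p_1)$ other operations; * at most $C n^{1+\rho}/p_1$ words of memory are used, including the working memory of the query, in addition to the data and to at most $C k^2/p_1$ stored functions from $\mathcal H$. If $p_2\ge 1/n$ and $n\ge 2$, then $k\le 2\log_{1/p_2} n$, so that $k^2/p_1=O(\log_{1/p_2}^2(n)/p_1)$.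 -/

import Mathlib

open MeasureTheory

/-! ## The word-RAM with word length `w`

Words are bit strings of length `w`. A program is one fixed finite text that does not depend on `w`
or on the input. Besides ordinary instructions of unit cost it can evaluate the stored hash
functions at the query point, and compare distances from the query point to data points with the
outer radius. -/

/-- Binary operations of the word-RAM. -/
inductive BinOp where
  | add | sub | mul | div | mod | and | or | xor | shl | shr | lt | eq

/-- Unsigned arithmetic modulo `2 ^ w`, bitwise operations, shifts, and comparisons with value
`0` or `1`. -/
def BinOp.eval {w : ℕ} : BinOp → BitVec w → BitVec w → BitVec w
  | .add, x, y => x + y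
  | .sub, x, y => x - y
  | .mul, x, y => x * y
  | .div, x, y => BitVec.ofNat w (x.toNat / y.toNat)
  | .mod, x, y => BitVec.ofNat w (x.toNat % y.toNat)
  | .and, x, y => x &&& y
  | .or, x, y => x ||| y
  | .xor, x, y => x ^^^ y
  | .shl, x, y => BitVec.ofNat w (x.toNat <<< y.toNat)
  | .shr, x, y => BitVec.ofNat w (x.toNat >>> y.toNat)
  | .lt, x, y => if x.toNat < y.toNat then BitVec.ofNat w 1 else BitVec.ofNat w 0
  | .eq, x, y => if x = y then BitVec.ofNat w 1 else BitVec.ofNat w 0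

/-- Programs. Natural-number arguments named `d`, `a`, `b` are names of registers. -/
inductive Prog where
  /-- `r_d := c` -/
  | const (d c : ℕ)
  /-- `r_d := r_a f r_b` -/
  | op (f : BinOp) (d a b : ℕ)
  /-- `r_d := mem[r_a]` -/
  | load (d a : ℕ)
  /-- `mem[r_a] := r_b` -/
  | store (a b : ℕ)
  /-- evaluate the stored hash function number `r_a` at the query point; `r_d :=` its value -/
  | hash (d a : ℕ)
  /-- compute the distance from the query point to data point number `r_a`; `r_d := 1` if it is
  less than the outer radius, `r_d := 0` otherwise -/
  | near (d a : ℕ)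
  /-- do nothing -/
  | skip
  /-- `p`, then `p'` -/
  | seq (p p' : Prog)
  /-- `if r_a ≠ 0 then p else p'` -/
  | ite (a : ℕ) (p p' : Prog)
  /-- `while r_a ≠ 0 do p` -/
  | loop (a : ℕ) (p : Prog)

/-- Contents of the registers and of the memory. -/
@[ext]
structure RAMState (w : ℕ) where
  reg : ℕ → BitVec w
  mem : ℕ → BitVec w

/-- Assignment to a register. -/
def RAMState.setReg {w : ℕ} (s : RAMState w) (d : ℕ) (v : BitVec w) : RAMState w :=
  ⟨Function.update s.reg d v, s.mem⟩

/-- Assignment to a memory cell. -/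
def RAMState.setMem {w : ℕ} (s : RAMState w) (a : ℕ) (v : BitVec w) : RAMState w :=
  ⟨s.reg, Function.update s.mem a v⟩

/-- What the program can learn about the query point, one evaluation or comparison at a time. -/
structure Oracle (w : ℕ) where
  numHash : ℕ
  hash : Fin numHash → BitVec w
  numPoints : ℕ
  near : Fin numPoints → Bool

/-- Numbers of hash function evaluations, of distance computations and of all other operations. -/
@[ext]
structure Cost where
  evals : ℕ
  dists : ℕ
  other : ℕ

instance : Zero Cost := ⟨⟨0, 0, 0⟩⟩

instance : Add Cost := ⟨fun c c' => ⟨c.evals + c'.evals, c.dists + c'.dists, c.other + c'.other⟩⟩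

/-- `Exec O space p s c s'`: started in the state `s`, the program `p` halts in the state `s'` at
cost `c`. Only memory cells with addresses below `space` exist; a run that accesses another cell, or
that refers to a hash function or data point that does not exist, has no result. -/
inductive Exec {w : ℕ} (O : Oracle w) (space : ℕ) :
    Prog → RAMState w → Cost → RAMState w → Prop where
  | const (s : RAMState w) (d c : ℕ) :
      Exec O space (.const d c) s ⟨0, 0, 1⟩ (s.setReg d (BitVec.ofNat w c))
  | op (s : RAMState w) (f : BinOp) (d a b : ℕ) :
      Exec O space (.op f d a b) s ⟨0, 0, 1⟩ (s.setReg d (f.eval (s.reg a) (s.reg b)))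
  | load (s : RAMState w) (d a : ℕ) (h : (s.reg a).toNat < space) :
      Exec O space (.load d a) s ⟨0, 0, 1⟩ (s.setReg d (s.mem (s.reg a).toNat))
  | store (s : RAMState w) (a b : ℕ) (h : (s.reg a).toNat < space) :
      Exec O space (.store a b) s ⟨0, 0, 1⟩ (s.setMem (s.reg a).toNat (s.reg b))
  | hash (s : RAMState w) (d a : ℕ) (h : (s.reg a).toNat < O.numHash) :
      Exec O space (.hash d a) s ⟨1, 0, 0⟩ (s.setReg d (O.hash ⟨(s.reg a).toNat, h⟩))
  | near (s : RAMState w) (d a : ℕ) (h : (s.reg a).toNat < O.numPoints) :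
      Exec O space (.near d a) s ⟨0, 1, 0⟩
        (s.setReg d (BitVec.ofNat w (O.near ⟨(s.reg a).toNat, h⟩).toNat))
  | skip (s : RAMState w) : Exec O space .skip s 0 s
  | seq {s s₁ s₂ : RAMState w} {c₁ c₂ : Cost} {p p' : Prog}
      (h₁ : Exec O space p s c₁ s₁) (h₂ : Exec O space p' s₁ c₂ s₂) :
      Exec O space (.seq p p') s (c₁ + c₂) s₂
  | ite_true {s s₁ : RAMState w} {c : Cost} {a : ℕ} {p p' : Prog}
      (ha : s.reg a ≠ 0) (h : Exec O space p s c s₁) :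
      Exec O space (.ite a p p') s (⟨0, 0, 1⟩ + c) s₁
  | ite_false {s s₁ : RAMState w} {c : Cost} {a : ℕ} {p p' : Prog}
      (ha : s.reg a = 0) (h : Exec O space p' s c s₁) :
      Exec O space (.ite a p p') s (⟨0, 0, 1⟩ + c) s₁
  | loop_true {s s₁ s₂ : RAMState w} {c₁ c₂ : Cost} {a : ℕ} {p : Prog}
      (ha : s.reg a ≠ 0) (h₁ : Exec O space p s c₁ s₁)
      (h₂ : Exec O space (.loop a p) s₁ c₂ s₂) :
      Exec O space (.loop a p) s (⟨0, 0, 1⟩ + c₁ + c₂) s₂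
  | loop_false {s : RAMState w} {a : ℕ} {p : Prog} (ha : s.reg a = 0) :
      Exec O space (.loop a p) s ⟨0, 0, 1⟩ s

/-! ## Locality-sensitive hashing -/

/-- The random function `h : X → R` (a sample `h ω` with `ω` distributed as `μ`) is
`(r₁, r₂, p₁, p₂)`-sensitive for the distance function `dist` on `X`. -/
structure IsSensitive {X R Ω : Type*} [MeasurableSpace Ω] (dist : X → X → ℝ) (μ : Measure Ω)
    (h : Ω → X → R) (r₁ r₂ p₁ p₂ : ℝ) : Prop where
  near : ∀ x y, dist x y ≤ r₁ → p₁ ≤ μ.real {ω | h ω x = h ω y}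
  far : ∀ x y, r₂ ≤ dist x y → μ.real {ω | h ω x = h ω y} ≤ p₂

/-! ## Data structures -/

/-- A randomized static data structure for `n` points on a machine with word length `w`.
It stores `numHash` hash functions, sampled independently from the given family. Preprocessing
evaluates them at the data points, draws `numBits` uniformly random bits, and from these fills
`tableSize` words of memory (`build`). A query may use `workSize` further words. -/
structure DataStructure (n w : ℕ) where
  numHash : ℕ
  numBits : ℕ
  tableSize : ℕ
  workSize : ℕ
  build : (Fin numHash → Fin n → BitVec w) → (Fin numBits → Bool) → Fin tableSize → BitVec w

namespace DataStructure

variable {n w : ℕ} (D : DataStructure n w) {X R Ω : Type*}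

/-- Total number of words of memory, for the table and for the work of the query. -/
def space : ℕ := D.tableSize + D.workSize

/-- The outcomes of preprocessing: the sampled functions and the random bits. -/
abbrev Outcome (Ω : Type*) : Type _ := (Fin D.numHash → Ω) × (Fin D.numBits → Bool)

/-- The law of the outcome: independent samples from the family, and independent fair bits. -/
noncomputable def law [MeasurableSpace Ω] (μ : Measure Ω) : Measure (D.Outcome Ω) :=
  (Measure.pi fun _ => μ).prod (ProbabilityTheory.uniformOn Set.univ)

/-- The table that preprocessing builds for the points `P`. -/
def table (h : Ω → X → R) (enc : R → BitVec w) (P : Fin n → X) (z : D.Outcome Ω) :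
    Fin D.tableSize → BitVec w :=
  D.build (fun j i => enc (h (z.1 j) (P i))) z.2

/-- What a query at `q` can learn about `q`. -/
noncomputable def oracle (dist : X → X → ℝ) (r₂ : ℝ) (h : Ω → X → R) (enc : R → BitVec w)
    (P : Fin n → X) (z : D.Outcome Ω) (q : X) : Oracle w where
  numHash := D.numHash
  hash := fun j => enc (h (z.1 j) q)
  numPoints := n
  near := fun i => decide (dist q (P i) < r₂)

/-- The table stands in the first `tableSize` memory cells of `s`. Nothing is said about the other
cells and the registers. -/
def Holds (t : Fin D.tableSize → BitVec w) (s : RAMState w) : Prop :=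
  ∀ i : Fin D.tableSize, s.mem i = t i

/-- For the outcome `z`, the query at `q` halts within the budget (at most `e` hash function
evaluations, `m` distance computations and `o` other operations) and leaves the table intact. -/
def QueryWithin (prog : Prog) (dist : X → X → ℝ) (r₂ : ℝ) (h : Ω → X → R) (enc : R → BitVec w)
    (P : Fin n → X) (q : X) (z : D.Outcome Ω) (e m o : ℝ) : Prop :=
  ∀ s : RAMState w, D.Holds (D.table h enc P z) s →
    ∃ (c : Cost) (s' : RAMState w),
      Exec (D.oracle dist r₂ h enc P z q) D.space prog s c s' ∧
      D.Holds (D.table h enc P z) s' ∧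
      (c.evals : ℝ) ≤ e ∧ (c.dists : ℝ) ≤ m ∧ (c.other : ℝ) ≤ o

/-- The outcomes for which the query at `q` returns, in register `0`, the index of a data point at
distance less than `r₂` from `q`. -/
def successEvent (prog : Prog) (dist : X → X → ℝ) (r₂ : ℝ) (h : Ω → X → R) (enc : R → BitVec w)
    (P : Fin n → X) (q : X) : Set (D.Outcome Ω) :=
  {z | ∀ s : RAMState w, D.Holds (D.table h enc P z) s →
    ∃ (c : Cost) (s' : RAMState w),
      Exec (D.oracle dist r₂ h enc P z q) D.space prog s c s' ∧
      ∃ i : Fin n, (s'.reg 0).toNat = i ∧ dist q (P i) < r₂}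

/-- With the query algorithm `prog`, `D` solves the `(r₁, r₂)`-near neighbor problem for `P`: a
query at any fixed point that has a data point within distance `r₁` succeeds with probability at
least `1 / 2`. -/
def Solves [MeasurableSpace Ω] (prog : Prog) (dist : X → X → ℝ) (r₁ r₂ : ℝ) (μ : Measure Ω)
    (h : Ω → X → R) (enc : R → BitVec w) (P : Fin n → X) : Prop :=
  ∀ q : X, (∃ i, dist q (P i) ≤ r₁) →
    MeasurableSet (D.successEvent prog dist r₂ h enc P q) ∧
    1 / 2 ≤ (D.law μ).real (D.successEvent prog dist r₂ h enc P q)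

end DataStructure

/-! Write `x = 1 / p₁` and split `k = k₁ + k₂` as evenly as possible. Classical locality-sensitive
hashing uses about `x ^ k ≤ n ^ ρ * x` tables, each with its own `k`-tuple of functions. Here a
table belongs to a pair of shorter tuples: `L₁ ≈ 16 x ^ k₁` tuples of length `k₁` and `L₂ ≈ 16 x ^
k₂` tuples of length `k₂` yield `L₁ * L₂ = O(x ^ k)` tables. If one tuple of each kind collides
completely at the query and a near point, then the table of this pair contains a match.

The tuples need not be independent. By Chebyshev's inequality (`measureReal_forall_notMem_le`,
`pi_real_forall_exists_notMem_le`) it is enough that the sum of `x ^ |S l ∩ S l'|` over all pairs of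
tuples of one kind is at most `(1 + ε) L²`. Disjoint tuples satisfy this. So do tuples from a pool
of `m ≈ 16 k x` functions per coordinate, `O(k² x)` in total, if they follow words chosen one after
another by averaging (`exists_design`). `exists_layout` takes the variant with fewer functions,
which also keeps the lists and the cache within the memory bound.

Work per table is constant: each tuple is digested once by polynomial hashing modulo a prime `p`,
and the fingerprint for a table is a random linear combination of two digests. Reading the tuples
costs `L₁ k₁ + L₂ k₂ = O(k² x + x ^ k)` by the inequality of arithmetic and geometric means
(`positions_bound`). The bucket is the fingerprint modulo `n`. A table has on average `O(1)` entries
in the bucket of the query with another fingerprint (`outcomeLaw_mismatch_le`). Far points with the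
same fingerprint number `O(n ^ ρ)` on average over all tables (`outcomeLaw_farMatch_le`,
`mul_pow_ceil_le`). Budgets `cap₁`, `cap₂` cut off both kinds of work, so the cost bounds hold for
every outcome; Markov's inequality bounds the probability that a budget runs out, and the failure
probabilities sum to less than `1 / 2` (`Moderate.failure_le`).

If `n ≤ n ^ ρ`, a linear scan is affordable; the same program performs it on a single table with
empty tuples. The program is verified with a weakest-precondition calculus (`wp_sound`,
`wp_scanTables`, `exec_query`). -/

/-! ## A weakest-precondition calculus for the word-RAM

Registers and memory are described by functions `ℕ → ℕ`. -/

/-- Assertions about registers, memory and the cost so far. -/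
abbrev Assertion : Type := (ℕ → ℕ) → (ℕ → ℕ) → Cost → Prop

/-- The effect of a binary operation on the values of words. -/
def BinOp.natEval (w : ℕ) (f : BinOp) (x y : ℕ) : ℕ :=
  (f.eval (BitVec.ofNat w x) (BitVec.ofNat w y)).toNat

/-- A precondition under which a program terminates with the given postcondition. -/
def Prog.wp {w : ℕ} (O : Oracle w) (space : ℕ) : Prog → Assertion → Assertion
  | .const d v, Q => fun r m c => Q (Function.update r d (v % 2 ^ w)) m (c + ⟨0, 0, 1⟩)
  | .op f d a b, Q => fun r m c =>
      Q (Function.update r d (f.natEval w (r a) (r b))) m (c + ⟨0, 0, 1⟩)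
  | .load d a, Q => fun r m c =>
      r a < space ∧ Q (Function.update r d (m (r a))) m (c + ⟨0, 0, 1⟩)
  | .store a b, Q => fun r m c =>
      r a < space ∧ Q r (Function.update m (r a) (r b)) (c + ⟨0, 0, 1⟩)
  | .hash d a, Q => fun r m c =>
      ∃ h : r a < O.numHash, Q (Function.update r d (O.hash ⟨r a, h⟩).toNat) m (c + ⟨1, 0, 0⟩)
  | .near d a, Q => fun r m c =>
      ∃ h : r a < O.numPoints,
        Q (Function.update r d ((O.near ⟨r a, h⟩).toNat % 2 ^ w)) m (c + ⟨0, 1, 0⟩)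
  | .skip, Q => Q
  | .seq p p', Q => p.wp O space (p'.wp O space Q)
  | .ite a p p', Q => fun r m c =>
      (r a ≠ 0 → p.wp O space Q r m (c + ⟨0, 0, 1⟩)) ∧
        (r a = 0 → p'.wp O space Q r m (c + ⟨0, 0, 1⟩))
  | .loop a p, Q => fun r m c =>
      ∃ I : ℕ → Assertion, (∃ v, I v r m c) ∧ ∀ v r m c, I v r m c →
        (r a = 0 → Q r m (c + ⟨0, 0, 1⟩)) ∧
          (r a ≠ 0 → p.wp O space (fun r m c => ∃ v' < v, I v' r m c) r m (c + ⟨0, 0, 1⟩))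

namespace Cost

@[simp] theorem add_evals (c c' : Cost) : (c + c').evals = c.evals + c'.evals := rfl
@[simp] theorem add_dists (c c' : Cost) : (c + c').dists = c.dists + c'.dists := rfl
@[simp] theorem add_other (c c' : Cost) : (c + c').other = c.other + c'.other := rfl
@[simp] theorem zero_evals : (0 : Cost).evals = 0 := rfl
@[simp] theorem zero_dists : (0 : Cost).dists = 0 := rfl
@[simp] theorem zero_other : (0 : Cost).other = 0 := rfl

protected theorem add_assoc (a b c : Cost) : a + b + c = a + (b + c) := by
  ext <;> simp [Nat.add_assoc]

protected theorem add_zero (a : Cost) : a + 0 = a := by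
  ext <;> simp

protected theorem zero_add (a : Cost) : 0 + a = a := by
  ext <;> simp

end Cost

namespace RAMState

variable {w : ℕ} (s : RAMState w)

/-- The values of the registers. -/
def regNat : ℕ → ℕ := fun i => (s.reg i).toNat

/-- The values of the memory cells. -/
def memNat : ℕ → ℕ := fun i => (s.mem i).toNat

theorem regNat_setReg (d : ℕ) (v : BitVec w) :
    (s.setReg d v).regNat = Function.update s.regNat d v.toNat := by
  funext i
  by_cases h : i = d
  · subst h; simp [regNat, setReg]
  · simp [regNat, setReg, h]

theorem memNat_setReg (d : ℕ) (v : BitVec w) : (s.setReg d v).memNat = s.memNat := rfl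

theorem regNat_setMem (d : ℕ) (v : BitVec w) : (s.setMem d v).regNat = s.regNat := rfl

theorem memNat_setMem (d : ℕ) (v : BitVec w) :
    (s.setMem d v).memNat = Function.update s.memNat d v.toNat := by
  funext i
  by_cases h : i = d
  · subst h; simp [memNat, setMem]
  · simp [memNat, setMem, h]

theorem regNat_eq_zero_iff (a : ℕ) : s.regNat a = 0 ↔ s.reg a = 0 := by
  rw [regNat, ← BitVec.toNat_inj]; simp

end RAMState

namespace Prog

variable {w : ℕ} {O : Oracle w} {space : ℕ}

/-- Induction on the program. For a loop, strong induction on the index of the invariant, which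
every pass decreases, gives termination. Existence of a run suffices, since cost and success of a
query are both stated existentially. -/
theorem wp_sound (p : Prog) : ∀ (Q : Assertion) (s : RAMState w) (c : Cost),
    p.wp O space Q s.regNat s.memNat c →
      ∃ c' s', Exec O space p s c' s' ∧ Q s'.regNat s'.memNat (c + c') := by
  induction p with
  | const d v =>
    intro Q s c h
    refine ⟨_, _, .const s d v, ?_⟩
    simpa [wp, RAMState.regNat_setReg, RAMState.memNat_setReg] using h
  | op f d a b =>
    intro Q s c h
    refine ⟨_, _, .op s f d a b, ?_⟩
    simpa [wp, BinOp.natEval, RAMState.regNat_setReg, RAMState.memNat_setReg, RAMState.regNat]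
      using h
  | load d a =>
    rintro Q s c ⟨h₁, h₂⟩
    refine ⟨_, _, .load s d a h₁, ?_⟩
    rw [RAMState.regNat_setReg, RAMState.memNat_setReg]
    exact h₂
  | store a b =>
    rintro Q s c ⟨h₁, h₂⟩
    refine ⟨_, _, .store s a b h₁, ?_⟩
    rw [RAMState.regNat_setMem, RAMState.memNat_setMem]
    exact h₂
  | hash d a =>
    rintro Q s c ⟨h₁, h₂⟩
    refine ⟨_, _, .hash s d a h₁, ?_⟩
    rw [RAMState.regNat_setReg, RAMState.memNat_setReg]
    exact h₂
  | near d a =>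
    rintro Q s c ⟨h₁, h₂⟩
    refine ⟨_, _, .near s d a h₁, ?_⟩
    rw [RAMState.regNat_setReg, RAMState.memNat_setReg, BitVec.toNat_ofNat]
    exact h₂
  | skip =>
    intro Q s c h
    exact ⟨_, _, .skip s, by rw [Cost.add_zero]; exact h⟩
  | seq p p' ih ih' =>
    intro Q s c h
    obtain ⟨c₁, s₁, e₁, h₁⟩ := ih _ s c h
    obtain ⟨c₂, s₂, e₂, h₂⟩ := ih' _ s₁ _ h₁
    exact ⟨_, _, .seq e₁ e₂, by rw [← Cost.add_assoc]; exact h₂⟩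
  | ite a p p' ih ih' =>
    rintro Q s c ⟨h, h'⟩
    by_cases ha : s.regNat a = 0
    · obtain ⟨c₁, s₁, e₁, h₁⟩ := ih' _ s _ (h' ha)
      exact ⟨_, _, .ite_false ((s.regNat_eq_zero_iff a).1 ha) e₁,
        by rw [← Cost.add_assoc]; exact h₁⟩
    · obtain ⟨c₁, s₁, e₁, h₁⟩ := ih _ s _ (h ha)
      exact ⟨_, _, .ite_true (mt (s.regNat_eq_zero_iff a).2 ha) e₁,
        by rw [← Cost.add_assoc]; exact h₁⟩
  | loop a p ih =>
    rintro Q s c ⟨I, ⟨v, hv⟩, hI⟩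
    induction v using Nat.strong_induction_on generalizing s c with
    | _ v ihv =>
      by_cases ha : s.regNat a = 0
      · exact ⟨_, _, .loop_false ((s.regNat_eq_zero_iff a).1 ha), (hI v _ _ _ hv).1 ha⟩
      · obtain ⟨c₁, s₁, e₁, v', hv', h₁⟩ := ih _ s _ ((hI v _ _ _ hv).2 ha)
        obtain ⟨c₂, s₂, e₂, h₂⟩ := ihv v' hv' s₁ _ h₁
        exact ⟨_, _, .loop_true (mt (s.regNat_eq_zero_iff a).2 ha) e₁ e₂,
          by rw [← Cost.add_assoc, ← Cost.add_assoc]; exact h₂⟩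

theorem wp_seq {p p' : Prog} {Q : Assertion} {r m : ℕ → ℕ} {c : Cost}
    (h : p.wp O space (p'.wp O space Q) r m c) : (seq p p').wp O space Q r m c := h

section Steps

variable {Q : Assertion} {r m : ℕ → ℕ} {c : Cost} {d a b : ℕ}

theorem wp_const (v : ℕ) (hv : v < 2 ^ w)
    (h : Q (Function.update r d v) m (c + ⟨0, 0, 1⟩)) : (const d v).wp O space Q r m c := by
  simpa only [wp, Nat.mod_eq_of_lt hv] using h

theorem wp_add (x y : ℕ) (hx : r a = x) (hy : r b = y) (hxy : x + y < 2 ^ w)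
    (h : Q (Function.update r d (x + y)) m (c + ⟨0, 0, 1⟩)) :
    (op .add d a b).wp O space Q r m c := by
  have : BinOp.natEval w .add x y = x + y := by
    simp [BinOp.natEval, BinOp.eval, Nat.mod_eq_of_lt hxy]
  simpa only [wp, hx, hy, this] using h

theorem wp_mul (x y : ℕ) (hx : r a = x) (hy : r b = y) (hxy : x * y < 2 ^ w)
    (h : Q (Function.update r d (x * y)) m (c + ⟨0, 0, 1⟩)) :
    (op .mul d a b).wp O space Q r m c := by
  have : BinOp.natEval w .mul x y = x * y := by
    simp [BinOp.natEval, BinOp.eval, Nat.mod_eq_of_lt hxy]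
  simpa only [wp, hx, hy, this] using h

theorem wp_sub (x y : ℕ) (hx : r a = x) (hy : r b = y) (hxy : y ≤ x) (hxw : x < 2 ^ w)
    (h : Q (Function.update r d (x - y)) m (c + ⟨0, 0, 1⟩)) :
    (op .sub d a b).wp O space Q r m c := by
  have : BinOp.natEval w .sub x y = x - y := by
    have hyw := hxy.trans_lt hxw
    simp only [BinOp.natEval, BinOp.eval, BitVec.toNat_sub, BitVec.toNat_ofNat,
      Nat.mod_eq_of_lt hxw, Nat.mod_eq_of_lt hyw]
    rw [show 2 ^ w - y + x = (x - y) + 2 ^ w by omega, Nat.add_mod_right,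
      Nat.mod_eq_of_lt (by omega)]
  simpa only [wp, hx, hy, this] using h

theorem wp_div (x y : ℕ) (hx : r a = x) (hy : r b = y) (hxw : x < 2 ^ w) (hyw : y < 2 ^ w)
    (h : Q (Function.update r d (x / y)) m (c + ⟨0, 0, 1⟩)) :
    (op .div d a b).wp O space Q r m c := by
  have : BinOp.natEval w .div x y = x / y := by
    simp [BinOp.natEval, BinOp.eval, Nat.mod_eq_of_lt hxw, Nat.mod_eq_of_lt hyw,
      Nat.mod_eq_of_lt ((Nat.div_le_self x y).trans_lt hxw)]
  simpa only [wp, hx, hy, this] using h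

theorem wp_mod (x y : ℕ) (hx : r a = x) (hy : r b = y) (hxw : x < 2 ^ w) (hyw : y < 2 ^ w)
    (h : Q (Function.update r d (x % y)) m (c + ⟨0, 0, 1⟩)) :
    (op .mod d a b).wp O space Q r m c := by
  have : BinOp.natEval w .mod x y = x % y := by
    simp [BinOp.natEval, BinOp.eval, Nat.mod_eq_of_lt hxw, Nat.mod_eq_of_lt hyw,
      Nat.mod_eq_of_lt ((Nat.mod_le x y).trans_lt hxw)]
  simpa only [wp, hx, hy, this] using h

theorem wp_lt (x y : ℕ) (hx : r a = x) (hy : r b = y) (hxw : x < 2 ^ w) (hyw : y < 2 ^ w)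
    (hw : 1 < 2 ^ w)
    (h : Q (Function.update r d (if x < y then 1 else 0)) m (c + ⟨0, 0, 1⟩)) :
    (op .lt d a b).wp O space Q r m c := by
  have : BinOp.natEval w .lt x y = if x < y then 1 else 0 := by
    simp only [BinOp.natEval, BinOp.eval, BitVec.toNat_ofNat, Nat.mod_eq_of_lt hxw,
      Nat.mod_eq_of_lt hyw]
    split_ifs <;> simp [Nat.mod_eq_of_lt hw]
  simpa only [wp, hx, hy, this] using h

theorem wp_eq (x y : ℕ) (hx : r a = x) (hy : r b = y) (hxw : x < 2 ^ w) (hyw : y < 2 ^ w)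
    (hw : 1 < 2 ^ w)
    (h : Q (Function.update r d (if x = y then 1 else 0)) m (c + ⟨0, 0, 1⟩)) :
    (op .eq d a b).wp O space Q r m c := by
  have : BinOp.natEval w .eq x y = if x = y then 1 else 0 := by
    simp only [BinOp.natEval, BinOp.eval, ← BitVec.toNat_inj, BitVec.toNat_ofNat,
      Nat.mod_eq_of_lt hxw, Nat.mod_eq_of_lt hyw]
    split_ifs <;> simp [Nat.mod_eq_of_lt hw]
  simpa only [wp, hx, hy, this] using h

theorem wp_load (x v : ℕ) (hx : r a = x) (hs : x < space) (hv : m x = v)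
    (h : Q (Function.update r d v) m (c + ⟨0, 0, 1⟩)) : (load d a).wp O space Q r m c := by
  subst hx hv; exact ⟨hs, h⟩

theorem wp_store (x v : ℕ) (hx : r a = x) (hv : r b = v) (hs : x < space)
    (h : Q r (Function.update m x v) (c + ⟨0, 0, 1⟩)) : (store a b).wp O space Q r m c := by
  subst hx hv; exact ⟨hs, h⟩

theorem wp_hash (x : ℕ) (hx : r a = x) (hs : x < O.numHash)
    (h : Q (Function.update r d (O.hash ⟨x, hs⟩).toNat) m (c + ⟨1, 0, 0⟩)) :
    (hash d a).wp O space Q r m c := by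
  subst hx; exact ⟨hs, h⟩

theorem wp_near (x : ℕ) (hx : r a = x) (hs : x < O.numPoints) (hw : 1 < 2 ^ w)
    (h : Q (Function.update r d (if O.near ⟨x, hs⟩ then 1 else 0)) m (c + ⟨0, 1, 0⟩)) :
    (near d a).wp O space Q r m c := by
  subst hx
  refine ⟨hs, ?_⟩
  have : (O.near ⟨r a, hs⟩).toNat % 2 ^ w = if O.near ⟨r a, hs⟩ then 1 else 0 := by
    cases O.near ⟨r a, hs⟩ <;> simp [Nat.mod_eq_of_lt hw]
  rwa [this]

theorem wp_skip (h : Q r m c) : skip.wp O space Q r m c := h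

theorem wp_ite {p p' : Prog} (h : r a ≠ 0 → p.wp O space Q r m (c + ⟨0, 0, 1⟩))
    (h' : r a = 0 → p'.wp O space Q r m (c + ⟨0, 0, 1⟩)) : (ite a p p').wp O space Q r m c :=
  ⟨h, h'⟩

theorem wp_loop {p : Prog} (I : ℕ → Assertion) (v : ℕ) (hv : I v r m c)
    (h : ∀ v r m c, I v r m c → r a = 0 → Q r m (c + ⟨0, 0, 1⟩))
    (h' : ∀ v r m c, I v r m c → r a ≠ 0 →
      p.wp O space (fun r m c => ∃ v' < v, I v' r m c) r m (c + ⟨0, 0, 1⟩)) :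
    (loop a p).wp O space Q r m c :=
  ⟨I, ⟨v, hv⟩, fun v r m c hI => ⟨h v r m c hI, h' v r m c hI⟩⟩

end Steps

end Prog

attribute [irreducible] Prog.wp

/-! ## The query program -/

namespace Prog

/-- Load the first `N` memory cells into the registers `1, …, N`. -/
def fetchAll : ℕ → Prog
  | 0 => skip
  | i + 1 => seq (fetchAll i) (seq (const 24 i) (load (i + 1) 24))

/-- Evaluate the first `r₂` stored functions and write the values to memory from address `r₃`. -/
def cacheValues : Prog :=
  seq (const 25 0) (seq (op .lt 24 25 2) (loop 24 (seq (hash 26 25) (seq (op .add 27 3 25)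
    (seq (store 27 26) (seq (op .add 25 25 22) (op .lt 24 25 2)))))))

/-- One step of the polynomial hash function: absorb the last digit of `r₃₄` into `r₃₁`. -/
def absorbDigit : Prog :=
  seq (op .mod 35 34 10) (seq (op .mul 31 31 12) (seq (op .add 31 31 35)
    (seq (op .mod 31 31 11) (op .div 34 34 10))))

/-- Obtain the value of the function in position `r₂₈` of the concatenation of all tuples, either
from the cache or by an evaluation. -/
def getValue : Prog :=
  ite 4 (seq (op .add 34 5 28) (seq (load 34 34) (seq (op .add 34 3 34) (load 34 34))))
    (hash 34 28)

/-- Compute the digest of the next tuple, of length `r_k`, in `r₃₁`. -/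
def digestTuple (k : ℕ) : Prog :=
  seq (const 31 0) (seq (const 32 0) (seq (op .lt 33 32 k) (loop 33 (seq getValue
    (seq absorbDigit (seq absorbDigit (seq absorbDigit (seq (op .add 28 28 22)
      (seq (op .add 32 32 22) (op .lt 33 32 k))))))))))

/-- Write the digests of the next `r_l` tuples of length `r_k` to memory from address `r₂₉`. -/
def digestSide (k l : ℕ) : Prog :=
  seq (const 30 0) (seq (op .lt 24 30 l) (loop 24 (seq (digestTuple k) (seq (store 29 31)
    (seq (op .add 29 29 22) (seq (op .add 30 30 22) (op .lt 24 30 l)))))))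

end Prog

/-- The two register files agree except possibly on the registers in `S`. -/
def AgreeOff (S : List ℕ) (r r' : ℕ → ℕ) : Prop := ∀ i, i ∉ S → r' i = r i

theorem AgreeOff.refl (S : List ℕ) (r : ℕ → ℕ) : AgreeOff S r r := fun _ _ => rfl

theorem AgreeOff.update {S : List ℕ} {r r' : ℕ → ℕ} (h : AgreeOff S r r') {d : ℕ} (hd : d ∈ S)
    (v : ℕ) : AgreeOff S r (Function.update r' d v) := by
  intro i hi
  rw [Function.update_of_ne (fun e : i = d => hi (by rw [e]; exact hd)), h i hi]

theorem AgreeOff.trans {S T : List ℕ} {r r' r'' : ℕ → ℕ} (h : AgreeOff S r r')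
    (h' : AgreeOff T r' r'') (hT : T ⊆ S) : AgreeOff S r r'' := fun i hi => by
  rw [h' i (fun e => hi (hT e)), h i hi]

/-- One step of polynomial hashing. -/
def absorb (p a acc x : ℕ) : ℕ := (acc * a + x) % p

/-- Absorb the three digits of a word in base `H`. -/
def absorbWord (H p a acc x : ℕ) : ℕ :=
  absorb p a (absorb p a (absorb p a acc (x % H)) (x / H % H)) (x / H / H % H)

/-- The polynomial hash value of a tuple of words. -/
def digest (H p a : ℕ) (v : ℕ → ℕ) : ℕ → ℕ
  | 0 => 0
  | k + 1 => absorbWord H p a (digest H p a v k) (v k)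

theorem absorb_lt {p : ℕ} (hp : 0 < p) (a acc x : ℕ) : absorb p a acc x < p := Nat.mod_lt _ hp

theorem digest_lt {p : ℕ} (hp : 0 < p) (H a : ℕ) (v : ℕ → ℕ) (k : ℕ) : digest H p a v k < p := by
  cases k with
  | zero => exact hp
  | succ k => exact absorb_lt hp _ _ _

theorem digest_congr {H p a : ℕ} {v v' : ℕ → ℕ} {k : ℕ} (h : ∀ i < k, v i = v' i) :
    digest H p a v k = digest H p a v' k := by
  induction k with
  | zero => rfl
  | succ k ih =>
    rw [digest, digest, ih fun i hi => h i (hi.trans k.lt_succ_self), h k k.lt_succ_self]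

/-! ### Correctness of caching and digesting -/

namespace Prog

variable {w : ℕ} {O : Oracle w} {space : ℕ} {Q : Assertion} {r m : ℕ → ℕ} {c : Cost}

theorem wp_fetchAll (N : ℕ) (hN : N ≤ 22) (hs : N ≤ space) (hw : N ≤ 2 ^ w)
    (hQ : ∀ r', (∀ i < N, r' (i + 1) = m i) → Q r' m (c + ⟨0, 0, 2 * N⟩)) :
    (fetchAll N).wp O space Q r m c := by
  induction N generalizing Q with
  | zero =>
    have := hQ r (by simp)
    rw [show (⟨0, 0, 2 * 0⟩ : Cost) = 0 from rfl, Cost.add_zero] at this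
    exact wp_skip this
  | succ N ih =>
    refine wp_seq (ih (by omega) (by omega) (by omega) fun r' hr' => ?_)
    refine wp_seq (wp_const N (by omega) ?_)
    refine wp_load N (m N) (by simp) (by omega) rfl ?_
    rw [Cost.add_assoc, Cost.add_assoc]
    refine hQ _ fun i hi => ?_
    rcases Nat.lt_succ_iff_lt_or_eq.1 hi with hi | rfl
    · rw [Function.update_of_ne (by omega), Function.update_of_ne (by omega), hr' i hi]
    · simp

theorem wp_cacheValues {hv : ℕ → ℕ}
    (hhv : ∀ j (h : j < O.numHash), (O.hash ⟨j, h⟩).toNat = hv j) {N B : ℕ}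
    (hN : r 2 = N) (hB : r 3 = B) (h1 : r 22 = 1) (hNO : N ≤ O.numHash) (hs : B + N ≤ space)
    (hw : space < 2 ^ w) (hw1 : 1 < 2 ^ w)
    (hQ : ∀ r' m' c', AgreeOff [24, 25, 26, 27] r r' → (∀ i < N, m' (B + i) = hv i) →
      (∀ x < B, m' x = m x) → c'.evals = c.evals + N → c'.dists = c.dists →
      c'.other ≤ c.other + 5 * N + 3 → Q r' m' c') :
    cacheValues.wp O space Q r m c := by
  refine wp_seq (wp_const 0 (by omega) ?_)
  refine wp_seq (wp_lt 0 N (by simp) (by simp [hN]) (by omega) (by omega) hw1 ?_)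
  -- After `i` passes the first `i` values are stored. Cells below `B` are unchanged, which protects
  -- the table.
  refine wp_loop (fun v r' m' c' => ∃ i ≤ N, v = N - i ∧ r' 25 = i ∧
    r' 24 = (if i < N then 1 else 0) ∧ AgreeOff [24, 25, 26, 27] r r' ∧
    (∀ i' < i, m' (B + i') = hv i') ∧ (∀ x < B, m' x = m x) ∧ c'.evals = c.evals + i ∧
    c'.dists = c.dists ∧ c'.other ≤ c.other + 5 * i + 2) N
    ⟨0, by omega, by omega, by simp, by simp,
      ((AgreeOff.refl _ _).update (by simp) _).update (by simp) _, by simp, by simp, by simp,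
      by simp, by simp⟩ ?_ ?_
  · rintro v r' m' c' ⟨i, hi, -, -, h24, hr, hm, hm', he, hd, ho⟩ h0
    have : i = N := by
      by_contra h
      rw [if_pos (by omega)] at h24
      omega
    subst this
    exact hQ _ _ _ hr hm hm' (by simpa using he) (by simpa using hd) (by simp; omega)
  · rintro v r' m' c' ⟨i, hi, rfl, h25, h24, hr, hm, hm', he, hd, ho⟩ h0
    have hi' : i < N := by
      by_contra h
      rw [if_neg h] at h24
      omega
    have h3 : r' 3 = B := by rw [hr 3 (by simp), hB]
    have h2 : r' 2 = N := by rw [hr 2 (by simp), hN]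
    have h22 : r' 22 = 1 := by rw [hr 22 (by simp), h1]
    refine wp_seq (wp_hash i h25 (by omega) ?_)
    rw [hhv]
    refine wp_seq (wp_add B i (by simp [h3]) (by simp [h25]) (by omega) ?_)
    refine wp_seq (wp_store (B + i) (hv i) (by simp) (by simp) (by omega) ?_)
    refine wp_seq (wp_add i 1 (by simp [h25]) (by simp [h22]) (by omega) ?_)
    refine wp_lt (i + 1) N (by simp) (by simp [h2]) (by omega) (by omega) hw1 ?_
    refine ⟨N - (i + 1), by omega, i + 1, by omega, rfl, by simp, by simp,
      (((hr.update (by simp) _).update (by simp) _).update (by simp) _).update (by simp) _,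
      fun i' hi' => ?_, fun x hx => ?_, by simp; omega, by simp [hd], by simp; omega⟩
    · rcases Nat.lt_succ_iff_lt_or_eq.1 hi' with h | rfl
      · rw [Function.update_of_ne (by omega), hm i' h]
      · simp
    · rw [Function.update_of_ne (by omega), hm' x hx]

theorem wp_absorbDigit {H p a acc x : ℕ} (hH : r 10 = H) (hp : r 11 = p) (ha : r 12 = a)
    (hacc : r 31 = acc) (hx : r 34 = x) (haccp : acc < p) (haH : a < H) (hxw : x < 2 ^ w)
    (hpH : p * H < 2 ^ w)
    (hQ : ∀ r' c', AgreeOff [31, 34, 35] r r' → r' 31 = absorb p a acc (x % H) → r' 34 = x / H →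
      c' = c + ⟨0, 0, 5⟩ → Q r' m c') :
    absorbDigit.wp O space Q r m c := by
  have hH2 : H < 2 ^ w := (Nat.le_mul_of_pos_left H (by omega)).trans_lt hpH
  have hp2 : p < 2 ^ w := (Nat.le_mul_of_pos_right p (by omega)).trans_lt hpH
  have hmod : x % H < H := Nat.mod_lt _ (by omega)
  -- This rules out overflow, so that word arithmetic computes `absorb` exactly.
  have hmul : acc * a + x % H < p * H := by
    calc acc * a + x % H < acc * H + H := by
          have := Nat.mul_le_mul_left acc haH.le
          omega
      _ = (acc + 1) * H := by ring
      _ ≤ p * H := Nat.mul_le_mul_right _ haccp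
  refine wp_seq (wp_mod x H hx hH hxw hH2 ?_)
  refine wp_seq (wp_mul acc a (by simp [hacc]) (by simp [ha]) (by omega) ?_)
  refine wp_seq (wp_add (acc * a) (x % H) (by simp) (by simp) (by omega) ?_)
  refine wp_seq (wp_mod (acc * a + x % H) p (by simp) (by simp [hp]) (by omega) hp2 ?_)
  refine wp_div x H (by simp [hx]) (by simp [hH]) hxw hH2 ?_
  exact hQ _ _ ((((((AgreeOff.refl _ _).update (by simp) _).update (by simp) _).update
    (by simp) _).update (by simp) _).update (by simp) _) (by simp [absorb]) (by simp)
    (by ext <;> simp)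

/-- With a cache, the list translates position `j` into a function number `ι` and the value is read
from memory without an evaluation. Without a cache, positions are function numbers and each read is
an evaluation. -/
theorem wp_getValue {hv : ℕ → ℕ}
    (hhv : ∀ j (h : j < O.numHash), (O.hash ⟨j, h⟩).toNat = hv j) {f CB FB j ι : ℕ}
    (hf : r 4 = f) (hCB : r 3 = CB) (hFB : r 5 = FB) (hj : r 28 = j)
    (hcached : f ≠ 0 → FB + j < space ∧ CB + ι < space ∧ m (FB + j) = ι ∧ m (CB + ι) = hv ι)
    (huncached : f = 0 → ι = j ∧ j < O.numHash) (hw : space < 2 ^ w)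
    (hQ : ∀ r' c', AgreeOff [34] r r' → r' 34 = hv ι →
      c'.evals = c.evals + (if f = 0 then 1 else 0) → c'.dists = c.dists →
      c'.other ≤ c.other + 5 → Q r' m c') :
    getValue.wp O space Q r m c := by
  refine wp_ite (fun h => ?_) fun h => ?_
  · have hf0 : f ≠ 0 := by omega
    obtain ⟨h₁, h₂, h₃, h₄⟩ := hcached hf0
    refine wp_seq (wp_add FB j hFB hj (by omega) ?_)
    refine wp_seq (wp_load (FB + j) ι (by simp) h₁ h₃ ?_)
    refine wp_seq (wp_add CB ι (by simp [hCB]) (by simp) (by omega) ?_)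
    refine wp_load (CB + ι) (hv ι) (by simp) h₂ h₄ ?_
    exact hQ _ _ (((((AgreeOff.refl _ _).update (by simp) _).update (by simp) _).update
      (by simp) _).update (by simp) _) (by simp) (by simp [hf0]) (by simp) (by simp)
  · have hf0 : f = 0 := by omega
    obtain ⟨rfl, h₂⟩ := huncached hf0
    refine wp_hash ι hj h₂ ?_
    rw [hhv]
    exact hQ _ _ ((AgreeOff.refl _ _).update (by simp) _) (by simp) (by simp [hf0]) (by simp)
      (by simp)

theorem wp_digestTuple {hv idx : ℕ → ℕ}
    (hhv : ∀ j (h : j < O.numHash), (O.hash ⟨j, h⟩).toNat = hv j) {f CB FB H p a j₀ k kr : ℕ}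
    (hf : r 4 = f) (hCB : r 3 = CB) (hFB : r 5 = FB) (hH : r 10 = H) (hp : r 11 = p)
    (ha : r 12 = a) (h1 : r 22 = 1) (hj : r 28 = j₀) (hk : r kr = k) (hkr : kr < 22)
    (hcached : f ≠ 0 → ∀ j, j₀ ≤ j → j < j₀ + k → FB + j < space ∧ CB + idx j < space ∧
      m (FB + j) = idx j ∧ m (CB + idx j) = hv (idx j))
    (huncached : f = 0 → ∀ j, j₀ ≤ j → j < j₀ + k → idx j = j ∧ j < O.numHash)
    (hw : space < 2 ^ w) (hw1 : 1 < 2 ^ w) (hp0 : 0 < p) (haH : a < H) (hpH : p * H < 2 ^ w)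
    (hjk : j₀ + k < 2 ^ w) (hvw : ∀ j, hv j < 2 ^ w)
    (hQ : ∀ r' c', AgreeOff [28, 31, 32, 33, 34, 35] r r' →
      r' 31 = digest H p a (fun i => hv (idx (j₀ + i))) k → r' 28 = j₀ + k →
      c'.evals = c.evals + (if f = 0 then k else 0) → c'.dists = c.dists →
      c'.other ≤ c.other + 24 * k + 4 → Q r' m c') :
    (digestTuple kr).wp O space Q r m c := by
  refine wp_seq (wp_const 0 (by omega) ?_)
  refine wp_seq (wp_const 0 (by omega) ?_)
  refine wp_seq (wp_lt 0 k (by simp) ?_ (by omega) (by omega) hw1 ?_)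
  · rw [Function.update_of_ne (by omega), Function.update_of_ne (by omega), hk]
  -- A pass costs at most 24: one loop test, 5 for the value, three times 5 for the digits, 3 for
  -- the counters.
  refine wp_loop (fun v r' m' c' => ∃ i ≤ k, v = k - i ∧ r' 32 = i ∧
    r' 33 = (if i < k then 1 else 0) ∧ AgreeOff [28, 31, 32, 33, 34, 35] r r' ∧ m' = m ∧
    r' 31 = digest H p a (fun i => hv (idx (j₀ + i))) i ∧ r' 28 = j₀ + i ∧
    c'.evals = c.evals + (if f = 0 then i else 0) ∧ c'.dists = c.dists ∧
    c'.other ≤ c.other + 24 * i + 3) k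
    ⟨0, by omega, by omega, by simp, by simp,
      (((AgreeOff.refl _ _).update (by simp) _).update (by simp) _).update (by simp) _, rfl,
      by simp [digest], by simp [hj], by simp, by simp, by simp⟩ ?_ ?_
  · rintro v r' m' c' ⟨i, hi, -, -, h33, hr, rfl, h31, h28, he, hd, ho⟩ h0
    have : i = k := by
      by_contra h
      rw [if_pos (by omega)] at h33
      omega
    subst this
    exact hQ _ _ hr h31 h28 (by simpa using he) (by simpa using hd) (by simp; omega)
  · rintro v r' m' c' ⟨i, hi, rfl, h32, h33, hr, rfl, h31, h28, he, hd, ho⟩ h0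
    have hi' : i < k := by
      by_contra h
      rw [if_neg h] at h33
      omega
    refine wp_seq (wp_getValue (j := j₀ + i) (ι := idx (j₀ + i)) hhv ((hr 4 (by simp)).trans hf)
      ((hr 3 (by simp)).trans hCB) ((hr 5 (by simp)).trans hFB) h28
      (fun h => hcached h _ (by omega) (by omega))
      (fun h => huncached h _ (by omega) (by omega)) hw fun r₁ c₁ hr₁ h34 he₁ hd₁ ho₁ => ?_)
    have g₁ : AgreeOff [28, 31, 32, 33, 34, 35] r r₁ := hr.trans hr₁ (by simp)
    obtain ⟨D, hD⟩ : ∃ D, D = digest H p a (fun i => hv (idx (j₀ + i))) i := ⟨_, rfl⟩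
    obtain ⟨x, hx⟩ : ∃ x, x = hv (idx (j₀ + i)) := ⟨_, rfl⟩
    have hDp : D < p := by rw [hD]; exact digest_lt hp0 H a _ i
    have hxw : x < 2 ^ w := by rw [hx]; exact hvw _
    have h31₁ : r₁ 31 = D := by rw [hr₁ 31 (by simp), h31, hD]
    rw [← hx] at h34
    refine wp_seq (wp_absorbDigit ((g₁ 10 (by simp)).trans hH) ((g₁ 11 (by simp)).trans hp)
      ((g₁ 12 (by simp)).trans ha) h31₁ h34 hDp haH hxw hpH fun r₂ c₂ hr₂ h31₂ h34₂ hc₂ => ?_)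
    have g₂ : AgreeOff [28, 31, 32, 33, 34, 35] r r₂ := g₁.trans hr₂ (by simp)
    refine wp_seq (wp_absorbDigit ((g₂ 10 (by simp)).trans hH) ((g₂ 11 (by simp)).trans hp)
      ((g₂ 12 (by simp)).trans ha) h31₂ h34₂ (absorb_lt hp0 _ _ _) haH
      ((Nat.div_le_self _ _).trans_lt hxw) hpH fun r₃ c₃ hr₃ h31₃ h34₃ hc₃ => ?_)
    have g₃ : AgreeOff [28, 31, 32, 33, 34, 35] r r₃ := g₂.trans hr₃ (by simp)
    refine wp_seq (wp_absorbDigit ((g₃ 10 (by simp)).trans hH) ((g₃ 11 (by simp)).trans hp)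
      ((g₃ 12 (by simp)).trans ha) h31₃ h34₃ (absorb_lt hp0 _ _ _) haH
      (((Nat.div_le_self _ _).trans (Nat.div_le_self _ _)).trans_lt hxw) hpH
      fun r₄ c₄ hr₄ h31₄ h34₄ hc₄ => ?_)
    have g₄ : AgreeOff [28, 31, 32, 33, 34, 35] r r₄ := g₃.trans hr₄ (by simp)
    have h28₄ : r₄ 28 = j₀ + i := by
      rw [hr₄ 28 (by simp), hr₃ 28 (by simp), hr₂ 28 (by simp), hr₁ 28 (by simp), h28]
    have h32₄ : r₄ 32 = i := by
      rw [hr₄ 32 (by simp), hr₃ 32 (by simp), hr₂ 32 (by simp), hr₁ 32 (by simp), h32]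
    have h22₄ : r₄ 22 = 1 := (g₄ 22 (by simp)).trans h1
    have hk₄ : r₄ kr = k := (g₄ kr (by simp; omega)).trans hk
    refine wp_seq (wp_add (j₀ + i) 1 h28₄ h22₄ (by omega) ?_)
    refine wp_seq (wp_add i 1 (by simp [h32₄]) (by simp [h22₄]) (by omega) ?_)
    refine wp_lt (i + 1) k (by simp) ?_ (by omega) (by omega) hw1 ?_
    · rw [Function.update_of_ne (by omega), Function.update_of_ne (by omega), hk₄]
    subst hc₄ hc₃ hc₂
    refine ⟨k - (i + 1), by omega, i + 1, by omega, rfl, by simp, by simp,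
      ((g₄.update (by simp) _).update (by simp) _).update (by simp) _, rfl, ?_, ?_, ?_, ?_, ?_⟩
    · simp [h31₄, digest, absorbWord, hD, hx]
    · simp [Nat.add_assoc]
    · simp only [Cost.add_evals, he₁, he] at *
      split_ifs <;> omega
    · simp [hd₁, hd]
    · simp only [Cost.add_other] at *
      omega

/-- The address `V₀` separates reading from writing: list and cache lie below `V₀ ≤ V`, and the
digests are written from `V` on, so the facts about list and cache survive all passes. -/
theorem wp_digestSide {hv idx : ℕ → ℕ}
    (hhv : ∀ j (h : j < O.numHash), (O.hash ⟨j, h⟩).toNat = hv j)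
    {f CB FB H p a j₀ k l kr lr V V₀ : ℕ}
    (hf : r 4 = f) (hCB : r 3 = CB) (hFB : r 5 = FB) (hH : r 10 = H) (hp : r 11 = p)
    (ha : r 12 = a) (h1 : r 22 = 1) (hj : r 28 = j₀) (hk : r kr = k) (hl : r lr = l)
    (hkr : kr < 22) (hlr : lr < 22) (hV : r 29 = V) (hV₀ : V₀ ≤ V) (hVs : V + l ≤ space)
    (hcached : f ≠ 0 → ∀ j, j < j₀ + l * k → FB + j < V₀ ∧ CB + idx j < V₀ ∧
      m (FB + j) = idx j ∧ m (CB + idx j) = hv (idx j))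
    (huncached : f = 0 → ∀ j, j < j₀ + l * k → idx j = j ∧ j < O.numHash)
    (hw : space < 2 ^ w) (hw1 : 1 < 2 ^ w) (hp0 : 0 < p) (haH : a < H) (hpH : p * H < 2 ^ w)
    (hjk : j₀ + l * k < 2 ^ w) (hvw : ∀ j, hv j < 2 ^ w)
    (hQ : ∀ r' m' c', AgreeOff [24, 28, 29, 30, 31, 32, 33, 34, 35] r r' → r' 28 = j₀ + l * k →
      r' 29 = V + l → (∀ i < l, m' (V + i) =
        digest H p a (fun i' => hv (idx (j₀ + i * k + i'))) k) → (∀ x < V, m' x = m x) →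
      c'.evals = c.evals + (if f = 0 then l * k else 0) → c'.dists = c.dists →
      c'.other ≤ c.other + 24 * (l * k) + 9 * l + 3 → Q r' m' c') :
    (digestSide kr lr).wp O space Q r m c := by
  refine wp_seq (wp_const 0 (by omega) ?_)
  refine wp_seq (wp_lt 0 l (by simp) ?_ (by omega) (by omega) hw1 ?_)
  · rw [Function.update_of_ne (by omega), hl]
  refine wp_loop (fun v r' m' c' => ∃ i ≤ l, v = l - i ∧ r' 30 = i ∧
    r' 24 = (if i < l then 1 else 0) ∧
    AgreeOff [24, 28, 29, 30, 31, 32, 33, 34, 35] r r' ∧ r' 28 = j₀ + i * k ∧ r' 29 = V + i ∧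
    (∀ i₁ < i, m' (V + i₁) = digest H p a (fun i' => hv (idx (j₀ + i₁ * k + i'))) k) ∧
    (∀ x < V, m' x = m x) ∧
    c'.evals = c.evals + (if f = 0 then i * k else 0) ∧ c'.dists = c.dists ∧
    c'.other ≤ c.other + 24 * (i * k) + 9 * i + 2) l
    ⟨0, by omega, by omega, by simp, by simp,
      ((AgreeOff.refl _ _).update (by simp) _).update (by simp) _, by simp [hj], by simp [hV],
      by simp, by simp, by simp, by simp, by simp⟩ ?_ ?_
  · rintro v r' m' c' ⟨i, hi, -, -, h24, hr, h28, h29, hm, hm', he, hd, ho⟩ h0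
    have : i = l := by
      by_contra h
      rw [if_pos (by omega)] at h24
      omega
    subst this
    exact hQ _ _ _ hr h28 h29 hm hm' (by simpa using he) (by simpa using hd) (by simp; omega)
  · rintro v r' m' c' ⟨i, hi, rfl, h30, h24, hr, h28, h29, hm, hm', he, hd, ho⟩ h0
    have hi' : i < l := by
      by_contra h
      rw [if_neg h] at h24
      omega
    have hik : i * k + k ≤ l * k := by
      rw [← Nat.succ_mul]; exact Nat.mul_le_mul_right _ hi'
    refine wp_seq (wp_digestTuple (idx := idx) (j₀ := j₀ + i * k) hhv ((hr 4 (by simp)).trans hf)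
      ((hr 3 (by simp)).trans hCB) ((hr 5 (by simp)).trans hFB) ((hr 10 (by simp)).trans hH)
      ((hr 11 (by simp)).trans hp) ((hr 12 (by simp)).trans ha) ((hr 22 (by simp)).trans h1) h28
      ((hr kr (by simp; omega)).trans hk) hkr (fun h j _ hj' => ?_)
      (fun h j _ hj' => huncached h j (by omega)) hw hw1 hp0 haH hpH (by omega) hvw
      fun r₁ c₁ hr₁ h31 h28₁ he₁ hd₁ ho₁ => ?_)
    · obtain ⟨h₁, h₂, h₃, h₄⟩ := hcached h j (by omega)
      exact ⟨by omega, by omega, (hm' _ (by omega)).trans h₃, (hm' _ (by omega)).trans h₄⟩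
    have g₁ : AgreeOff [24, 28, 29, 30, 31, 32, 33, 34, 35] r r₁ := hr.trans hr₁ (by simp)
    have h22 : r₁ 22 = 1 := (g₁ 22 (by simp)).trans h1
    have h29₁ : r₁ 29 = V + i := (hr₁ 29 (by simp)).trans h29
    have h30₁ : r₁ 30 = i := (hr₁ 30 (by simp)).trans h30
    have hl₁ : r₁ lr = l := (g₁ lr (by simp; omega)).trans hl
    refine wp_seq (wp_store (V + i) _ h29₁ h31 (by omega) ?_)
    refine wp_seq (wp_add (V + i) 1 h29₁ h22 (by omega) ?_)
    refine wp_seq (wp_add i 1 (by simp [h30₁]) (by simp [h22]) (by omega) ?_)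
    refine wp_lt (i + 1) l (by simp) ?_ (by omega) (by omega) hw1 ?_
    · rw [Function.update_of_ne (by omega), Function.update_of_ne (by omega), hl₁]
    refine ⟨l - (i + 1), by omega, i + 1, by omega, rfl, by simp, by simp,
      ((g₁.update (by simp) _).update (by simp) _).update (by simp) _, ?_, ?_, ?_, ?_, ?_, ?_, ?_⟩
    · simp [h28₁, Nat.succ_mul, Nat.add_assoc]
    · simp [Nat.add_assoc]
    · intro i₁ hi₁
      rcases Nat.lt_succ_iff_lt_or_eq.1 hi₁ with h | rfl
      · rw [Function.update_of_ne (by omega), hm i₁ h]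
      · simp
    · intro x hx
      rw [Function.update_of_ne (by omega), hm' x hx]
    · simp only [Cost.add_evals, he₁, he, Nat.succ_mul] at *
      split_ifs <;> omega
    · simp [hd₁, hd]
    · simp only [Cost.add_other, Nat.succ_mul] at *
      omega

end Prog

/-! ### The scan of the tables: program and combinatorial description -/

namespace Prog

/-- Open table number `r₃₆`: compute the fingerprint `r₄₁` of the query for this table and let
`r₃₇` point to the first entry in the bucket of the query. -/
def openTable : Prog :=
  seq (op .div 44 36 9) (seq (op .add 44 44 15) (seq (load 44 44) (seq (op .mod 45 36 9)
    (seq (op .add 45 45 15) (seq (op .add 45 45 7) (seq (load 45 45) (seq (op .mul 44 44 13)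
    (seq (op .mul 45 45 14) (seq (op .add 44 44 45) (seq (op .mod 41 44 11)
    (seq (op .mod 45 41 1) (seq (op .mul 46 36 1) (seq (op .add 38 46 1) (seq (op .add 45 45 46)
    (seq (op .add 45 45 16) (seq (load 37 45) (op .add 36 36 22)))))))))))))))))

/-- Process the entry `r₃₇` and move on to the next one in the same bucket. The flag `r₂₄` is
cleared if a near point is found or one of the budgets `r₁₉`, `r₂₀` is exhausted. -/
def processEntry : Prog :=
  seq (op .add 40 17 37) (seq (load 40 40) (seq (op .eq 40 40 41)
    (seq (ite 40 (seq (op .mod 0 37 1) (seq (near 43 0) (seq (op .sub 20 20 22)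
        (ite 43 (const 24 0) skip)))) (op .sub 19 19 22))
      (seq (ite 19 (ite 20 skip (const 24 0)) (const 24 0))
        (seq (op .add 40 18 37) (load 37 40))))))

/-- Go through the tables and search the bucket of the query in each of them. -/
def scanTables : Prog :=
  seq (const 36 0) (seq (const 37 0) (seq (const 38 0) (seq (const 24 1) (loop 24
    (seq (op .lt 39 37 38) (ite 39 processEntry
      (seq (op .lt 39 36 21) (ite 39 openTable (const 24 0)))))))))

/-- The query program. -/
def query : Prog :=
  seq (fetchAll 21) (seq (const 22 1) (seq cacheValues (seq (const 28 0)
    (seq (const 23 0) (seq (op .add 29 15 23) (seq (digestSide 6 7) (seq (digestSide 8 9)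
      scanTables)))))))

end Prog

/-- The first `u ≥ lo` with `Q u`, or `hi` if there is none below `hi`. -/
noncomputable def firstFrom (Q : ℕ → Prop) (lo hi : ℕ) : ℕ := sInf {u | lo ≤ u ∧ (hi ≤ u ∨ Q u)}

section firstFrom

variable {Q : ℕ → Prop} {lo hi : ℕ}

theorem firstFrom_mem (h : lo ≤ hi) :
    lo ≤ firstFrom Q lo hi ∧ (hi ≤ firstFrom Q lo hi ∨ Q (firstFrom Q lo hi)) :=
  Nat.sInf_mem (s := {u | lo ≤ u ∧ (hi ≤ u ∨ Q u)}) ⟨hi, h, .inl le_rfl⟩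

theorem firstFrom_le (h : lo ≤ hi) : firstFrom Q lo hi ≤ hi :=
  Nat.sInf_le (s := {u | lo ≤ u ∧ (hi ≤ u ∨ Q u)}) ⟨h, .inl le_rfl⟩

theorem le_firstFrom (h : lo ≤ hi) : lo ≤ firstFrom Q lo hi := (firstFrom_mem h).1

theorem firstFrom_spec (h : lo ≤ hi) (hlt : firstFrom Q lo hi < hi) : Q (firstFrom Q lo hi) :=
  (firstFrom_mem h).2.resolve_left hlt.not_ge

theorem not_of_lt_firstFrom {u : ℕ} (hu : lo ≤ u) (hlt : u < firstFrom Q lo hi) : ¬ Q u :=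
  fun hQ => hlt.not_ge
    (Nat.sInf_le (s := {u | lo ≤ u ∧ (hi ≤ u ∨ Q u)}) ⟨hu, .inr hQ⟩)

end firstFrom

/-- Entries jumped over by the bucket chains must not change the counts of mismatches and far
matches. -/
theorem Nat.count_eq_of_forall_not {P : ℕ → Prop} [DecidablePred P] {a b : ℕ} (hab : a ≤ b)
    (h : ∀ x, a ≤ x → x < b → ¬ P x) : Nat.count P b = Nat.count P a := by
  induction b, hab using Nat.le_induction with
  | base => rfl
  | succ b hab ih =>
    rw [Nat.count_succ, if_neg (h b hab b.lt_succ_self), Nat.add_zero]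
    exact ih fun x hx hxb => h x hx (hxb.trans b.lt_succ_self)

/-- The entry `u` lies in the bucket of the query but has a different fingerprint. Here `fq l` and
`fp u` are the fingerprints of the query for table `l` and of entry `u`; table `l` consists of the
`n` entries from `l * n`. -/
abbrev Mismatch (n : ℕ) (fq fp : ℕ → ℕ) (u : ℕ) : Prop :=
  fp u % n = fq (u / n) % n ∧ fp u ≠ fq (u / n)

/-- The entry `u` has the fingerprint of the query but belongs to a far point. -/
abbrev FarMatch (n : ℕ) (fq fp : ℕ → ℕ) (nr : ℕ → Bool) (u : ℕ) : Prop :=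
  fp u = fq (u / n) ∧ nr (u % n) = false

/-- Conditions under which the scan of the tables finds a near point. -/
structure ScanSucceeds (n L : ℕ) (fq fp : ℕ → ℕ) (nr : ℕ → Bool) (cap₁ cap₂ : ℕ) : Prop where
  exists_match : ∃ u < L * n, fp u = fq (u / n) ∧ nr (u % n) = true
  mismatch_lt : Nat.count (Mismatch n fq fp) (L * n) < cap₁
  farMatch_lt : Nat.count (FarMatch n fq fp nr) (L * n) < cap₂

/-! ### Correctness of the scan -/

namespace Prog

variable {w : ℕ} {O : Oracle w} {space : ℕ} {Q : Assertion} {r m : ℕ → ℕ} {c : Cost}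

theorem wp_openTable {n L₁ L₂ p α β V HB l A B : ℕ} (hn : r 1 = n) (hL₁ : r 7 = L₁)
    (hL₂ : r 9 = L₂) (hp : r 11 = p) (hα : r 13 = α) (hβ : r 14 = β) (hV : r 15 = V)
    (hHB : r 16 = HB) (h1 : r 22 = 1) (hl : r 36 = l) (hw : space < 2 ^ w)
    (hA : m (V + l / L₂) = A) (hB : m (V + L₁ + l % L₂) = B) (hlL : l < L₁ * L₂)
    (hVs : V + L₁ + L₂ ≤ space) (hAB : A * α + B * β < 2 ^ w) (hn0 : 0 < n) (hp0 : 0 < p)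
    (hpw : p < 2 ^ w) (hHs : HB + L₁ * L₂ * n ≤ space)
    (hQ : ∀ r' c', AgreeOff [36, 37, 38, 41, 44, 45, 46] r r' → r' 36 = l + 1 →
      r' 38 = (l + 1) * n → r' 41 = (A * α + B * β) % p →
      r' 37 = m (HB + (l * n + (A * α + B * β) % p % n)) → c' = c + ⟨0, 0, 18⟩ → Q r' m c') :
    openTable.wp O space Q r m c := by
  have hL₂0 : 0 < L₂ := Nat.pos_of_ne_zero fun h => by simp [h] at hlL
  have hL₁0 : 0 < L₁ := Nat.pos_of_ne_zero fun h => by simp [h] at hlL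
  have hdiv : l / L₂ < L₁ := Nat.div_lt_of_lt_mul (by rwa [Nat.mul_comm])
  have hmod : l % L₂ < L₂ := Nat.mod_lt _ hL₂0
  have hln : l * n + n ≤ L₁ * L₂ * n := by
    rw [← Nat.succ_mul]; exact Nat.mul_le_mul_right _ hlL
  have hl_le : l ≤ l * n := Nat.le_mul_of_pos_right _ hn0
  have hb : (A * α + B * β) % p % n < n := Nat.mod_lt _ hn0
  have hF : (A * α + B * β) % p < p := Nat.mod_lt _ hp0
  refine wp_seq (wp_div l L₂ hl hL₂ (by omega) (by omega) ?_)
  refine wp_seq (wp_add (l / L₂) V (by simp) (by simp [hV]) (by omega) ?_)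
  refine wp_seq (wp_load (l / L₂ + V) A (by simp) (by omega) (by rw [Nat.add_comm, hA]) ?_)
  refine wp_seq (wp_mod l L₂ (by simp [hl]) (by simp [hL₂]) (by omega) (by omega) ?_)
  refine wp_seq (wp_add (l % L₂) V (by simp) (by simp [hV]) (by omega) ?_)
  refine wp_seq (wp_add (l % L₂ + V) L₁ (by simp) (by simp [hL₁]) (by omega) ?_)
  refine wp_seq (wp_load (l % L₂ + V + L₁) B (by simp) (by omega)
    (by rw [← hB]; congr 1; omega) ?_)
  refine wp_seq (wp_mul A α (by simp) (by simp [hα]) (by omega) ?_)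
  refine wp_seq (wp_mul B β (by simp) (by simp [hβ]) (by omega) ?_)
  refine wp_seq (wp_add (A * α) (B * β) (by simp) (by simp) hAB ?_)
  refine wp_seq (wp_mod (A * α + B * β) p (by simp) (by simp [hp]) hAB hpw ?_)
  refine wp_seq (wp_mod ((A * α + B * β) % p) n (by simp) (by simp [hn]) (by omega)
    (by omega) ?_)
  refine wp_seq (wp_mul l n (by simp [hl]) (by simp [hn]) (by omega) ?_)
  refine wp_seq (wp_add (l * n) n (by simp) (by simp [hn]) (by omega) ?_)
  refine wp_seq (wp_add ((A * α + B * β) % p % n) (l * n) (by simp) (by simp) (by omega) ?_)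
  refine wp_seq (wp_add ((A * α + B * β) % p % n + l * n) HB (by simp) (by simp [hHB])
    (by omega) ?_)
  refine wp_seq (wp_load ((A * α + B * β) % p % n + l * n + HB) _ (by simp) (by omega) rfl ?_)
  refine wp_add l 1 (by simp [hl]) (by simp [h1]) (by omega) ?_
  exact hQ _ _ (by intro i hi; simp at hi; simp [hi]) (by simp) (by simp [Nat.succ_mul])
    (by simp) (by simp; congr 1; omega) (by ext <;> simp)

theorem wp_processEntry {n u e F c₁ c₂ FPB NXB : ℕ} {nr : ℕ → Bool} (hn : r 1 = n)
    (hFPB : r 17 = FPB) (hNXB : r 18 = NXB) (hc₁ : r 19 = c₁) (hc₂ : r 20 = c₂) (h1 : r 22 = 1)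
    (hgo : r 24 = 1) (hu : r 37 = u) (hF : r 41 = F) (he : m (FPB + u) = e)
    (hc₁0 : 0 < c₁) (hc₂0 : 0 < c₂) (hc₁w : c₁ < 2 ^ w) (hc₂w : c₂ < 2 ^ w) (hw : space < 2 ^ w)
    (hw1 : 1 < 2 ^ w) (hus : FPB + u < space) (hus' : NXB + u < space) (hew : e < 2 ^ w)
    (hFw : F < 2 ^ w) (hn0 : 0 < n) (hnw : n < 2 ^ w) (hnO : n = O.numPoints)
    (hnr : ∀ i (h : i < O.numPoints), O.near ⟨i, h⟩ = nr i)
    (hmiss : e ≠ F → ∀ r' c', AgreeOff [19, 24, 37, 40] r r' → r' 19 = c₁ - 1 →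
      r' 24 = (if c₁ - 1 = 0 then 0 else 1) → r' 37 = m (NXB + u) → c'.evals = c.evals →
      c'.dists = c.dists → c'.other ≤ c.other + 10 → Q r' m c')
    (hhit : e = F → ∀ r' c', AgreeOff [0, 20, 24, 37, 40, 43] r r' → r' 0 = u % n →
      r' 20 = c₂ - 1 → r' 24 = (if nr (u % n) = true ∨ c₂ - 1 = 0 then 0 else 1) →
      r' 37 = m (NXB + u) → c'.evals = c.evals → c'.dists = c.dists + 1 →
      c'.other ≤ c.other + 13 → Q r' m c') :
    processEntry.wp O space Q r m c := by
  refine wp_seq (wp_add FPB u hFPB hu (by omega) ?_)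
  refine wp_seq (wp_load (FPB + u) e (by simp) hus he ?_)
  refine wp_seq (wp_eq e F (by simp) (by simp [hF]) hew hFw hw1 ?_)
  refine wp_seq (wp_ite (fun h => ?_) fun h => ?_)
  · have heF : e = F := by
      by_contra hne
      simp [hne] at h
    have hmod : u % n < n := Nat.mod_lt _ hn0
    refine wp_seq (wp_mod u n (by simp [hu]) (by simp [hn]) (by omega) hnw ?_)
    refine wp_seq (wp_near (u % n) (by simp) (by omega) hw1 ?_)
    rw [hnr]
    refine wp_seq (wp_sub c₂ 1 (by simp [hc₂]) (by simp [h1]) (by omega) (by omega) ?_)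
    refine wp_ite (fun h' => ?_) fun h' => ?_
    · have hnr' : nr (u % n) = true := by
        by_contra hne
        simp [hne] at h'
      refine wp_const 0 (by omega) (wp_seq (wp_ite (fun _ => wp_ite (fun _ => wp_skip ?_)
        fun _ => wp_const 0 (by omega) ?_) fun h'' => absurd h'' (by simp; omega)))
      all_goals
        refine wp_seq (wp_add NXB u (by simp [hNXB]) (by simp [hu]) (by omega) ?_)
        refine wp_load (NXB + u) _ (by simp) hus' rfl ?_
        exact hhit heF _ _ (by intro i hi; simp at hi; simp [hi]) (by simp) (by simp)
          (by simp [hnr']) (by simp) (by simp) (by simp) (by simp)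
    · have hnr' : nr (u % n) = false := by
        by_contra hne
        simp [hne] at h'
      refine wp_skip (wp_seq (wp_ite (fun _ => wp_ite (fun h₃ => wp_skip ?_)
        fun h₃ => wp_const 0 (by omega) ?_) fun h'' => absurd h'' (by simp; omega)))
      all_goals
        simp at h₃
        refine wp_seq (wp_add NXB u (by simp [hNXB]) (by simp [hu]) (by omega) ?_)
        refine wp_load (NXB + u) _ (by simp) hus' rfl ?_
        exact hhit heF _ _ (by intro i hi; simp at hi; simp [hi]) (by simp) (by simp)
          (by simp [hnr', h₃, hgo]) (by simp) (by simp) (by simp) (by simp)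
  · have heF : e ≠ F := by
      intro he
      simp [he] at h
    refine wp_sub c₁ 1 (by simp [hc₁]) (by simp [h1]) (by omega) (by omega) ?_
    refine wp_seq (wp_ite (fun h₃ => wp_ite (fun _ => wp_skip ?_)
      fun h'' => absurd h'' (by simp; omega)) fun h₃ => wp_const 0 (by omega) ?_)
    all_goals
      simp at h₃
      refine wp_seq (wp_add NXB u (by simp [hNXB]) (by simp [hu]) (by omega) ?_)
      refine wp_load (NXB + u) _ (by simp) hus' rfl ?_
      exact hmiss heF _ _ (by intro i hi; simp at hi; simp [hi]) (by simp)
        (by simp [h₃, hgo]) (by simp) (by simp) (by simp) (by simp)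

/-- The chains run through each bucket in increasing order, and the end of the table serves as null
pointer. Every pass of the loop opens a table, spends a unit of a budget or stops, so there are at
most `L + cap₁ + cap₂ + 1` passes, each of cost at most 30. -/
theorem wp_scanTables {n L₁ L₂ p α β V HB FPB NXB cap₁ cap₂ : ℕ} {A B fq fp : ℕ → ℕ}
    {nr : ℕ → Bool} (hn : r 1 = n) (hL₁ : r 7 = L₁) (hL₂ : r 9 = L₂) (hp : r 11 = p)
    (hα : r 13 = α) (hβ : r 14 = β) (hV : r 15 = V) (hHB : r 16 = HB) (hFPB : r 17 = FPB)
    (hNXB : r 18 = NXB) (hc₁ : r 19 = cap₁) (hc₂ : r 20 = cap₂) (hL : r 21 = L₁ * L₂)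
    (h1 : r 22 = 1) (hw : space < 2 ^ w) (hw1 : 1 < 2 ^ w)
    (hA : ∀ i < L₁, m (V + i) = A i) (hB : ∀ i < L₂, m (V + L₁ + i) = B i)
    (hfq : ∀ l, fq l = (A (l / L₂) * α + B (l % L₂) * β) % p)
    (hAB : ∀ i < L₁, ∀ j < L₂, A i * α + B j * β < 2 ^ w)
    (hVs : V + L₁ + L₂ ≤ space) (hHs : HB + L₁ * L₂ * n ≤ space)
    (hFs : FPB + L₁ * L₂ * n ≤ space) (hNs : NXB + L₁ * L₂ * n ≤ space)
    (hhead : ∀ l < L₁ * L₂, ∀ b < n, m (HB + (l * n + b)) =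
      firstFrom (fun u => fp u % n = b) (l * n) ((l + 1) * n))
    (hfp : ∀ u < L₁ * L₂ * n, m (FPB + u) = fp u) (hfpw : ∀ u, fp u < 2 ^ w)
    (hnext : ∀ u < L₁ * L₂ * n, m (NXB + u) =
      firstFrom (fun u' => fp u' % n = fp u % n) (u + 1) ((u / n + 1) * n))
    (hn0 : 0 < n) (hp0 : 0 < p) (hpw : p < 2 ^ w) (hcap₁ : 0 < cap₁) (hcap₂ : 0 < cap₂)
    (hcap₁w : cap₁ < 2 ^ w) (hcap₂w : cap₂ < 2 ^ w) (hnw : n < 2 ^ w) (hnO : n = O.numPoints)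
    (hnr : ∀ i (h : i < O.numPoints), O.near ⟨i, h⟩ = nr i)
    (hQ : ∀ r' c', c'.evals = c.evals → c'.dists ≤ c.dists + cap₂ →
      c'.other ≤ c.other + 30 * (L₁ * L₂ + cap₁ + cap₂ + 2) →
      (ScanSucceeds n (L₁ * L₂) fq fp nr cap₁ cap₂ → r' 0 < n ∧ nr (r' 0) = true) →
      Q r' m c') :
    scanTables.wp O space Q r m c := by
  set L := L₁ * L₂ with hLdef
  set S : List ℕ := [0, 19, 20, 24, 36, 37, 38, 39, 40, 41, 43, 44, 45, 46] with hS
  have hLn : L ≤ L * n := Nat.le_mul_of_pos_right _ hn0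
  refine wp_seq (wp_const 0 (by omega) (wp_seq (wp_const 0 (by omega) (wp_seq
    (wp_const 0 (by omega) (wp_seq (wp_const 1 hw1 ?_)))))))
  -- Either the scan has stopped, or `l` tables are open, `u` is the next entry to process, every
  -- match before `u` is far, and the spent parts of the budgets are exactly the counts of
  -- `Mismatch` and `FarMatch` below `u`.
  refine wp_loop (fun v r' m' c' => m' = m ∧ AgreeOff S r r' ∧ c'.evals = c.evals ∧
    c'.other + 30 * v ≤ c.other + 30 * (L + cap₁ + cap₂ + 1) + 4 ∧
    ((r' 24 = 0 ∧ c'.dists ≤ c.dists + cap₂ ∧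
      (ScanSucceeds n L fq fp nr cap₁ cap₂ → r' 0 < n ∧ nr (r' 0) = true)) ∨
    (r' 24 = 1 ∧ ∃ l u c₁ c₂, v = L - l + c₁ + c₂ + 1 ∧ r' 36 = l ∧ r' 37 = u ∧ r' 38 = l * n ∧
      r' 19 = c₁ ∧ r' 20 = c₂ ∧ l ≤ L ∧ u ≤ l * n ∧ l * n ≤ u + n ∧ 0 < c₁ ∧ 0 < c₂ ∧
      (u < l * n → r' 41 = fq (u / n) ∧ fp u % n = fq (u / n) % n) ∧
      c₁ + Nat.count (Mismatch n fq fp) u = cap₁ ∧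
      c₂ + Nat.count (FarMatch n fq fp nr) u = cap₂ ∧
      (∀ x < u, fp x = fq (x / n) → nr (x % n) = false) ∧
      c'.dists = c.dists + Nat.count (FarMatch n fq fp nr) u))) (L + cap₁ + cap₂ + 1)
    ⟨rfl, (((((AgreeOff.refl _ _).update (by simp [hS]) _).update (by simp [hS]) _).update
      (by simp [hS]) _).update (by simp [hS]) _), by simp, by simp; omega, .inr ⟨by simp, 0, 0,
      cap₁, cap₂, by omega, by simp, by simp, by simp, by simp [hc₁], by simp [hc₂], by omega,
      by omega, by omega, hcap₁, hcap₂, by simp, by simp, by simp, by simp, by simp⟩⟩ ?_ ?_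
  · rintro v r' m c' ⟨rfl, hr, he, ho, h | h⟩ h0
    · exact hQ _ _ (by simp [he]) (by simpa using h.2.1) (by simp; omega) h.2.2
    · omega
  · rintro v r' m c' ⟨rfl, hr, he, ho, h | ⟨h24, l, u, c₁, c₂, hv, h36, h37, h38, h19, h20, hlL,
      hul, hlu, hc₁0, hc₂0, hbucket, hcount₁, hcount₂, hfar, hd⟩⟩ h0
    · omega
    have hln : l * n ≤ L * n := Nat.mul_le_mul_right _ hlL
    have hlw : l ≤ l * n := Nat.le_mul_of_pos_right _ hn0
    refine wp_seq (wp_lt u (l * n) h37 h38 (by omega) (by omega) hw1 (wp_ite (fun h => ?_)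
      fun h => ?_))
    · have hu : u < l * n := by
        by_contra hne
        simp [hne] at h
      obtain ⟨h41, hb⟩ := hbucket hu
      have hl0 : 0 < l := Nat.pos_of_ne_zero fun h => by simp [h] at hu
      obtain ⟨l, rfl⟩ : ∃ l', l = l' + 1 := ⟨l - 1, by omega⟩
      have hdiv : u / n = l := Nat.div_eq_of_lt_le (by rw [Nat.succ_mul] at hlu; omega) hu
      have huL : u < L * n := by omega
      have hsucc : u + 1 ≤ (l + 1) * n := hu
      have hu₁ := le_firstFrom (Q := fun u' => fp u' % n = fp u % n) hsucc
      have hu₂ := firstFrom_le (Q := fun u' => fp u' % n = fp u % n) hsucc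
      have hnx := hnext u huL
      rw [hdiv] at hnx hb h41
      have hu₃ := firstFrom_spec (Q := fun u' => fp u' % n = fp u % n) hsucc
      have hu₄ := fun x => not_of_lt_firstFrom (Q := fun u' => fp u' % n = fp u % n)
        (lo := u + 1) (hi := (l + 1) * n) (u := x)
      rw [← hnx] at hu₁ hu₂ hu₃ hu₄
      set u' := m (NXB + u) with hu'
      have hdiv' : ∀ x, u ≤ x → x < (l + 1) * n → x / n = l := fun x h₁ h₂ =>
        Nat.div_eq_of_lt_le (by rw [Nat.succ_mul] at hlu; omega) h₂
      -- Entries between `u` and its successor lie in other buckets, so they are neither mismatches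
      -- nor matches.
      have hskip : ∀ x, u + 1 ≤ x → x < u' → fp x % n ≠ fq (x / n) % n := by
        intro x h₁ h₂
        rw [hdiv' x (by omega) (by omega), ← hb]
        exact hu₄ x h₁ h₂
      have hs₁ : Nat.count (Mismatch n fq fp) u' = Nat.count (Mismatch n fq fp) (u + 1) :=
        Nat.count_eq_of_forall_not hu₁ fun x h₁ h₂ h₃ => hskip x h₁ h₂ h₃.1
      have hs₂ : Nat.count (FarMatch n fq fp nr) u' = Nat.count (FarMatch n fq fp nr) (u + 1) :=
        Nat.count_eq_of_forall_not hu₁ fun x h₁ h₂ h₃ => hskip x h₁ h₂ (by rw [h₃.1])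
      have hmono₁ := Nat.count_monotone (Mismatch n fq fp) (show u + 1 ≤ L * n by omega)
      have hmono₂ := Nat.count_monotone (FarMatch n fq fp nr) (show u + 1 ≤ L * n by omega)
      have hfar' : nr (u % n) = false ∨ fp u ≠ fq l → ∀ x < u', fp x = fq (x / n) →
          nr (x % n) = false := by
        intro hor x hx hxe
        rcases lt_trichotomy x u with hxu | rfl | hxu
        · exact hfar x hxu hxe
        · rw [hdiv] at hxe
          exact hor.resolve_right (not_not.2 hxe)
        · exact absurd (by rw [hxe]) (hskip x hxu hx)
      have hbucket' : u' < (l + 1) * n → fq l = fq (u' / n) ∧ fp u' % n = fq (u' / n) % n := by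
        intro h'
        rw [hdiv' u' (by omega) h', ← hb]
        exact ⟨rfl, hu₃ h'⟩
      have g : ∀ i, i ≠ 39 → Function.update r' 39 (if u < (l + 1) * n then 1 else 0) i = r' i :=
        fun i hi => Function.update_of_ne hi _ _
      refine wp_processEntry (n := n) (FPB := FPB) (NXB := NXB) (u := u) (e := fp u) (F := fq l)
        (c₁ := c₁) (c₂ := c₂) (nr := nr) ?_ ?_ ?_ ?_ ?_ ?_ ?_ ?_ ?_ (hfp u huL) hc₁0 hc₂0
        (by omega) (by omega) hw hw1
        (by omega) (by omega) (hfpw u) (by rw [hfq]; exact (Nat.mod_lt _ hp0).trans hpw) hn0 hnw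
        hnO hnr ?_ ?_
      · rw [g 1 (by simp), hr 1 (by simp [hS]), hn]
      · rw [g 17 (by simp), hr 17 (by simp [hS]), hFPB]
      · rw [g 18 (by simp), hr 18 (by simp [hS]), hNXB]
      · rw [g 19 (by simp), h19]
      · rw [g 20 (by simp), h20]
      · rw [g 22 (by simp), hr 22 (by simp [hS]), h1]
      · rw [g 24 (by simp), h24]
      · rw [g 37 (by simp), h37]
      · rw [g 41 (by simp), h41]
      · intro hne r₁ c' hr₁ h19' h24' h37' he' hd' ho'
        have hs₁' : Nat.count (Mismatch n fq fp) (u + 1) = Nat.count (Mismatch n fq fp) u + 1 := by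
          rw [Nat.count_succ, if_pos]
          exact ⟨by rw [hdiv, hb], by rwa [hdiv]⟩
        have hs₂' : Nat.count (FarMatch n fq fp nr) (u + 1) =
            Nat.count (FarMatch n fq fp nr) u := by
          rw [Nat.count_succ, if_neg, Nat.add_zero]
          rintro ⟨h₁, -⟩
          rw [hdiv] at h₁
          exact hne h₁
        refine ⟨L - (l + 1) + (c₁ - 1) + c₂ + 1, by omega, rfl,
          (hr.update (by simp [hS]) _).trans hr₁ (by simp [hS]), by simp [he', he], ?_, ?_⟩
        · simp at ho'
          omega
        · simp only [Cost.add_dists] at hd'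
          -- An exhausted budget means that `cap₁` mismatches were seen, against the strict
          -- inequality `mismatch_lt`.
          by_cases hz : c₁ - 1 = 0
          · refine .inl ⟨by rw [h24', if_pos hz], by omega, fun hs => ?_⟩
            have := hs.mismatch_lt
            omega
          · refine .inr ⟨by rw [h24', if_neg hz], l + 1, u', c₁ - 1, c₂, rfl, ?_, h37', ?_, h19',
              ?_, hlL, hu₂, ?_, by omega, hc₂0, fun h' => ?_, by omega, by omega,
              hfar' (.inr hne), by omega⟩
            · rw [hr₁ 36 (by simp), g 36 (by simp), h36]
            · rw [hr₁ 38 (by simp), g 38 (by simp), h38]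
            · rw [hr₁ 20 (by simp), g 20 (by simp), h20]
            · omega
            · rw [hr₁ 41 (by simp), g 41 (by simp), h41]
              exact hbucket' h'
      · intro heq r₁ c' hr₁ h0' h20' h24' h37' he' hd' ho'
        have hs₁' : Nat.count (Mismatch n fq fp) (u + 1) = Nat.count (Mismatch n fq fp) u := by
          rw [Nat.count_succ, if_neg, Nat.add_zero]
          rintro ⟨-, h₁⟩
          rw [hdiv] at h₁
          exact h₁ heq
        refine ⟨L - (l + 1) + c₁ + (c₂ - 1) + 1, by omega, rfl,
          (hr.update (by simp [hS]) _).trans hr₁ (by simp [hS]), by simp [he', he], ?_, ?_⟩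
        · simp at ho'
          omega
        · simp only [Cost.add_dists] at hd'
          by_cases hnear : nr (u % n) = true
          · refine .inl ⟨by rw [h24', if_pos (.inl hnear)], by omega, fun _ => ?_⟩
            rw [h0']
            exact ⟨Nat.mod_lt _ hn0, hnear⟩
          · simp only [Bool.not_eq_true] at hnear
            have hs₂' : Nat.count (FarMatch n fq fp nr) (u + 1) =
                Nat.count (FarMatch n fq fp nr) u + 1 := by
              rw [Nat.count_succ, if_pos]
              exact ⟨by rw [hdiv, heq], hnear⟩
            -- Likewise `cap₂` far matches contradict `farMatch_lt`.
            by_cases hz : c₂ - 1 = 0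
            · refine .inl ⟨by rw [h24', if_pos (.inr hz)], by omega, fun hs => ?_⟩
              have := hs.farMatch_lt
              omega
            · refine .inr ⟨by rw [h24', if_neg (by simp [hnear, hz])], l + 1, u', c₁, c₂ - 1, rfl,
                ?_, h37', ?_, ?_, h20', hlL, hu₂, ?_, hc₁0, by omega, fun h' => ?_, by omega,
                by omega, hfar' (.inl hnear), by omega⟩
              · rw [hr₁ 36 (by simp), g 36 (by simp), h36]
              · rw [hr₁ 38 (by simp), g 38 (by simp), h38]
              · rw [hr₁ 19 (by simp), g 19 (by simp), h19]
              · omega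
              · rw [hr₁ 41 (by simp), g 41 (by simp), h41]
                exact hbucket' h'
    · have hu : u = l * n := by
        by_contra hne
        rw [if_pos (by omega)] at h
        simp at h
      refine wp_seq (wp_lt l L (by simp [h36]) (by simp [hr 21 (by simp [hS]), hL]) (by omega)
        (by omega) hw1 (wp_ite (fun h => ?_) fun h => ?_))
      · have hl : l < L := by
          by_contra hne
          simp [hne] at h
        have hL₂0 : 0 < L₂ := Nat.pos_of_ne_zero fun h => by
          rw [hLdef, h, Nat.mul_zero] at hl; omega
        have hdivL : l / L₂ < L₁ := Nat.div_lt_of_lt_mul (by rwa [Nat.mul_comm])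
        have hmodL : l % L₂ < L₂ := Nat.mod_lt _ hL₂0
        have g : ∀ i, i ∉ S → Function.update (Function.update r' 39
            (if u < l * n then 1 else 0)) 39 (if l < L then 1 else 0) i = r i :=
          ((hr.update (by simp [hS]) _).update (by simp [hS]) _)
        have g' : ∀ i, i ≠ 39 → Function.update (Function.update r' 39
            (if u < l * n then 1 else 0)) 39 (if l < L then 1 else 0) i = r' i := by
          intro i hi
          simp [hi]
        refine wp_openTable (n := n) (L₁ := L₁) (L₂ := L₂) (l := l) ((g 1 (by simp [hS])).trans hn)
          ((g 7 (by simp [hS])).trans hL₁) ((g 9 (by simp [hS])).trans hL₂)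
          ((g 11 (by simp [hS])).trans hp) ((g 13 (by simp [hS])).trans hα)
          ((g 14 (by simp [hS])).trans hβ) ((g 15 (by simp [hS])).trans hV)
          ((g 16 (by simp [hS])).trans hHB) ((g 22 (by simp [hS])).trans h1)
          ((g' 36 (by simp)).trans h36) hw (hA _ hdivL) (hB _ hmodL) hl hVs (hAB _ hdivL _ hmodL)
          hn0 hp0 hpw hHs fun r₁ c₁' hr₁ h36' h38' h41' h37' hc' => ?_
        rw [← hfq] at h41' h37'
        rw [hhead l hl _ (Nat.mod_lt _ hn0)] at h37'
        have hle : l * n ≤ (l + 1) * n := Nat.mul_le_mul_right _ l.le_succ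
        have hu₁ := le_firstFrom (Q := fun u => fp u % n = fq l % n) hle
        have hu₂ := firstFrom_le (Q := fun u => fp u % n = fq l % n) hle
        have hu₃ := firstFrom_spec (Q := fun u => fp u % n = fq l % n) hle
        have hu₄ := fun x => not_of_lt_firstFrom (Q := fun u => fp u % n = fq l % n)
          (lo := l * n) (hi := (l + 1) * n) (u := x)
        set u' := firstFrom (fun u => fp u % n = fq l % n) (l * n) ((l + 1) * n) with hu'
        have hdiv' : ∀ x, l * n ≤ x → x < (l + 1) * n → x / n = l := fun x h₁ h₂ =>
          Nat.div_eq_of_lt_le h₁ h₂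
        have hskip : ∀ x, u ≤ x → x < u' → fp x % n ≠ fq (x / n) % n := by
          intro x h₁ h₂
          rw [hdiv' x (by omega) (by omega)]
          exact hu₄ x (by omega) h₂
        have hs₁ : Nat.count (Mismatch n fq fp) u' = Nat.count (Mismatch n fq fp) u :=
          Nat.count_eq_of_forall_not (by omega) fun x h₁ h₂ h₃ => hskip x h₁ h₂ h₃.1
        have hs₂ : Nat.count (FarMatch n fq fp nr) u' = Nat.count (FarMatch n fq fp nr) u :=
          Nat.count_eq_of_forall_not (by omega) fun x h₁ h₂ h₃ => hskip x h₁ h₂ (by rw [h₃.1])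
        subst hc'
        refine ⟨L - (l + 1) + c₁ + c₂ + 1, by omega, rfl,
          ((hr.update (by simp [hS]) _).update (by simp [hS]) _).trans hr₁ (by simp [hS]),
          by simp [he], by simp; omega, .inr ⟨?_, l + 1, u', c₁, c₂, rfl, h36', h37', h38', ?_, ?_,
          hl, hu₂, ?_, hc₁0, hc₂0, fun h' => ?_, by omega, by omega, fun x hx hxe => ?_,
          by simp; omega⟩⟩
        · rw [hr₁ 24 (by simp), g' 24 (by simp), h24]
        · rw [hr₁ 19 (by simp), g' 19 (by simp), h19]
        · rw [hr₁ 20 (by simp), g' 20 (by simp), h20]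
        · rw [Nat.succ_mul]; omega
        · rw [hdiv' u' hu₁ h']
          exact ⟨h41', hu₃ h'⟩
        · by_cases hxu : x < u
          · exact hfar x hxu hxe
          · exact absurd (by rw [hxe]) (hskip x (by omega) hx)
      · have hl : l = L := by
          by_contra hne
          simp [show l < L by omega] at h
        subst hl
        refine wp_const 0 (by omega) ⟨0, by omega, rfl,
          (((hr.update (by simp [hS]) _).update (by simp [hS]) _).update (by simp [hS]) _),
          by simp [he], by simp; omega, .inl ⟨by simp, by simp; omega, fun hs => ?_⟩⟩
        -- All tables are exhausted and every match in them was far, so the promised near match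
        -- cannot exist.
        obtain ⟨x, hx, hxe, hxn⟩ := hs.exists_match
        rw [hfar x (by omega) hxe] at hxn
        simp at hxn

end Prog

/-! ## Memory layout -/

/-- The parameters of the data structure: `L₁ * L₂` hash tables, where table `l` is indexed by the
concatenation of a `k₁`-tuple (number `l / L₂`) and a `k₂`-tuple (number `l % L₂`) of hash values.
Coordinate `i` of tuple `l` is given by the hash function with number `idxA l i` or `idxB l i`.
If `cached` holds, then the query first stores the values of all functions in its work memory. -/
structure Layout where
  (n L₁ L₂ k₁ k₂ numHash H p cap₁ cap₂ : ℕ)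
  cached : Bool
  (idxA idxB : ℕ → ℕ → ℕ)

namespace Layout

variable (T : Layout)

/-- The number of entries of all tables together. -/
def entries : ℕ := T.L₁ * T.L₂ * T.n

/-- The total length of all tuples. -/
def positions : ℕ := T.L₁ * T.k₁ + T.L₂ * T.k₂

/-- The size of the list of the numbers of hash functions in all tuples. -/
def listSize : ℕ := if T.cached then T.positions else 0

/-- The size of the cache of hash values. -/
def cacheSize : ℕ := if T.cached then T.numHash else 0

/-- The address of the heads of the buckets. -/
def headBase : ℕ := 21 + T.listSize

/-- The address of the fingerprints of the entries. -/
def fpBase : ℕ := T.headBase + T.entries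

/-- The address of the successors of the entries in their buckets. -/
def nextBase : ℕ := T.fpBase + T.entries

/-- The size of the table that preprocessing builds. -/
def tableSize : ℕ := T.nextBase + T.entries

/-- The address at which the query stores the digests of the tuples. -/
def digestBase : ℕ := T.tableSize + T.cacheSize

/-- The size of the work memory. -/
def workSize : ℕ := T.cacheSize + (T.L₁ + T.L₂)

/-- The number of the hash function in position `j` of the concatenation of all tuples. -/
def idx (j : ℕ) : ℕ :=
  if j < T.L₁ * T.k₁ then T.idxA (j / T.k₁) (j % T.k₁)
  else T.idxB ((j - T.L₁ * T.k₁) / T.k₂) ((j - T.L₁ * T.k₁) % T.k₂)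

/-- The digest of the first tuple number `l` of a point with hash values `v`. -/
def digestA (a : ℕ) (v : ℕ → ℕ) (l : ℕ) : ℕ := digest T.H T.p a (fun i => v (T.idxA l i)) T.k₁

/-- The digest of the second tuple number `l` of a point with hash values `v`. -/
def digestB (a : ℕ) (v : ℕ → ℕ) (l : ℕ) : ℕ := digest T.H T.p a (fun i => v (T.idxB l i)) T.k₂

/-- The fingerprint, for table `l`, of a point with hash values `v`. -/
def fingerprint (z : ℕ × ℕ × ℕ) (v : ℕ → ℕ) (l : ℕ) : ℕ :=
  (T.digestA z.1 v (l / T.L₂) * z.2.1 + T.digestB z.1 v (l % T.L₂) * z.2.2) % T.p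

/-- The fingerprint of the entry `u` if data point `i` has hash values `v i`. -/
def entryFp (z : ℕ × ℕ × ℕ) (v : ℕ → ℕ → ℕ) (u : ℕ) : ℕ := T.fingerprint z (v (u % T.n)) (u / T.n)

/-- The constants that the query program loads first. -/
def header (z : ℕ × ℕ × ℕ) : List ℕ :=
  [T.n, T.cacheSize, T.tableSize, if T.cached then 1 else 0, 21, T.k₁, T.L₁, T.k₂, T.L₂, T.H, T.p,
    z.1, z.2.1, z.2.2, T.digestBase, T.headBase, T.fpBase, T.nextBase, T.cap₁, T.cap₂,
    T.L₁ * T.L₂]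

/-- The contents of the table. -/
noncomputable def cell (z : ℕ × ℕ × ℕ) (v : ℕ → ℕ → ℕ) (x : ℕ) : ℕ :=
  if x < 21 then (T.header z).getD x 0
  else if x < T.headBase then T.idx (x - 21)
  else if x < T.fpBase then
    firstFrom (fun u => T.entryFp z v u % T.n = (x - T.headBase) % T.n)
      ((x - T.headBase) / T.n * T.n) (((x - T.headBase) / T.n + 1) * T.n)
  else if x < T.nextBase then T.entryFp z v (x - T.fpBase)
  else firstFrom (fun u => T.entryFp z v u % T.n = T.entryFp z v (x - T.nextBase) % T.n)
    (x - T.nextBase + 1) (((x - T.nextBase) / T.n + 1) * T.n)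

/-- Everything fits into words of length `w`, and the numbers of hash functions are valid. -/
structure Fits (w : ℕ) : Prop where
  n_pos : 0 < T.n
  L₁_pos : 0 < T.L₁
  L₂_pos : 0 < T.L₂
  p_pos : 0 < T.p
  cap₁_pos : 0 < T.cap₁
  cap₂_pos : 0 < T.cap₂
  H_pos : 0 < T.H
  space_lt : T.tableSize + T.workSize < 2 ^ w
  positions_lt : T.positions + T.k₁ + T.k₂ < 2 ^ w
  numHash_lt : T.numHash < 2 ^ w
  cap₁_lt : T.cap₁ < 2 ^ w
  cap₂_lt : T.cap₂ < 2 ^ w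
  pH_lt : 2 * (T.p * T.H) < 2 ^ w
  idxA_lt : ∀ l < T.L₁, ∀ i < T.k₁, T.idxA l i < T.numHash
  idxB_lt : ∀ l < T.L₂, ∀ i < T.k₂, T.idxB l i < T.numHash
  idxA_eq : T.cached = false → ∀ l < T.L₁, ∀ i < T.k₁, T.idxA l i = l * T.k₁ + i
  idxB_eq : T.cached = false → ∀ l < T.L₂, ∀ i < T.k₂, T.idxB l i = T.L₁ * T.k₁ + (l * T.k₂ + i)
  positions_le : T.cached = false → T.positions ≤ T.numHash

variable {T} {w : ℕ}

theorem idx_A {l i : ℕ} (hl : l < T.L₁) (hi : i < T.k₁) : T.idx (l * T.k₁ + i) = T.idxA l i := by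
  have h : l * T.k₁ + i < T.L₁ * T.k₁ := by
    have := Nat.mul_le_mul_right T.k₁ (Nat.succ_le_of_lt hl)
    rw [Nat.succ_mul] at this
    omega
  have hk : 0 < T.k₁ := by omega
  rw [idx, if_pos h, Nat.mul_comm, Nat.mul_add_div hk, Nat.mul_add_mod, Nat.div_eq_of_lt hi,
    Nat.mod_eq_of_lt hi, Nat.add_zero]

theorem idx_B {l i : ℕ} (hi : i < T.k₂) :
    T.idx (T.L₁ * T.k₁ + (l * T.k₂ + i)) = T.idxB l i := by
  have hk : 0 < T.k₂ := by omega
  rw [idx, if_neg (by omega), Nat.add_sub_cancel_left, Nat.mul_comm, Nat.mul_add_div hk,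
    Nat.mul_add_mod, Nat.div_eq_of_lt hi, Nat.mod_eq_of_lt hi, Nat.add_zero]

theorem exists_of_lt_mul {j l k : ℕ} (h : j < l * k) : ∃ a < l, ∃ b < k, j = a * k + b := by
  have hk : 0 < k := Nat.pos_of_ne_zero fun e => by simp [e] at h
  exact ⟨j / k, Nat.div_lt_of_lt_mul (by rwa [Nat.mul_comm]), j % k, Nat.mod_lt _ hk,
    (Nat.div_add_mod' j k).symm⟩

theorem exists_position {j : ℕ} (h : j < T.positions) :
    (∃ l < T.L₁, ∃ i < T.k₁, j = l * T.k₁ + i) ∨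
      ∃ l < T.L₂, ∃ i < T.k₂, j = T.L₁ * T.k₁ + (l * T.k₂ + i) := by
  by_cases h' : j < T.L₁ * T.k₁
  · exact .inl (exists_of_lt_mul h')
  · rw [positions] at h
    obtain ⟨l, hl, i, hi, e⟩ := exists_of_lt_mul (show j - T.L₁ * T.k₁ < T.L₂ * T.k₂ by omega)
    exact .inr ⟨l, hl, i, hi, by omega⟩

theorem Fits.idx_lt (hT : T.Fits w) {j : ℕ} (h : j < T.positions) : T.idx j < T.numHash := by
  rcases exists_position h with ⟨l, hl, i, hi, rfl⟩ | ⟨l, hl, i, hi, rfl⟩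
  · rw [idx_A hl hi]; exact hT.idxA_lt l hl i hi
  · rw [idx_B hi]; exact hT.idxB_lt l hl i hi

theorem Fits.idx_eq (hT : T.Fits w) (hc : T.cached = false) {j : ℕ} (h : j < T.positions) :
    T.idx j = j := by
  rcases exists_position h with ⟨l, hl, i, hi, rfl⟩ | ⟨l, hl, i, hi, rfl⟩
  · rw [idx_A hl hi, hT.idxA_eq hc l hl i hi]
  · rw [idx_B hi, hT.idxB_eq hc l hl i hi]

theorem fingerprint_lt (hp : 0 < T.p) (z : ℕ × ℕ × ℕ) (v : ℕ → ℕ) (l : ℕ) :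
    T.fingerprint z v l < T.p := Nat.mod_lt _ hp

theorem Fits.p_lt (hT : T.Fits w) : T.p < 2 ^ w := by
  have := Nat.le_mul_of_pos_right T.p hT.H_pos
  have := hT.pH_lt
  omega

theorem Fits.H_lt (hT : T.Fits w) : T.H < 2 ^ w := by
  have := Nat.le_mul_of_pos_left T.H hT.p_pos
  have := hT.pH_lt
  omega

theorem cell_header {z : ℕ × ℕ × ℕ} {v : ℕ → ℕ → ℕ} {x : ℕ} (hx : x < 21) :
    T.cell z v x = (T.header z).getD x 0 := if_pos hx

theorem cell_list {z : ℕ × ℕ × ℕ} {v : ℕ → ℕ → ℕ} {j : ℕ} (hj : j < T.listSize) :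
    T.cell z v (21 + j) = T.idx j := by
  rw [cell, if_neg (by omega), if_pos (by rw [headBase]; omega), Nat.add_sub_cancel_left]

theorem cell_head {z : ℕ × ℕ × ℕ} {v : ℕ → ℕ → ℕ} {l b : ℕ} (hl : l < T.L₁ * T.L₂)
    (hb : b < T.n) : T.cell z v (T.headBase + (l * T.n + b)) =
      firstFrom (fun u => T.entryFp z v u % T.n = b) (l * T.n) ((l + 1) * T.n) := by
  have h : l * T.n + b < T.entries := by
    have := Nat.mul_le_mul_right T.n (Nat.succ_le_of_lt hl)
    rw [Nat.succ_mul] at this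
    rw [entries]; omega
  have hdiv : (l * T.n + b) / T.n = l := by
    rw [Nat.mul_comm, Nat.mul_add_div (by omega), Nat.div_eq_of_lt hb, Nat.add_zero]
  have hmod : (l * T.n + b) % T.n = b := by
    rw [Nat.mul_comm, Nat.mul_add_mod, Nat.mod_eq_of_lt hb]
  rw [cell, if_neg (by rw [headBase]; omega), if_neg (by omega), if_pos (by rw [fpBase]; omega),
    Nat.add_sub_cancel_left, hdiv, hmod]

theorem cell_fp {z : ℕ × ℕ × ℕ} {v : ℕ → ℕ → ℕ} {u : ℕ} (hu : u < T.entries) :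
    T.cell z v (T.fpBase + u) = T.entryFp z v u := by
  rw [cell, if_neg (by rw [fpBase, headBase]; omega), if_neg (by rw [fpBase]; omega),
    if_neg (by omega), if_pos (by rw [nextBase]; omega), Nat.add_sub_cancel_left]

theorem cell_next {z : ℕ × ℕ × ℕ} {v : ℕ → ℕ → ℕ} {u : ℕ} :
    T.cell z v (T.nextBase + u) = firstFrom
      (fun u' => T.entryFp z v u' % T.n = T.entryFp z v u % T.n) (u + 1) ((u / T.n + 1) * T.n) := by
  rw [cell, if_neg (by rw [nextBase, fpBase, headBase]; omega),
    if_neg (by rw [nextBase, fpBase]; omega), if_neg (by rw [nextBase]; omega),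
    if_neg (by omega), Nat.add_sub_cancel_left]

theorem listSize_le : T.listSize ≤ T.positions := by
  rw [listSize]; split_ifs <;> omega

/-- Chain pointers never exceed the number of entries and fingerprints stay below `p`. Hence storing
a cell as a word loses nothing. -/
theorem Fits.cell_lt (hT : T.Fits w) {z : ℕ × ℕ × ℕ} (hz₁ : z.1 < T.H) (hz₂ : z.2.1 < T.H)
    (hz₃ : z.2.2 < T.H) (v : ℕ → ℕ → ℕ) {x : ℕ} (hx : x < T.tableSize) :
    T.cell z v x < 2 ^ w := by
  have hs := hT.space_lt
  have hn := hT.n_pos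
  have hL : 0 < T.L₁ * T.L₂ := Nat.mul_pos hT.L₁_pos hT.L₂_pos
  have hent : T.entries = T.L₁ * T.L₂ * T.n := rfl
  have hn' : T.n ≤ T.entries := Nat.le_mul_of_pos_left _ hL
  have hL' : T.L₁ * T.L₂ ≤ T.entries := Nat.le_mul_of_pos_right _ hn
  have e₁ : T.tableSize = T.nextBase + T.entries := rfl
  have e₂ : T.nextBase = T.fpBase + T.entries := rfl
  have e₃ : T.fpBase = T.headBase + T.entries := rfl
  have e₄ : T.headBase = 21 + T.listSize := rfl
  have e₅ : T.digestBase = T.tableSize + T.cacheSize := rfl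
  have e₆ : T.workSize = T.cacheSize + (T.L₁ + T.L₂) := rfl
  have hp := hT.p_lt
  have hH := hT.H_lt
  have hpos := hT.positions_lt
  have hend : ∀ u < T.entries, (u / T.n + 1) * T.n ≤ T.entries := fun u hu =>
    Nat.mul_le_mul_right _ (Nat.div_lt_of_lt_mul (by rwa [Nat.mul_comm]))
  by_cases h₁ : x < 21
  · rw [cell_header h₁]
    have h₂ := hT.cap₁_lt
    have h₃ := hT.cap₂_lt
    interval_cases x <;> simp only [header, List.getD_cons_zero, List.getD_cons_succ] <;>
      first | omega | (split_ifs <;> omega)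
  by_cases h₂ : x < T.headBase
  · obtain ⟨j, rfl⟩ := Nat.exists_eq_add_of_le (Nat.le_of_not_lt h₁)
    rw [cell_list (by omega)]
    exact (hT.idx_lt ((show j < T.listSize by omega).trans_le listSize_le)).trans hT.numHash_lt
  by_cases h₃ : x < T.fpBase
  · rw [cell, if_neg h₁, if_neg h₂, if_pos h₃]
    refine (firstFrom_le (Nat.mul_le_mul_right _ (Nat.le_succ _))).trans_lt
      ((hend _ (by omega)).trans_lt (by omega))
  by_cases h₄ : x < T.nextBase
  · rw [cell, if_neg h₁, if_neg h₂, if_neg h₃, if_pos h₄]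
    exact (fingerprint_lt hT.p_pos _ _ _).trans hp
  · rw [cell, if_neg h₁, if_neg h₂, if_neg h₃, if_neg h₄]
    refine (firstFrom_le ?_).trans_lt ((hend _ (by omega)).trans_lt (by omega))
    have := Nat.lt_div_mul_add hn (a := x - T.nextBase)
    rw [Nat.succ_mul]
    omega

variable {O : Oracle w}

/-- The query program halts within its budget, does not change the table, and finds a near point
under the conditions of `ScanSucceeds`. -/
theorem Fits.exec_query (hT : T.Fits w) (hO : O.numHash = T.numHash) (hOn : O.numPoints = T.n)
    {z : ℕ × ℕ × ℕ} (hz₁ : z.1 < T.H) (hz₂ : z.2.1 < T.H) (hz₃ : z.2.2 < T.H) (v : ℕ → ℕ → ℕ)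
    {hv : ℕ → ℕ} (hhv : ∀ j (h : j < O.numHash), (O.hash ⟨j, h⟩).toNat = hv j)
    (hvw : ∀ j, hv j < 2 ^ w) {nr : ℕ → Bool}
    (hnr : ∀ i (h : i < O.numPoints), O.near ⟨i, h⟩ = nr i)
    (s : RAMState w) (hs : ∀ x < T.tableSize, s.memNat x = T.cell z v x) :
    ∃ c s', Exec O (T.tableSize + T.workSize) Prog.query s c s' ∧
      (∀ x < T.tableSize, s'.memNat x = s.memNat x) ∧ c.evals ≤ T.numHash ∧ c.dists ≤ T.cap₂ ∧
      c.other ≤ 115 + 5 * T.cacheSize + 24 * T.positions + 9 * (T.L₁ + T.L₂) +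
        30 * (T.L₁ * T.L₂ + T.cap₁ + T.cap₂) ∧
      (ScanSucceeds T.n (T.L₁ * T.L₂) (T.fingerprint z hv) (T.entryFp z v) nr T.cap₁ T.cap₂ →
        s'.regNat 0 < T.n ∧ nr (s'.regNat 0) = true) := by
  have hspace := hT.space_lt
  have hn := hT.n_pos
  have hL : 0 < T.L₁ * T.L₂ := Nat.mul_pos hT.L₁_pos hT.L₂_pos
  have hent : T.entries = T.L₁ * T.L₂ * T.n := rfl
  have hn' : T.n ≤ T.entries := Nat.le_mul_of_pos_left _ hL
  have e₁ : T.tableSize = T.nextBase + T.entries := rfl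
  have e₂ : T.nextBase = T.fpBase + T.entries := rfl
  have e₃ : T.fpBase = T.headBase + T.entries := rfl
  have e₄ : T.headBase = 21 + T.listSize := rfl
  have e₅ : T.digestBase = T.tableSize + T.cacheSize := rfl
  have e₆ : T.workSize = T.cacheSize + (T.L₁ + T.L₂) := rfl
  have e₇ : T.positions = T.L₁ * T.k₁ + T.L₂ * T.k₂ := rfl
  have hp := hT.p_lt
  have hpH := hT.pH_lt
  have hpos := hT.positions_lt
  have hw1 : 1 < 2 ^ w := by omega
  set S := T.tableSize + T.workSize with hS
  set m := s.memNat with hm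
  suffices h : Prog.query.wp O S (fun r' m' c => (∀ x < T.tableSize, m' x = m x) ∧
      c.evals ≤ T.numHash ∧ c.dists ≤ T.cap₂ ∧
      c.other ≤ 115 + 5 * T.cacheSize + 24 * T.positions + 9 * (T.L₁ + T.L₂) +
        30 * (T.L₁ * T.L₂ + T.cap₁ + T.cap₂) ∧
      (ScanSucceeds T.n (T.L₁ * T.L₂) (T.fingerprint z hv) (T.entryFp z v) nr T.cap₁ T.cap₂ →
        r' 0 < T.n ∧ nr (r' 0) = true)) s.regNat m 0 by
    obtain ⟨c, s', he, hQ⟩ := Prog.wp_sound _ _ _ _ h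
    rw [Cost.zero_add] at hQ
    exact ⟨c, s', he, hQ⟩
  set f : ℕ := if T.cached then 1 else 0 with hf
  refine Prog.wp_seq (Prog.wp_fetchAll 21 (by omega) (by omega) (by omega) fun r₀ hr₀ => ?_)
  have hh : ∀ i < 21, r₀ (i + 1) = (T.header z).getD i 0 := fun i hi => by
    rw [hr₀ i hi, hs i (by omega), cell_header hi]
  refine Prog.wp_seq (Prog.wp_const 1 hw1 ?_)
  set r₁ := Function.update r₀ 22 1 with hr₁
  have g : ∀ i < 21, r₁ (i + 1) = (T.header z).getD i 0 := fun i hi => by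
    rw [hr₁, Function.update_of_ne (by omega), hh i hi]
  have g22 : r₁ 22 = 1 := by simp [hr₁]
  have hcacheO : T.cacheSize ≤ O.numHash := by
    rw [hO, cacheSize]; split_ifs <;> omega
  refine Prog.wp_seq (Prog.wp_cacheValues hhv (g 1 (by omega)) (g 2 (by omega)) g22 hcacheO
    (by simp [header]; omega) hspace hw1 fun r₂ m₂ c₂ hr₂ hm₂ hm₂' he₂ hd₂ ho₂ => ?_)
  simp only [header, List.getD_cons_succ, List.getD_cons_zero] at hm₂ hm₂' he₂ ho₂
  refine Prog.wp_seq (Prog.wp_const 0 (by omega) (Prog.wp_seq (Prog.wp_const 0 (by omega)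
    (Prog.wp_seq (Prog.wp_add T.digestBase 0 ?_ (by simp) (by omega) ?_)))))
  · rw [Function.update_of_ne (by omega), Function.update_of_ne (by omega),
      hr₂ 15 (by simp), g 14 (by omega)]
    rfl
  set r₃ := Function.update (Function.update (Function.update r₂ 28 0) 23 0) 29 (T.digestBase + 0)
    with hr₃
  have G : ∀ i < 22, r₃ (i + 1) = r₁ (i + 1) := fun i hi => by
    rw [hr₃, Function.update_of_ne (by omega), Function.update_of_ne (by omega),
      Function.update_of_ne (by omega), hr₂ (i + 1) (by simp; omega)]
  have hfcached : f ≠ 0 → T.listSize = T.positions ∧ T.cacheSize = T.numHash := fun h => by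
    have hc : T.cached = true := by
      by_contra hc
      simp [hf, hc] at h
    simp [listSize, cacheSize, hc]
  have hfuncached : f = 0 → T.cached = false := fun h => by
    by_contra hc
    simp [hf, hc] at h
  -- The memory `m'` is arbitrary from `digestBase` on, so this also applies after the digests of
  -- the first tuples have been written.
  have hcached : ∀ m' : ℕ → ℕ, (∀ x < T.digestBase, m' x = m₂ x) → f ≠ 0 →
      ∀ j < T.positions, 21 + j < T.digestBase ∧ T.tableSize + T.idx j < T.digestBase ∧
        m' (21 + j) = T.idx j ∧ m' (T.tableSize + T.idx j) = hv (T.idx j) := by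
    intro m' hm' h j hj
    obtain ⟨h₁, h₂⟩ := hfcached h
    have h₃ := hT.idx_lt hj
    refine ⟨by omega, by omega, ?_, ?_⟩
    · rw [hm' _ (by omega), hm₂' _ (by omega), hs _ (by omega), cell_list (by omega)]
    · rw [hm' _ (by omega), hm₂ _ (by omega)]
  have huncached : f = 0 → ∀ j < T.positions, T.idx j = j ∧ j < O.numHash := by
    intro h j hj
    have hc := hfuncached h
    have := hT.positions_le hc
    exact ⟨hT.idx_eq hc hj, by omega⟩
  have hpH' : T.p * T.H < 2 ^ w := by omega
  have hnum := hT.numHash_lt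
  refine Prog.wp_seq (Prog.wp_digestSide (idx := T.idx) (j₀ := 0) (V₀ := T.digestBase) hhv
    ((G 3 (by omega)).trans (g 3 (by omega))) ((G 2 (by omega)).trans (g 2 (by omega)))
    ((G 4 (by omega)).trans (g 4 (by omega))) ((G 9 (by omega)).trans (g 9 (by omega)))
    ((G 10 (by omega)).trans (g 10 (by omega))) ((G 11 (by omega)).trans (g 11 (by omega)))
    ((G 21 (by omega)).trans g22) (by simp [hr₃]) ((G 5 (by omega)).trans (g 5 (by omega)))
    ((G 6 (by omega)).trans (g 6 (by omega))) (by omega) (by omega)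
    (show r₃ 29 = T.digestBase by simp [hr₃]) le_rfl
    (by simp only [header, List.getD_cons_succ, List.getD_cons_zero]; omega)
    (fun h j hj => hcached m₂ (fun _ _ => rfl) h j ?_) (fun h j hj => huncached h j ?_) hspace hw1
    hT.p_pos hz₁ hpH' ?_ hvw fun r₄ m₄ c₄ hr₄ h28 h29 hA₄ hm₄ he₄ hd₄ ho₄ => ?_)
  · simp only [header, List.getD_cons_succ, List.getD_cons_zero] at hj; omega
  · simp only [header, List.getD_cons_succ, List.getD_cons_zero] at hj; omega
  · simp only [header, List.getD_cons_succ, List.getD_cons_zero]; omega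
  simp only [header, List.getD_cons_succ, List.getD_cons_zero, Nat.zero_add] at h28 h29 hA₄ he₄ ho₄
  have G₄ : ∀ i < 22, r₄ (i + 1) = r₁ (i + 1) := fun i hi => by
    rw [hr₄ (i + 1) (by simp; omega), G i hi]
  refine Prog.wp_seq (Prog.wp_digestSide (idx := T.idx) (V₀ := T.digestBase) hhv
    ((G₄ 3 (by omega)).trans (g 3 (by omega))) ((G₄ 2 (by omega)).trans (g 2 (by omega)))
    ((G₄ 4 (by omega)).trans (g 4 (by omega))) ((G₄ 9 (by omega)).trans (g 9 (by omega)))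
    ((G₄ 10 (by omega)).trans (g 10 (by omega))) ((G₄ 11 (by omega)).trans (g 11 (by omega)))
    ((G₄ 21 (by omega)).trans g22) h28 ((G₄ 7 (by omega)).trans (g 7 (by omega)))
    ((G₄ 8 (by omega)).trans (g 8 (by omega))) (by omega) (by omega) h29 (by omega)
    (by simp only [header, List.getD_cons_succ, List.getD_cons_zero]; omega)
    (fun h j hj => hcached m₄ hm₄ h j ?_) (fun h j hj => huncached h j ?_) hspace hw1
    hT.p_pos hz₁ hpH' ?_ hvw fun r₅ m₅ c₅ hr₅ _ _ hB₅ hm₅ he₅ hd₅ ho₅ => ?_)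
  · simp only [header, List.getD_cons_succ, List.getD_cons_zero] at hj; omega
  · simp only [header, List.getD_cons_succ, List.getD_cons_zero] at hj; omega
  · simp only [header, List.getD_cons_succ, List.getD_cons_zero]; omega
  simp only [header, List.getD_cons_succ, List.getD_cons_zero] at hB₅ he₅ ho₅
  have G₅ : ∀ i < 21, r₅ (i + 1) = (T.header z).getD i 0 := fun i hi => by
    rw [hr₅ (i + 1) (by simp; omega), G₄ i (by omega), g i hi]
  have hmem : ∀ x < T.tableSize, m₅ x = T.cell z v x := fun x hx => by
    rw [hm₅ _ (by omega), hm₄ _ (by omega), hm₂' _ hx, hs _ hx]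
  have hAlt : ∀ i, T.digestA z.1 hv i < T.p := fun i => digest_lt hT.p_pos _ _ _ _
  have hBlt : ∀ i, T.digestB z.1 hv i < T.p := fun i => digest_lt hT.p_pos _ _ _ _
  have hmul : ∀ x y, x < T.p → y < T.H → x * y ≤ T.p * T.H := fun x y hx hy =>
    Nat.mul_le_mul hx.le hy.le
  refine Prog.wp_scanTables (n := T.n) (L₁ := T.L₁) (L₂ := T.L₂) (nr := nr)
    (A := T.digestA z.1 hv) (B := T.digestB z.1 hv) (fq := T.fingerprint z hv)
    (fp := T.entryFp z v) (G₅ 0 (by omega)) (G₅ 6 (by omega)) (G₅ 8 (by omega)) (G₅ 10 (by omega))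
    (G₅ 12 (by omega)) (G₅ 13 (by omega)) (G₅ 14 (by omega)) (G₅ 15 (by omega))
    (G₅ 16 (by omega)) (G₅ 17 (by omega)) (G₅ 18 (by omega)) (G₅ 19 (by omega))
    (G₅ 20 (by omega)) ?_ hspace hw1 (fun i hi => ?_) (fun i hi => ?_) (fun l => rfl)
    (fun i _ j _ => ?_) ?_ ?_ ?_ ?_ (fun l hl b hb => ?_) (fun u hu => ?_) (fun u => ?_)
    (fun u hu => ?_) hn hT.p_pos hp hT.cap₁_pos hT.cap₂_pos hT.cap₁_lt hT.cap₂_lt ?_ hOn.symm hnr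
    fun r₆ c₆ he₆ hd₆ ho₆ hsucc => ⟨fun x hx => ?_, ?_, ?_, ?_, hsucc⟩
  all_goals try simp only [header, List.getD_cons_succ, List.getD_cons_zero]
  · rw [hr₅ 22 (by simp), G₄ 21 (by omega), g22]
  · rw [hm₅ _ (by omega), hA₄ i hi]
    exact digest_congr fun i' hi' => by rw [idx_A hi hi']
  · rw [hB₅ i hi]
    exact digest_congr fun i' hi' => by rw [Nat.add_assoc, idx_B hi']
  -- The factor 2 in `pH_lt` makes room for the sum of these two products.
  · have h₁ := hmul _ _ (hAlt i) hz₂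
    have h₂ := hmul _ _ (hBlt j) hz₃
    omega
  · omega
  · omega
  · omega
  · omega
  · have hlb : l * T.n + b < T.entries := by
      have := Nat.mul_le_mul_right T.n (Nat.succ_le_of_lt hl)
      rw [Nat.succ_mul] at this
      omega
    rw [hmem _ (by omega), cell_head hl hb]
  · rw [hmem _ (by omega), cell_fp hu]
  · exact (fingerprint_lt hT.p_pos _ _ _).trans hp
  · rw [hmem _ (by omega), cell_next]
  · omega
  · rw [hmem x hx, hs x hx]
  · simp only [Cost.add_evals, Cost.zero_evals] at he₂ he₄ he₅ he₆
    -- Without a cache there is one evaluation per position, and `positions_le` applies. With a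
    -- cache all evaluations were made when it was filled.
    by_cases h0 : f = 0
    · have hc := hfuncached h0
      have := hT.positions_le hc
      have : T.cacheSize = 0 := by simp [cacheSize, hc]
      rw [if_pos h0] at he₄ he₅
      omega
    · have := (hfcached h0).2
      rw [if_neg h0] at he₄ he₅
      omega
  · simp only [Cost.add_dists, Cost.zero_dists, header, List.getD_cons_succ,
      List.getD_cons_zero] at hd₂ hd₄ hd₅ hd₆
    omega
  · simp only [Cost.add_other, Cost.zero_other, header, List.getD_cons_succ,
      List.getD_cons_zero] at ho₂ ho₄ ho₅ ho₆
    omega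

end Layout

/-! ## Collisions of the fingerprints -/

section Collisions

open Finset Polynomial

variable {p : ℕ}

/-- The polynomial whose value at `a` is the digest. -/
noncomputable def digestPoly (p H : ℕ) (v : ℕ → ℕ) : ℕ → (ZMod p)[X]
  | 0 => 0
  | k + 1 => ((digestPoly p H v k * X + C ((v k % H : ℕ) : ZMod p)) * X +
      C ((v k / H % H : ℕ) : ZMod p)) * X + C ((v k / H / H % H : ℕ) : ZMod p)

theorem cast_absorb (a acc x : ℕ) : ((absorb p a acc x : ℕ) : ZMod p) = acc * a + x := by
  rw [absorb, ZMod.natCast_mod]; push_cast; rfl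

/-- The digest is Horner's scheme for a polynomial whose coefficients are the base-`H` digits of the
words. Collisions therefore reduce to counting roots. -/
theorem cast_digest (H a : ℕ) (v : ℕ → ℕ) (k : ℕ) :
    ((digest H p a v k : ℕ) : ZMod p) = (digestPoly p H v k).eval (a : ZMod p) := by
  induction k with
  | zero => simp [digest, digestPoly]
  | succ k ih => simp [digest, digestPoly, absorbWord, cast_absorb, ih]

theorem natDegree_mul_X_add_C_le {R : Type*} [Semiring R] (P : R[X]) (c : R) :
    (P * X + C c).natDegree ≤ P.natDegree + 1 :=
  natDegree_add_le_of_degree_le (natDegree_mul_le_of_le le_rfl natDegree_X_le) (by simp)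

theorem natDegree_digestPoly_le (H : ℕ) (v : ℕ → ℕ) (k : ℕ) :
    (digestPoly p H v k).natDegree ≤ 3 * k := by
  induction k with
  | zero => simp [digestPoly]
  | succ k ih =>
    rw [digestPoly]
    refine (natDegree_mul_X_add_C_le _ _).trans ?_
    have h₁ := natDegree_mul_X_add_C_le (digestPoly p H v k * X + C ((v k % H : ℕ) : ZMod p))
      ((v k / H % H : ℕ) : ZMod p)
    have h₂ := natDegree_mul_X_add_C_le (digestPoly p H v k) ((v k % H : ℕ) : ZMod p)
    omega

theorem mul_X_add_C_inj {R : Type*} [CommRing R] [IsDomain R] {P P' : R[X]} {c c' : R}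
    (h : P * X + C c = P' * X + C c') : P = P' ∧ c = c' := by
  have hc : c = c' := by simpa using congrArg (fun q => q.coeff 0) h
  subst hc
  exact ⟨mul_right_cancel₀ X_ne_zero (add_right_cancel h), rfl⟩

theorem natCast_zmod_inj {a b : ℕ} (ha : a < p) (hb : b < p) (h : (a : ZMod p) = b) : a = b := by
  rw [ZMod.natCast_eq_natCast_iff'] at h
  rwa [Nat.mod_eq_of_lt ha, Nat.mod_eq_of_lt hb] at h

theorem eq_of_digits_eq {H x y : ℕ} (hx : x < H ^ 3) (hy : y < H ^ 3) (h₀ : x % H = y % H)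
    (h₁ : x / H % H = y / H % H) (h₂ : x / H / H % H = y / H / H % H) : x = y := by
  have key : ∀ z < H ^ 3, z / H / H % H = z / H / H := fun z hz => by
    apply Nat.mod_eq_of_lt
    rw [Nat.div_div_eq_div_mul]
    exact Nat.div_lt_of_lt_mul (by rw [pow_succ, pow_two] at hz; exact hz)
  rw [key x hx, key y hy] at h₂
  have h₃ : x / H = y / H := by rw [← Nat.div_add_mod (x / H) H, h₁, h₂, Nat.div_add_mod]
  rw [← Nat.div_add_mod x H, h₀, h₃, Nat.div_add_mod]

variable [Fact p.Prime]

/-- The coefficients are digits below `H ≤ p`, so their residues determine them, and three digits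
determine a word below `H ^ 3`. -/
theorem digestPoly_inj {H : ℕ} (hHp : H ≤ p) (hH : 0 < H) {v v' : ℕ → ℕ} {k : ℕ}
    (hv : ∀ i < k, v i < H ^ 3) (hv' : ∀ i < k, v' i < H ^ 3)
    (h : digestPoly p H v k = digestPoly p H v' k) : ∀ i < k, v i = v' i := by
  induction k with
  | zero => simp
  | succ k ih =>
    have hmod : ∀ x, x % H < p := fun x => (Nat.mod_lt x hH).trans_le hHp
    obtain ⟨h₃, d₂⟩ := mul_X_add_C_inj h
    obtain ⟨h₂, d₁⟩ := mul_X_add_C_inj h₃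
    obtain ⟨h₁, d₀⟩ := mul_X_add_C_inj h₂
    intro i hi
    rcases Nat.lt_succ_iff_lt_or_eq.1 hi with hi | rfl
    · exact ih (fun i hi => hv i (by omega)) (fun i hi => hv' i (by omega)) h₁ i hi
    · exact eq_of_digits_eq (hv i hi) (hv' i hi) (natCast_zmod_inj (hmod _) (hmod _) d₀)
        (natCast_zmod_inj (hmod _) (hmod _) d₁) (natCast_zmod_inj (hmod _) (hmod _) d₂)

/-- Each such `a` is a root of the nonzero difference of two polynomials of degree at most `3 * k`,
and numbers below `H ≤ p` are distinct modulo `p`. -/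
theorem card_digest_eq_le {H : ℕ} (hHp : H ≤ p) (hH : 0 < H) {v v' : ℕ → ℕ} {k : ℕ}
    (hv : ∀ i < k, v i < H ^ 3) (hv' : ∀ i < k, v' i < H ^ 3) (hne : ∃ i < k, v i ≠ v' i) :
    #{a ∈ range H | digest H p a v k = digest H p a v' k} ≤ 3 * k := by
  classical
  set D := digestPoly p H v k - digestPoly p H v' k with hD
  have hD0 : D ≠ 0 := fun h => by
    obtain ⟨i, hi, hne⟩ := hne
    exact hne (digestPoly_inj hHp hH hv hv' (sub_eq_zero.1 h) i hi)
  calc #{a ∈ range H | digest H p a v k = digest H p a v' k}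
      ≤ #D.roots.toFinset := by
        refine card_le_card_of_injOn (fun a => (a : ZMod p)) (fun a ha => ?_)
          fun a ha b hb hab => ?_
        · have ha' := (mem_filter.1 (mem_coe.1 ha)).2
          refine mem_coe.2 (Multiset.mem_toFinset.2 ((mem_roots hD0).2 ?_))
          rw [IsRoot, hD, eval_sub, ← cast_digest, ← cast_digest, ha', sub_self]
        · have ha' := mem_range.1 (mem_filter.1 (mem_coe.1 ha)).1
          have hb' := mem_range.1 (mem_filter.1 (mem_coe.1 hb)).1
          exact natCast_zmod_inj (by omega) (by omega) hab
    _ ≤ D.natDegree := (Multiset.toFinset_card_le _).trans (card_roots' D)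
    _ ≤ 3 * k := (natDegree_sub_le _ _).trans
        (max_le (natDegree_digestPoly_le _ _ _) (natDegree_digestPoly_le _ _ _))

section Affine

variable {H A A' : ℕ}

/-- Modulo `p` the difference is affine in `α` with the invertible slope `A - A'`. -/
theorem injOn_affine_sub (hHp : H ≤ p) (hA : A < p) (hA' : A' < p) (hne : A ≠ A') (y y' : ℕ) :
    Set.InjOn (fun α : ℕ => (((A * α + y) % p : ℕ) : ℤ) - ((A' * α + y') % p : ℕ))
      (range H : Finset ℕ) := by
  intro α hα β hβ h
  simp only [coe_range, Set.mem_Iio] at hα hβ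
  have h' := congrArg (fun z : ℤ => (z : ZMod p)) h
  simp only [Int.cast_sub, Int.cast_natCast, ZMod.natCast_mod, Nat.cast_add, Nat.cast_mul] at h'
  have h₁ : ((A : ZMod p) - A') * (α - β) = 0 := by linear_combination h'
  rcases mul_eq_zero.1 h₁ with h₂ | h₂
  · exact absurd (natCast_zmod_inj hA hA' (sub_eq_zero.1 h₂)) hne
  · exact natCast_zmod_inj (by omega) (by omega) (sub_eq_zero.1 h₂)

theorem card_affine_eq_le (hHp : H ≤ p) (hA : A < p) (hA' : A' < p) (hne : A ≠ A') (y y' : ℕ) :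
    #{α ∈ range H | (A * α + y) % p = (A' * α + y') % p} ≤ 1 := by
  rw [card_le_one]
  intro α hα β hβ
  rw [mem_filter] at hα hβ
  exact injOn_affine_sub hHp hA hA' hne y y' (mem_coe.2 hα.1) (mem_coe.2 hβ.1)
    (by simp [hα.2, hβ.2])

/-- Agreement modulo `n` makes the difference a multiple of `n` strictly between `-p` and `p`. There
are at most `2 * (p / n) + 1` of these, and each arises from at most one `α`. -/
theorem card_affine_mod_eq_le {n : ℕ} (hn : 0 < n) (hHp : H ≤ p) (hA : A < p) (hA' : A' < p)
    (hne : A ≠ A') (y y' : ℕ) :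
    n * #{α ∈ range H | (A * α + y) % p % n = (A' * α + y') % p % n} ≤ 2 * p + n := by
  have hp : 0 < p := by omega
  set s := {α ∈ range H | (A * α + y) % p % n = (A' * α + y') % p % n} with hs
  set g : ℕ → ℤ := fun α => (((A * α + y) % p : ℕ) : ℤ) - ((A' * α + y') % p : ℕ) with hg
  have hdvd : ∀ α ∈ s, (n : ℤ) ∣ g α := fun α hα => by
    rw [hs, mem_filter] at hα
    exact (Nat.modEq_iff_dvd.1 (show (A' * α + y') % p ≡ (A * α + y) % p [MOD n] from hα.2.symm))
  have hcard : #s ≤ #(Icc (-(p / n : ℕ) : ℤ) (p / n : ℕ)) := by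
    refine card_le_card_of_injOn (fun α => g α / n) (fun α hα => ?_) fun α hα β hβ h => ?_
    · obtain ⟨d, hd⟩ := hdvd α hα
      have h₁ : g α < p := by
        have := Nat.mod_lt (A * α + y) hp
        simp only [hg]; omega
      have h₂ : -(p : ℤ) < g α := by
        have := Nat.mod_lt (A' * α + y') hp
        simp only [hg]; omega
      have hn' : (0 : ℤ) < n := by exact_mod_cast hn
      rw [coe_Icc, Set.mem_Icc]
      simp only [hd, Int.mul_ediv_cancel_left _ hn'.ne']
      rw [hd] at h₁ h₂
      push_cast
      constructor
      · rw [neg_le, Int.le_ediv_iff_mul_le hn']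
        nlinarith
      · rw [Int.le_ediv_iff_mul_le hn']
        nlinarith
    · have hα' := (mem_filter.1 (mem_coe.1 hα)).1
      have hβ' := (mem_filter.1 (mem_coe.1 hβ)).1
      refine injOn_affine_sub hHp hA hA' hne y y' (mem_coe.2 hα') (mem_coe.2 hβ') ?_
      exact (Int.mul_ediv_cancel' (hdvd α hα)).symm.trans
        ((congrArg (fun t => (n : ℤ) * t) h).trans (Int.mul_ediv_cancel' (hdvd β hβ)))
  rw [Int.card_Icc] at hcard
  have h₁ : #s ≤ 2 * (p / n) + 1 := by omega
  calc n * #s ≤ n * (2 * (p / n) + 1) := Nat.mul_le_mul_left _ h₁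
    _ = 2 * (n * (p / n)) + n := by ring
    _ ≤ 2 * p + n := by have := Nat.mul_div_le p n; omega

end Affine

theorem card_filter_product_le {α β : Type*} (s : Finset α) (t : Finset β) (P : α × β → Prop)
    [DecidablePred P] {K : ℕ} (h : ∀ a ∈ s, #{b ∈ t | P (a, b)} ≤ K) :
    #{x ∈ s ×ˢ t | P x} ≤ #s * K := by
  rw [card_filter, sum_product]
  refine (sum_le_card_nsmul _ _ K fun a ha => ?_)
  rw [← card_filter]
  exact h a ha

theorem card_filter_product_swap {α β : Type*} (s : Finset α) (t : Finset β) (P : α × β → Prop)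
    [DecidablePred P] : #{x ∈ s ×ˢ t | P x} = #{x ∈ t ×ˢ s | P x.swap} := by
  rw [card_filter, card_filter, sum_product_right, sum_product]
  rfl

variable {H A A' B B' : ℕ}

/-- Vary the multiplier of a digest that differs while the other multiplier is fixed: at most one
value in each of `H` lines is bad. -/
theorem card_combine_eq_le (hHp : H ≤ p) (hA : A < p) (hA' : A' < p) (hB : B < p) (hB' : B' < p)
    (hne : ¬ (A = A' ∧ B = B')) :
    #{z ∈ range H ×ˢ range H | (A * z.1 + B * z.2) % p = (A' * z.1 + B' * z.2) % p} ≤ H := by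
  by_cases h : A = A'
  · refine (card_filter_product_le _ _ _ (K := 1) fun α _ => ?_).trans (by simp)
    simp only [Nat.add_comm (_ * α)]
    exact card_affine_eq_le hHp hB hB' (fun h' => hne ⟨h, h'⟩) _ _
  · rw [card_filter_product_swap]
    refine (card_filter_product_le _ _ _ (K := 1) fun α _ => ?_).trans (by simp)
    simp only [Prod.fst_swap, Prod.snd_swap]
    exact card_affine_eq_le hHp hA hA' h _ _

theorem card_combine_mod_eq_le {n : ℕ} (hn : 0 < n) (hHp : H ≤ p) (hA : A < p) (hA' : A' < p)
    (hB : B < p) (hB' : B' < p) (hne : ¬ (A = A' ∧ B = B')) :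
    n * #{z ∈ range H ×ˢ range H |
      (A * z.1 + B * z.2) % p % n = (A' * z.1 + B' * z.2) % p % n} ≤ H * (2 * p + n) := by
  have key : ∀ K, n * K ≤ 2 * p + n → K ≤ (2 * p + n) / n := fun K hK => by
    rwa [Nat.le_div_iff_mul_le hn, Nat.mul_comm]
  have hle : n * (H * ((2 * p + n) / n)) ≤ H * (2 * p + n) := by
    rw [Nat.mul_left_comm]
    exact Nat.mul_le_mul_left _ (Nat.mul_div_le _ _)
  refine (Nat.mul_le_mul_left n ?_).trans hle
  by_cases h : A = A'
  · refine (card_filter_product_le _ _ _ (K := (2 * p + n) / n) fun α _ => key _ ?_).trans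
      (by simp)
    simp only [Nat.add_comm (_ * α)]
    exact card_affine_mod_eq_le hn hHp hB hB' (fun h' => hne ⟨h, h'⟩) _ _
  · rw [card_filter_product_swap]
    refine (card_filter_product_le _ _ _ (K := (2 * p + n) / n) fun α _ => key _ ?_).trans
      (by simp)
    simp only [Prod.fst_swap, Prod.snd_swap]
    exact card_affine_mod_eq_le hn hHp hA hA' h _ _

end Collisions

/-! ### Collisions of the fingerprints of tables -/

namespace Layout

open Finset

variable {T : Layout}

/-- The possible seeds of the fingerprints. -/
def seeds (T : Layout) : Finset (ℕ × ℕ × ℕ) := range T.H ×ˢ range T.H ×ˢ range T.H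

theorem card_seeds : #T.seeds = T.H * (T.H * T.H) := by simp [seeds]

variable [Fact T.p.Prime]

/-- At most `3 * (k₁ + k₂)` evaluation points `a` fail to separate the pair of digests, and each of
them spoils at most `H * H` seeds. Each of the at most `H` remaining points spoils at most `H`, by
`card_combine_eq_le`. -/
theorem card_fingerprint_eq_le (hHp : T.H ≤ T.p) (hH : 0 < T.H) {v v' : ℕ → ℕ} {l : ℕ}
    (hv : ∀ j, v j < T.H ^ 3) (hv' : ∀ j, v' j < T.H ^ 3)
    (hne : (∃ i < T.k₁, v (T.idxA (l / T.L₂) i) ≠ v' (T.idxA (l / T.L₂) i)) ∨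
      ∃ i < T.k₂, v (T.idxB (l % T.L₂) i) ≠ v' (T.idxB (l % T.L₂) i)) :
    #{z ∈ T.seeds | T.fingerprint z v l = T.fingerprint z v' l} ≤
      (3 * (T.k₁ + T.k₂) + 1) * (T.H * T.H) := by
  classical
  have hp : 0 < T.p := by omega
  set bad := {a ∈ range T.H | T.digestA a v (l / T.L₂) = T.digestA a v' (l / T.L₂) ∧
    T.digestB a v (l % T.L₂) = T.digestB a v' (l % T.L₂)} with hbad
  have hbadcard : #bad ≤ 3 * (T.k₁ + T.k₂) := by
    rcases hne with h | h
    · refine (card_le_card (fun a ha => ?_)).trans ((card_digest_eq_le hHp hH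
        (fun i _ => hv _) (fun i _ => hv' _) h).trans (by omega))
      rw [hbad, mem_filter] at ha
      exact mem_filter.2 ⟨ha.1, ha.2.1⟩
    · refine (card_le_card (fun a ha => ?_)).trans ((card_digest_eq_le hHp hH
        (fun i _ => hv _) (fun i _ => hv' _) h).trans (by omega))
      rw [hbad, mem_filter] at ha
      exact mem_filter.2 ⟨ha.1, ha.2.2⟩
  rw [seeds, card_filter, sum_product]
  calc _ ≤ ∑ a ∈ range T.H, ((if a ∈ bad then T.H * T.H else 0) + T.H) := by
        refine sum_le_sum fun a ha => ?_
        rw [← card_filter]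
        by_cases h : a ∈ bad
        · rw [if_pos h]
          refine (card_filter_le _ _).trans ?_
          simp
        · rw [if_neg h, Nat.zero_add]
          refine card_combine_eq_le hHp (digest_lt hp _ _ _ _) (digest_lt hp _ _ _ _)
            (digest_lt hp _ _ _ _) (digest_lt hp _ _ _ _) fun h' => h ?_
          exact mem_filter.2 ⟨ha, h'⟩
    _ = #bad * (T.H * T.H) + T.H * T.H := by
        rw [sum_add_distrib, ← sum_filter, sum_const, sum_const, card_range, smul_eq_mul,
          smul_eq_mul, filter_mem_eq_inter, inter_eq_right.2 (filter_subset _ _)]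
    _ ≤ _ := by
        rw [Nat.add_mul, Nat.one_mul]
        exact Nat.add_le_add_right (Nat.mul_le_mul_right _ hbadcard) _

/-- Unequal fingerprints force unequal digests, so the two multipliers alone provide the bound for
every `a`. Hence no term depends on the lengths of the tuples, and the expected number of mismatches
per table is constant. -/
theorem card_fingerprint_mod_eq_le (hn : 0 < T.n) (hHp : T.H ≤ T.p) (hp : 0 < T.p)
    (v v' : ℕ → ℕ) (l : ℕ) :
    T.n * #{z ∈ T.seeds | T.fingerprint z v l % T.n = T.fingerprint z v' l % T.n ∧
      T.fingerprint z v l ≠ T.fingerprint z v' l} ≤ T.H * (T.H * (2 * T.p + T.n)) := by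
  rw [seeds]
  have key : ∀ K, T.n * K ≤ T.H * (2 * T.p + T.n) → K ≤ T.H * (2 * T.p + T.n) / T.n :=
    fun K hK => by rwa [Nat.le_div_iff_mul_le hn, Nat.mul_comm]
  refine (Nat.mul_le_mul_left _ (card_filter_product_le _ _ _
    (K := T.H * (2 * T.p + T.n) / T.n) fun a _ => key _ ?_)).trans ?_
  · by_cases h : T.digestA a v (l / T.L₂) = T.digestA a v' (l / T.L₂) ∧
        T.digestB a v (l % T.L₂) = T.digestB a v' (l % T.L₂)
    · rw [filter_false_of_mem, card_empty]
      · simp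
      · rintro z - ⟨-, h'⟩
        exact h' (by simp only [fingerprint, h.1, h.2])
    · refine (Nat.mul_le_mul_left _ (card_le_card (fun z hz => ?_))).trans
        (card_combine_mod_eq_le hn hHp (digest_lt hp _ _ _ _) (digest_lt hp _ _ _ _)
          (digest_lt hp _ _ _ _) (digest_lt hp _ _ _ _) h)
      rw [mem_filter] at hz ⊢
      exact ⟨hz.1, hz.2.1⟩
  · rw [card_range, Nat.mul_left_comm]
    exact Nat.mul_le_mul_left _ (Nat.mul_div_le _ _)

end Layout

/-! ## Probabilistic tools -/

section SecondMoment

variable {Ω ι : Type*} {U : Finset ι} {A : ι → Set Ω}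

/-- The number of events that occur, as a sum of indicator functions. -/
noncomputable def numOccur (U : Finset ι) (A : ι → Set Ω) (ω : Ω) : ℝ :=
  ∑ u ∈ U, (A u).indicator (fun _ => (1 : ℝ)) ω

theorem numOccur_sq (ω : Ω) : numOccur U A ω ^ 2 =
    numOccur (U ×ˢ U) (fun x => A x.1 ∩ A x.2) ω := by
  rw [numOccur, numOccur, sq, Finset.sum_mul_sum, Finset.sum_product]
  refine Finset.sum_congr rfl fun u _ => Finset.sum_congr rfl fun u' _ => ?_
  by_cases h : ω ∈ A u <;> by_cases h' : ω ∈ A u' <;> simp [h, h']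

variable [MeasurableSpace Ω] (μ : Measure Ω)

theorem integrable_indicator_one [IsProbabilityMeasure μ] {s : Set Ω} (hs : MeasurableSet s) :
    Integrable (s.indicator fun _ => (1 : ℝ)) μ := (integrable_const _).indicator hs

theorem integral_indicator_one_eq {s : Set Ω} (hs : MeasurableSet s) :
    ∫ ω, s.indicator (fun _ => (1 : ℝ)) ω ∂μ = μ.real s := by
  rw [integral_indicator_const _ hs, smul_eq_mul, mul_one]

theorem integrable_numOccur [IsProbabilityMeasure μ] (hA : ∀ u ∈ U, MeasurableSet (A u)) :
    Integrable (numOccur U A) μ := by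
  unfold numOccur
  exact integrable_finsetSum _ fun u hu => integrable_indicator_one μ (hA u hu)

theorem integral_numOccur [IsProbabilityMeasure μ] (hA : ∀ u ∈ U, MeasurableSet (A u)) :
    ∫ ω, numOccur U A ω ∂μ = ∑ u ∈ U, μ.real (A u) := by
  unfold numOccur
  rw [integral_finsetSum _ fun u hu => integrable_indicator_one μ (hA u hu)]
  exact Finset.sum_congr rfl fun u hu => integral_indicator_one_eq μ (hA u hu)

/-- Markov's inequality for the number of events that occur. -/
theorem mul_measureReal_le_sum [IsProbabilityMeasure μ] (hA : ∀ u ∈ U, MeasurableSet (A u))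
    (c : ℝ) : c * μ.real {ω | c ≤ numOccur U A ω} ≤ ∑ u ∈ U, μ.real (A u) := by
  rw [← integral_numOccur μ hA]
  refine mul_meas_ge_le_integral_of_nonneg (.of_forall fun ω => ?_) (integrable_numOccur μ hA) c
  exact Finset.sum_nonneg fun u _ => Set.indicator_nonneg (fun _ _ => zero_le_one) _

/-- The second moment method. -/
theorem measureReal_forall_notMem_le [IsProbabilityMeasure μ] (hA : ∀ u ∈ U, MeasurableSet (A u))
    {a ε : ℝ} (ha : 0 < a) (hU : U.Nonempty) (hμ : ∀ u ∈ U, μ.real (A u) = a)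
    (h : ∑ u ∈ U, ∑ u' ∈ U, μ.real (A u ∩ A u') ≤ (1 + ε) * (U.card * a) ^ 2) :
    μ.real {ω | ∀ u ∈ U, ω ∉ A u} ≤ ε := by
  have hA₂ : ∀ x ∈ U ×ˢ U, MeasurableSet (A x.1 ∩ A x.2) := fun x hx =>
    (hA _ (Finset.mem_product.1 hx).1).inter (hA _ (Finset.mem_product.1 hx).2)
  set E := (U.card : ℝ) * a with hE
  have hE0 : 0 < E := mul_pos (by exact_mod_cast hU.card_pos) ha
  have h₁ := integrable_numOccur μ hA
  have h₂ := integrable_numOccur μ hA₂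
  have hint : ∫ ω, (numOccur U A ω - E) ^ 2 ∂μ =
      ∑ u ∈ U, ∑ u' ∈ U, μ.real (A u ∩ A u') - E ^ 2 := by
    have : ∀ ω, (numOccur U A ω - E) ^ 2 = numOccur (U ×ˢ U) (fun x => A x.1 ∩ A x.2) ω -
        2 * E * numOccur U A ω + E ^ 2 := fun ω => by rw [← numOccur_sq]; ring
    simp only [this]
    have h₃ : Integrable (fun ω => numOccur (U ×ˢ U) (fun x => A x.1 ∩ A x.2) ω -
        2 * E * numOccur U A ω) μ := h₂.sub (h₁.const_mul _)
    rw [integral_add h₃ (integrable_const _),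
      integral_sub h₂ (h₁.const_mul _), integral_const_mul, integral_numOccur μ hA,
      integral_numOccur μ hA₂, Finset.sum_product, Finset.sum_congr rfl hμ, Finset.sum_const,
      nsmul_eq_mul, ← hE]
    simp
    ring
  have hle : E ^ 2 * μ.real {ω | ∀ u ∈ U, ω ∉ A u} ≤ ∫ ω, (numOccur U A ω - E) ^ 2 ∂μ := by
    have hi : Integrable (fun ω => (numOccur U A ω - E) ^ 2) μ := by
      have : (fun ω => (numOccur U A ω - E) ^ 2) = fun ω =>
          numOccur (U ×ˢ U) (fun x => A x.1 ∩ A x.2) ω - 2 * E * numOccur U A ω + E ^ 2 := by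
        funext ω; rw [← numOccur_sq]; ring
      rw [this]
      exact (h₂.sub (h₁.const_mul _)).add (integrable_const _)
    -- Chebyshev's inequality: where no event occurs, the squared deviation from the mean equals `E
    -- ^ 2`.
    refine le_trans ?_ (mul_meas_ge_le_integral_of_nonneg
      (.of_forall fun ω => sq_nonneg (numOccur U A ω - E)) hi (E ^ 2))
    refine mul_le_mul_of_nonneg_left (measureReal_mono fun ω hω => ?_) (sq_nonneg _)
    have h0 : numOccur U A ω = 0 := Finset.sum_eq_zero fun u hu =>
      Set.indicator_of_notMem (hω u hu) _
    simp [h0]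
  rw [hint] at hle
  have h3 : E ^ 2 * μ.real {ω | ∀ u ∈ U, ω ∉ A u} ≤ E ^ 2 * ε := by linarith
  exact le_of_mul_le_mul_left h3 (by positivity)

end SecondMoment

/-! ### Collisions on sets of independent functions -/

section Pi

variable {Ω : Type*} [MeasurableSpace Ω] (μ : Measure Ω) [IsProbabilityMeasure μ] {M : ℕ}

theorem pi_real_forall_mem (S : Finset (Fin M)) (E : Set Ω) :
    (Measure.pi fun _ : Fin M => μ).real {ζ | ∀ j ∈ S, ζ j ∈ E} = μ.real E ^ S.card := by
  classical
  have : {ζ : Fin M → Ω | ∀ j ∈ S, ζ j ∈ E} =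
      Set.univ.pi fun j => if j ∈ S then E else Set.univ := by
    ext ζ
    simp only [Set.mem_ofPred_eq, Set.mem_pi, Set.mem_univ, true_implies]
    refine forall_congr' fun j => ?_
    split_ifs with h <;> simp [h]
  rw [this, measureReal_def, Measure.pi_pi, ENNReal.toReal_prod]
  have h2 : ∀ j, (μ (if j ∈ S then E else Set.univ)).toReal = if j ∈ S then μ.real E else 1 := by
    intro j
    split_ifs <;> simp [measureReal_def]
  simp only [h2]
  rw [Finset.prod_ite_mem, Finset.univ_inter, Finset.prod_const]

theorem measurableSet_forall_mem (S : Finset (Fin M)) {E : Set Ω} (hE : MeasurableSet E) :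
    MeasurableSet {ζ : Fin M → Ω | ∀ j ∈ S, ζ j ∈ E} := by
  have : {ζ : Fin M → Ω | ∀ j ∈ S, ζ j ∈ E} = ⋂ j ∈ S, (fun ζ : Fin M → Ω => ζ j) ⁻¹' E := by
    ext; simp
  rw [this]
  exact Finset.measurableSet_biInter _ fun j _ => measurable_pi_apply j hE

/-- If the sets `S l` of `k` coordinates have small intersections on average, then with high
probability there is one of them on which all coordinates lie in `E`. -/
theorem pi_real_forall_exists_notMem_le {E : Set Ω} (hE : MeasurableSet E) {p₁ ε : ℝ}
    (hp₁ : 0 < p₁) (hpE : p₁ ≤ μ.real E) {L k : ℕ} (hL : 0 < L) (S : ℕ → Finset (Fin M))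
    (hS : ∀ l < L, (S l).card = k)
    (hsum : ∑ l ∈ Finset.range L, ∑ l' ∈ Finset.range L, (1 / p₁) ^ (S l ∩ S l').card ≤
      (1 + ε) * (L : ℝ) ^ 2) :
    (Measure.pi fun _ : Fin M => μ).real {ζ | ∀ l < L, ¬ ∀ j ∈ S l, ζ j ∈ E} ≤ ε := by
  classical
  set P := μ.real E with hP
  have hP0 : 0 < P := hp₁.trans_le hpE
  have := measureReal_forall_notMem_le (Measure.pi fun _ : Fin M => μ) (U := Finset.range L)
    (A := fun l => {ζ | ∀ j ∈ S l, ζ j ∈ E}) (fun l _ => measurableSet_forall_mem _ hE)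
    (a := P ^ k) (ε := ε) (by positivity) (by simpa using hL.ne')
    (fun l hl => by rw [pi_real_forall_mem, hS l (Finset.mem_range.1 hl)]) ?_
  · simpa using this
  · have hterm : ∀ l ∈ Finset.range L, ∀ l' ∈ Finset.range L,
        (Measure.pi fun _ : Fin M => μ).real
          ({ζ | ∀ j ∈ S l, ζ j ∈ E} ∩ {ζ | ∀ j ∈ S l', ζ j ∈ E}) ≤
        P ^ (2 * k) * (1 / p₁) ^ (S l ∩ S l').card := by
      intro l hl l' hl'
      have hset : {ζ : Fin M → Ω | ∀ j ∈ S l, ζ j ∈ E} ∩ {ζ | ∀ j ∈ S l', ζ j ∈ E} =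
          {ζ | ∀ j ∈ S l ∪ S l', ζ j ∈ E} := by
        ext ζ
        simp only [Set.mem_inter_iff, Set.mem_ofPred_eq, Finset.mem_union]
        exact ⟨fun h j hj => hj.elim (h.1 j) (h.2 j), fun h => ⟨fun j hj => h j (.inl hj),
          fun j hj => h j (.inr hj)⟩⟩
      rw [hset, pi_real_forall_mem, ← hP]
      have hcard : (S l ∪ S l').card + (S l ∩ S l').card = 2 * k := by
        rw [Finset.card_union_add_card_inter, hS l (Finset.mem_range.1 hl),
          hS l' (Finset.mem_range.1 hl'), two_mul]
      rw [← hcard, pow_add, mul_assoc, ← mul_pow]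
      refine le_mul_of_one_le_right (by positivity) (one_le_pow₀ ?_)
      rw [mul_one_div, one_le_div hp₁]
      exact hpE
    calc _ ≤ ∑ l ∈ Finset.range L, ∑ l' ∈ Finset.range L,
          P ^ (2 * k) * (1 / p₁) ^ (S l ∩ S l').card :=
        Finset.sum_le_sum fun l hl => Finset.sum_le_sum fun l' hl' => hterm l hl l' hl'
      _ = P ^ (2 * k) * ∑ l ∈ Finset.range L, ∑ l' ∈ Finset.range L,
          (1 / p₁) ^ (S l ∩ S l').card := by simp only [Finset.mul_sum]
      _ ≤ P ^ (2 * k) * ((1 + ε) * (L : ℝ) ^ 2) := mul_le_mul_of_nonneg_left hsum (by positivity)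
      _ = _ := by rw [Finset.card_range]; ring

end Pi

/-! ### Words that agree in few positions -/

section Design

open Finset

theorem prod_ite_eq_pow_card {k m : ℕ} (x : ℝ) (u v : Fin k → Fin m) :
    ∏ i, (if v i = u i then x else 1) = x ^ #{i | v i = u i} := by
  rw [prod_ite, prod_const, prod_const_one, mul_one]

/-- The summand is a product over the coordinates, so the sum factorizes. In each coordinate one
letter contributes `x` and the other `m - 1` contribute 1. -/
theorem sum_pow_agree (k m : ℕ) (x : ℝ) (u : Fin k → Fin m) :
    ∑ v : Fin k → Fin m, x ^ #{i | v i = u i} = (m - 1 + x) ^ k := by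
  have h : ∀ i, ∑ j : Fin m, (if j = u i then x else 1) = (m : ℝ) - 1 + x := by
    intro i
    rw [← Finset.add_sum_erase _ _ (mem_univ (u i)), if_pos rfl,
      sum_congr rfl (fun j hj => if_neg (ne_of_mem_erase hj)), sum_const,
      card_erase_of_mem (mem_univ _), card_univ, Fintype.card_fin, nsmul_eq_mul, mul_one,
      Nat.cast_sub (Fin.pos (u i))]
    push_cast
    ring
  calc _ = ∑ v : Fin k → Fin m, ∏ i, (if v i = u i then x else 1) := by
        simp only [prod_ite_eq_pow_card]
    _ = ∏ i, ∑ j : Fin m, (if j = u i then x else 1) := by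
        rw [prod_univ_sum, Fintype.piFinset_univ]
    _ = _ := by simp only [h, prod_const, card_univ, Fintype.card_fin]

/-- There are `L` words of length `k` over an alphabet of size `m` that agree in few positions. -/
theorem exists_design (k m : ℕ) (hm : 0 < m) {x : ℝ} (hx : 1 ≤ x) (L : ℕ) :
    ∃ f : ℕ → Fin k → Fin m, ∑ l ∈ range L, ∑ l' ∈ range L, x ^ #{i | f l i = f l' i} ≤
      L * x ^ k + (L : ℝ) ^ 2 * (1 + x / m) ^ k := by
  have hm' : (0 : ℝ) < m := by exact_mod_cast hm
  set y := (1 + x / m) ^ k with hy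
  have hy0 : 0 ≤ y := by positivity
  induction L with
  | zero => exact ⟨fun _ _ => ⟨0, hm⟩, by simp⟩
  | succ L ih =>
    obtain ⟨f, hf⟩ := ih
    -- The next word is found by averaging over all words: some word is no worse than the mean.
    obtain ⟨v, hv⟩ : ∃ v : Fin k → Fin m,
        ∑ l ∈ range L, x ^ #{i | v i = f l i} ≤ L * y := by
      have : Nonempty (Fin m) := ⟨⟨0, hm⟩⟩
      have hsum : ∑ v : Fin k → Fin m, ∑ l ∈ range L, x ^ #{i | v i = f l i} ≤
          ∑ _v : Fin k → Fin m, L * y := by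
        rw [sum_comm]
        simp only [sum_pow_agree, sum_const, card_range, card_univ, Fintype.card_pi,
          Fintype.card_fin, prod_const, nsmul_eq_mul, Nat.cast_pow]
        rw [mul_left_comm]
        refine mul_le_mul_of_nonneg_left ?_ (Nat.cast_nonneg _)
        rw [hy, ← mul_pow]
        refine pow_le_pow_left₀ ?_ ?_ _
        · have : (1 : ℝ) ≤ m := by exact_mod_cast hm
          linarith
        · rw [mul_add, mul_div_cancel₀ _ hm'.ne']
          linarith
      obtain ⟨v, -, hv⟩ := exists_le_of_sum_le univ_nonempty hsum
      exact ⟨v, hv⟩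
    refine ⟨fun l => if l = L then v else f l, ?_⟩
    have h₁ : ∀ l ∈ range L, (if l = L then v else f l) = f l := fun l hl =>
      if_neg (mem_range.1 hl).ne
    rw [sum_range_succ]
    simp only [sum_range_succ _ L, if_true]
    rw [sum_add_distrib]
    have e₁ : ∑ l ∈ range L, ∑ l' ∈ range L, x ^ #{i | (if l = L then v else f l) i =
        (if l' = L then v else f l') i} = ∑ l ∈ range L, ∑ l' ∈ range L,
          x ^ #{i | f l i = f l' i} :=
      sum_congr rfl fun l hl => sum_congr rfl fun l' hl' => by rw [h₁ l hl, h₁ l' hl']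
    have e₂ : ∑ l ∈ range L, x ^ #{i | (if l = L then v else f l) i = v i} =
        ∑ l ∈ range L, x ^ #{i | v i = f l i} :=
      sum_congr rfl fun l hl => by rw [h₁ l hl]; simp only [eq_comm]
    have e₃ : ∑ l ∈ range L, x ^ #{i | v i = (if l = L then v else f l) i} =
        ∑ l ∈ range L, x ^ #{i | v i = f l i} :=
      sum_congr rfl fun l hl => by rw [h₁ l hl]
    rw [e₁, e₂, e₃]
    -- The new word contributes `x ^ k` on the diagonal and at most `2 * L * y` off it, which is
    -- below `(L + 1) ^ 2 * y - L ^ 2 * y`.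
    simp only [filter_true, card_univ, Fintype.card_fin]
    push_cast
    nlinarith

end Design

/-! ### From layouts to data structures -/

namespace Layout

variable (T : Layout) {w : ℕ}

/-- The hash values at a data point, extended by `0`. -/
def extend {w a b : ℕ} (vals : Fin a → Fin b → BitVec w) (i j : ℕ) : ℕ :=
  if hij : j < a ∧ i < b then (vals ⟨j, hij.1⟩ ⟨i, hij.2⟩).toNat else 0

/-- The data structure with the given layout; `dec` turns random bits into the seeds of the
fingerprints. -/
noncomputable def dataStructure (w N : ℕ) (dec : (Fin N → Bool) → ℕ × ℕ × ℕ) :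
    DataStructure T.n w where
  numHash := T.numHash
  numBits := N
  tableSize := T.tableSize
  workSize := T.workSize
  build := fun vals bits x => BitVec.ofNat w (T.cell (dec bits) (extend vals) x)

variable {X R Ω : Type*} (h : Ω → X → R) (enc : R → BitVec w)

/-- The values of the sampled functions at a point, extended by `0`. -/
def values {M : ℕ} (ζ : Fin M → Ω) (x : X) (j : ℕ) : ℕ :=
  if hj : j < M then (enc (h (ζ ⟨j, hj⟩) x)).toNat else 0

/-- The values of the sampled functions at the data points. -/
def dataValues {M n : ℕ} (P : Fin n → X) (ζ : Fin M → Ω) : ℕ → ℕ → ℕ :=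
  extend fun j i => enc (h (ζ j) (P i))

/-- Whether a data point is near the query point. -/
noncomputable def nearFlag (dist : X → X → ℝ) (r₂ : ℝ) {n : ℕ} (P : Fin n → X) (q : X) (i : ℕ) :
    Bool :=
  if hi : i < n then decide (dist q (P ⟨i, hi⟩) < r₂) else false

/-- The event that the scan of the tables is successful. -/
def scanEvent (dist : X → X → ℝ) (r₂ : ℝ) (P : Fin T.n → X) (q : X) {N : ℕ}
    (dec : (Fin N → Bool) → ℕ × ℕ × ℕ) : Set ((Fin T.numHash → Ω) × (Fin N → Bool)) :=
  {z | ScanSucceeds T.n (T.L₁ * T.L₂) (T.fingerprint (dec z.2) (values h enc z.1 q))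
    (T.entryFp (dec z.2) (dataValues h enc P z.1)) (nearFlag dist r₂ P q) T.cap₁ T.cap₂}

theorem dataValues_eq {M n : ℕ} (P : Fin n → X) (ζ : Fin M → Ω) {i : ℕ} (hi : i < n) :
    dataValues h enc P ζ i = values h enc ζ (P ⟨i, hi⟩) := by
  funext j
  simp [dataValues, extend, values, hi]

theorem values_lt {M : ℕ} (ζ : Fin M → Ω) (x : X) (j : ℕ) : values h enc ζ x j < 2 ^ w := by
  rw [values]
  split_ifs
  · exact BitVec.isLt _
  · positivity

variable {T h enc}

theorem Fits.exec_dataStructure (hT : T.Fits w) {N : ℕ} {dec : (Fin N → Bool) → ℕ × ℕ × ℕ}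
    (hdec : ∀ b, dec b ∈ T.seeds) (dist : X → X → ℝ) (r₂ : ℝ) (P : Fin T.n → X) (q : X)
    (z : (T.dataStructure w N dec).Outcome Ω) (s : RAMState w)
    (hs : (T.dataStructure w N dec).Holds ((T.dataStructure w N dec).table h enc P z) s) :
    ∃ c s', Exec ((T.dataStructure w N dec).oracle dist r₂ h enc P z q)
      (T.dataStructure w N dec).space Prog.query s c s' ∧
      (T.dataStructure w N dec).Holds ((T.dataStructure w N dec).table h enc P z) s' ∧
      c.evals ≤ T.numHash ∧ c.dists ≤ T.cap₂ ∧
      c.other ≤ 115 + 5 * T.cacheSize + 24 * T.positions + 9 * (T.L₁ + T.L₂) +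
        30 * (T.L₁ * T.L₂ + T.cap₁ + T.cap₂) ∧
      (z ∈ T.scanEvent h enc dist r₂ P q dec →
        ∃ i : Fin T.n, (s'.reg 0).toNat = i ∧ dist q (P i) < r₂) := by
  have hz := hdec z.2
  simp only [seeds, Finset.mem_product, Finset.mem_range] at hz
  have hcell : ∀ x < T.tableSize,
      s.memNat x = T.cell (dec z.2) (dataValues h enc P z.1) x := fun x hx => by
    have h₁ := hs ⟨x, hx⟩
    simp only [DataStructure.table, dataStructure] at h₁
    rw [RAMState.memNat, h₁, BitVec.toNat_ofNat]
    exact Nat.mod_eq_of_lt (hT.cell_lt hz.1 hz.2.1 hz.2.2 _ hx)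
  obtain ⟨c, s', he, hm, h₁, h₂, h₃, h₄⟩ := hT.exec_query
    (O := (T.dataStructure w N dec).oracle dist r₂ h enc P z q) rfl rfl hz.1 hz.2.1 hz.2.2
    (dataValues h enc P z.1) (hv := values h enc z.1 q)
    (fun j hj => by
      rw [values, dif_pos (show j < (T.dataStructure w N dec).numHash from hj)]; rfl)
    (values_lt _ _ _ _)
    (nr := nearFlag dist r₂ P q)
    (fun i hi => by
      simp [nearFlag, DataStructure.oracle, show i < T.n from hi]) s hcell
  refine ⟨c, s', he, fun x => ?_, h₁, h₂, h₃, fun hz' => ?_⟩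
  · have h₅ := hm x x.2
    rw [RAMState.memNat, RAMState.memNat, BitVec.toNat_inj] at h₅
    rw [h₅, hs x]
  · obtain ⟨h₅, h₆⟩ := h₄ hz'
    refine ⟨⟨_, h₅⟩, rfl, ?_⟩
    simpa [nearFlag, h₅] using h₆

end Layout

/-! ### Measurability -/

section Measurability

variable {X R Ω : Type*} [MeasurableSpace R] [MeasurableSingletonClass R] [Finite R]
  [MeasurableSpace Ω]

/-- Every event that depends only on the values of the sampled functions at finitely many points
and on the random bits is measurable. -/
theorem measurableSet_of_values {h : Ω → X → R} (hh : ∀ x, Measurable fun ω => h ω x) {M n N : ℕ}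
    (P : Fin n → X) (q : X)
    (Φ : (Fin M → Fin n → R) × (Fin M → R) × (Fin N → Bool) → Prop) :
    MeasurableSet {z : (Fin M → Ω) × (Fin N → Bool) |
      Φ (fun j i => h (z.1 j) (P i), fun j => h (z.1 j) q, z.2)} := by
  have hmeas : Measurable fun z : (Fin M → Ω) × (Fin N → Bool) =>
      ((fun j i => h (z.1 j) (P i), fun j => h (z.1 j) q, z.2) :
        (Fin M → Fin n → R) × (Fin M → R) × (Fin N → Bool)) := by
    refine Measurable.prodMk (measurable_pi_lambda _ fun j => measurable_pi_lambda _ fun i => ?_)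
      (Measurable.prodMk (measurable_pi_lambda _ fun j => ?_) measurable_snd)
    · exact (hh (P i)).comp ((measurable_pi_apply j).comp measurable_fst)
    · exact (hh q).comp ((measurable_pi_apply j).comp measurable_fst)
  -- The data range over a finite space with measurable points, so no regularity of `Φ` is needed.
  exact hmeas (Set.toFinite {x | Φ x}).measurableSet

theorem measurableSet_collision {h : Ω → X → R} (hh : ∀ x, Measurable fun ω => h ω x) (x y : X) :
    MeasurableSet {ω | h ω x = h ω y} := by
  have : {ω | h ω x = h ω y} = ⋃ r : R, (fun ω => h ω x) ⁻¹' {r} ∩ (fun ω => h ω y) ⁻¹' {r} := by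
    ext ω
    simp [eq_comm]
  rw [this]
  exact MeasurableSet.iUnion fun r =>
    (hh x (measurableSet_singleton r)).inter (hh y (measurableSet_singleton r))

end Measurability

/-! ### Random seeds and conditioning -/

section Law

variable {Ω : Type*} [MeasurableSpace Ω] {N : ℕ}

/-- As `Z` has `2 ^ N` elements, the decoded seed is uniform on `Z`, and counting bounds for seeds
become probabilities. -/
theorem uniformOn_univ_real_le {P : ℕ × ℕ × ℕ → Prop} [DecidablePred P]
    {dec : (Fin N → Bool) → ℕ × ℕ × ℕ} (hinj : Function.Injective dec) {Z : Finset (ℕ × ℕ × ℕ)}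
    (hdec : ∀ b, dec b ∈ Z) (hZ : Z.card = 2 ^ N) {δ : ℝ}
    (hδ : ((Z.filter P).card : ℝ) ≤ δ * Z.card) :
    (ProbabilityTheory.uniformOn (Set.univ : Set (Fin N → Bool))).real {b | P (dec b)} ≤ δ := by
  classical
  have hcard : (Finset.univ.filter fun b => P (dec b)).card ≤ (Z.filter P).card :=
    Finset.card_le_card_of_injOn dec (fun b hb => by
      have := (Finset.mem_filter.1 (Finset.mem_coe.1 hb)).2
      exact Finset.mem_coe.2 (Finset.mem_filter.2 ⟨hdec b, this⟩)) hinj.injOn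
  have hset : {b | P (dec b)} = ((Finset.univ.filter fun b => P (dec b) : Finset _) :
      Set (Fin N → Bool)) := by ext; simp
  have hZ0 : (0 : ℝ) < Z.card := by rw [hZ]; positivity
  rw [measureReal_def, ProbabilityTheory.uniformOn_univ, hset, Measure.count_apply_finset,
    ENNReal.toReal_div, ENNReal.toReal_natCast, ENNReal.toReal_natCast]
  have hF : Fintype.card (Fin N → Bool) = Z.card := by simp [hZ]
  rw [hF, div_le_iff₀ hZ0]
  exact le_trans (by exact_mod_cast hcard) hδ

/-- An event has small probability if, outside of an event of small probability for the first
component, it has small probability for the second component. -/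
theorem prod_real_le {Ω' : Type*} [MeasurableSpace Ω'] (μ : Measure Ω) [IsProbabilityMeasure μ]
    (ν : Measure Ω') [IsProbabilityMeasure ν] {E : Set (Ω × Ω')} (hE : MeasurableSet E)
    {G : Set Ω} (hG : MeasurableSet G) {δ : ℝ} (hδ0 : 0 ≤ δ)
    (hδ : ∀ ζ ∉ G, ν.real {b | (ζ, b) ∈ E} ≤ δ) : (μ.prod ν).real E ≤ μ.real G + δ := by
  have h₁ : (μ.prod ν) E ≤ μ G + ENNReal.ofReal δ := by
    rw [Measure.prod_apply hE]
    calc ∫⁻ ζ, ν (Prod.mk ζ ⁻¹' E) ∂μ ≤ ∫⁻ ζ, (G.indicator 1 ζ + ENNReal.ofReal δ) ∂μ := by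
          refine lintegral_mono fun ζ => ?_
          by_cases hζ : ζ ∈ G
          · rw [Set.indicator_of_mem hζ]
            exact prob_le_one.trans le_self_add
          · rw [Set.indicator_of_notMem hζ, zero_add]
            have := hδ ζ hζ
            rw [measureReal_def] at this
            exact (ENNReal.le_ofReal_iff_toReal_le (measure_ne_top _ _) hδ0).2 this
      _ = μ G + ENNReal.ofReal δ := by
          rw [lintegral_add_right _ measurable_const, lintegral_indicator_one hG]
          simp
  rw [measureReal_def, measureReal_def]
  have h₂ := ENNReal.toReal_mono (by finiteness) h₁
  rwa [ENNReal.toReal_add (measure_ne_top _ _) ENNReal.ofReal_ne_top,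
    ENNReal.toReal_ofReal hδ0] at h₂

end Law

/-! ### The success probability of the scan -/

namespace Layout

variable (T : Layout) {w : ℕ}

/-- The set of hash functions of the first tuple number `l`. -/
def setA (l : ℕ) : Finset (Fin T.numHash) := {j | ∃ i < T.k₁, T.idxA l i = j}

/-- The set of hash functions of the second tuple number `l`. -/
def setB (l : ℕ) : Finset (Fin T.numHash) := {j | ∃ i < T.k₂, T.idxB l i = j}

/-- The tuples consist of distinct functions, and different tuples have few functions in common. -/
structure Spread (x ε : ℝ) : Prop where
  cardA : ∀ l < T.L₁, (T.setA l).card = T.k₁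
  cardB : ∀ l < T.L₂, (T.setB l).card = T.k₂
  disj : ∀ l < T.L₁, ∀ l' < T.L₂, Disjoint (T.setA l) (T.setB l')
  sumA : ∑ l ∈ Finset.range T.L₁, ∑ l' ∈ Finset.range T.L₁, x ^ (T.setA l ∩ T.setA l').card ≤
    (1 + ε) * (T.L₁ : ℝ) ^ 2
  sumB : ∑ l ∈ Finset.range T.L₂, ∑ l' ∈ Finset.range T.L₂, x ^ (T.setB l ∩ T.setB l').card ≤
    (1 + ε) * (T.L₂ : ℝ) ^ 2

variable {T} {X R Ω : Type*} {h : Ω → X → R} {enc : R → BitVec w}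

theorem mem_setA {l : ℕ} {j : Fin T.numHash} : j ∈ T.setA l ↔ ∃ i < T.k₁, T.idxA l i = j := by
  simp [setA]

theorem mem_setB {l : ℕ} {j : Fin T.numHash} : j ∈ T.setB l ↔ ∃ i < T.k₂, T.idxB l i = j := by
  simp [setB]

/-- If all functions of two tuples agree at two points, then so do the fingerprints. -/
theorem fingerprint_eq_of_collide (hT : T.Fits w) {l₁ l₂ : ℕ} (hl₁ : l₁ < T.L₁) (hl₂ : l₂ < T.L₂)
    {ζ : Fin T.numHash → Ω} {x y : X} (hA : ∀ j ∈ T.setA l₁, h (ζ j) x = h (ζ j) y)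
    (hB : ∀ j ∈ T.setB l₂, h (ζ j) x = h (ζ j) y) (z : ℕ × ℕ × ℕ) :
    T.fingerprint z (values h enc ζ x) (l₁ * T.L₂ + l₂) =
      T.fingerprint z (values h enc ζ y) (l₁ * T.L₂ + l₂) := by
  have hdiv : (l₁ * T.L₂ + l₂) / T.L₂ = l₁ := by
    rw [Nat.mul_comm, Nat.mul_add_div hT.L₂_pos, Nat.div_eq_of_lt hl₂, Nat.add_zero]
  have hmod : (l₁ * T.L₂ + l₂) % T.L₂ = l₂ := by
    rw [Nat.mul_comm, Nat.mul_add_mod, Nat.mod_eq_of_lt hl₂]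
  have h₁ : T.digestA z.1 (values h enc ζ x) l₁ = T.digestA z.1 (values h enc ζ y) l₁ :=
    digest_congr fun i hi => by
      have hlt := hT.idxA_lt l₁ hl₁ i hi
      rw [values, values, dif_pos hlt, dif_pos hlt, hA ⟨_, hlt⟩ (mem_setA.2 ⟨i, hi, rfl⟩)]
  have h₂ : T.digestB z.1 (values h enc ζ x) l₂ = T.digestB z.1 (values h enc ζ y) l₂ :=
    digest_congr fun i hi => by
      have hlt := hT.idxB_lt l₂ hl₂ i hi
      rw [values, values, dif_pos hlt, dif_pos hlt, hB ⟨_, hlt⟩ (mem_setB.2 ⟨i, hi, rfl⟩)]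
  rw [fingerprint, fingerprint, hdiv, hmod, h₁, h₂]

/-- If some function of the tuples of table `l` separates two points, then so do the fingerprints
for most seeds. -/
theorem card_fingerprint_eq_le_of_separate [Fact T.p.Prime] (hT : T.Fits w) (hHp : T.H ≤ T.p)
    (hwH : 2 ^ w ≤ T.H ^ 3) (henc : Function.Injective enc) {l : ℕ} (hl : l < T.L₁ * T.L₂)
    {ζ : Fin T.numHash → Ω} {x y : X}
    (hsep : ¬ ∀ j ∈ T.setA (l / T.L₂) ∪ T.setB (l % T.L₂), h (ζ j) x = h (ζ j) y) :
    (T.seeds.filter fun z => T.fingerprint z (values h enc ζ x) l =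
      T.fingerprint z (values h enc ζ y) l).card ≤
      (3 * (T.k₁ + T.k₂) + 1) * (T.H * T.H) := by
  have hv : ∀ (x : X) (j), values h enc ζ x j < T.H ^ 3 := fun x j =>
    (values_lt _ _ _ _ _).trans_le hwH
  have hdiv : l / T.L₂ < T.L₁ := Nat.div_lt_of_lt_mul (by rwa [Nat.mul_comm])
  have hmod : l % T.L₂ < T.L₂ := Nat.mod_lt _ hT.L₂_pos
  have hne : ∀ j : Fin T.numHash, h (ζ j) x ≠ h (ζ j) y →
      values h enc ζ x j ≠ values h enc ζ y j := fun j hj e => by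
    rw [values, values, dif_pos j.2, dif_pos j.2, BitVec.toNat_inj] at e
    exact hj (henc e)
  refine card_fingerprint_eq_le hHp hT.H_pos (hv x) (hv y) ?_
  push Not at hsep
  obtain ⟨j, hj, hxy⟩ := hsep
  rcases Finset.mem_union.1 hj with hj | hj
  · obtain ⟨i, hi, e⟩ := mem_setA.1 hj
    exact .inl ⟨i, hi, by rw [e]; exact hne j hxy⟩
  · obtain ⟨i, hi, e⟩ := mem_setB.1 hj
    exact .inr ⟨i, hi, by rw [e]; exact hne j hxy⟩

theorem count_eq_numOccur {Ω' : Type*} (Q : Ω' → ℕ → Prop) [∀ z, DecidablePred (Q z)] (N : ℕ)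
    (z : Ω') : (Nat.count (Q z) N : ℝ) = numOccur (Finset.range N) (fun u => {z | Q z u}) z := by
  classical
  rw [Nat.count_eq_card_filter_range, Finset.card_filter, numOccur]
  push_cast
  refine Finset.sum_congr rfl fun u _ => ?_
  simp [Set.indicator_apply]

theorem entryFp_dataValues {M n : ℕ} {T : Layout} (hTn : T.n = n) (hn : 0 < n) (P : Fin n → X)
    (z : ℕ × ℕ × ℕ) (ζ : Fin M → Ω) (u : ℕ) : T.entryFp z (dataValues h enc P ζ) u =
      T.fingerprint z (values h enc ζ (P ⟨u % n, Nat.mod_lt _ hn⟩)) (u / n) := by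
  subst hTn
  rw [entryFp, dataValues_eq h enc P ζ (Nat.mod_lt _ hn)]

variable [MeasurableSpace R] [MeasurableSingletonClass R] [MeasurableSpace Ω] {μ : Measure Ω}
  [IsProbabilityMeasure μ] {dist : X → X → ℝ} {r₁ r₂ p₁ p₂ ε : ℝ} {N : ℕ}
  {dec : (Fin N → Bool) → ℕ × ℕ × ℕ}

/-- The law of the outcome of preprocessing. -/
noncomputable abbrev outcomeLaw (μ : Measure Ω) (M N : ℕ) :
    Measure ((Fin M → Ω) × (Fin N → Bool)) :=
  (Measure.pi fun _ => μ).prod (ProbabilityTheory.uniformOn Set.univ)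

instance : IsProbabilityMeasure
    (ProbabilityTheory.uniformOn (Set.univ : Set (Fin N → Bool))) :=
  ProbabilityTheory.isProbabilityMeasure_uniformOn Set.finite_univ Set.univ_nonempty

theorem measurableSet_of_values_of_dataValues [Finite R] (hh : ∀ x, Measurable fun ω => h ω x)
    {M n : ℕ} (P : Fin n → X) (q : X) (Φ : (ℕ → ℕ) → (ℕ → ℕ → ℕ) → (Fin N → Bool) → Prop) :
    MeasurableSet {z : (Fin M → Ω) × (Fin N → Bool) |
      Φ (values h enc z.1 q) (dataValues h enc P z.1) z.2} :=
  measurableSet_of_values hh P q fun x =>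
    Φ (fun j => if hj : j < M then (enc (x.2.1 ⟨j, hj⟩)).toNat else 0)
      (extend fun j i => enc (x.1 j i)) x.2.2

/-- The bound holds for all fixed hash functions, by the randomness of the seeds alone. The constant
comes from `2 * p + n ≤ 5 * H`. -/
theorem outcomeLaw_mismatch_le [Finite R] [Fact T.p.Prime] (hT : T.Fits w)
    (hh : ∀ x, Measurable fun ω => h ω x) (hdec : ∀ b, dec b ∈ T.seeds)
    (hinj : Function.Injective dec) (hN : T.seeds.card = 2 ^ N) (P : Fin T.n → X) (q : X)
    (hHp : T.H ≤ T.p) (hpH : T.p ≤ 2 * T.H) (hnH : T.n ≤ T.H) (u : ℕ) :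
    (outcomeLaw μ T.numHash N).real {z | Mismatch T.n
      (T.fingerprint (dec z.2) (values h enc z.1 q)) (T.entryFp (dec z.2) (dataValues h enc P z.1))
      u} ≤ 5 / T.n := by
  have hn := hT.n_pos
  have hn' : (0 : ℝ) < T.n := by exact_mod_cast hn
  refine (prod_real_le _ _ (measurableSet_of_values_of_dataValues hh P q fun v v' b =>
    Mismatch T.n (T.fingerprint (dec b) v) (T.entryFp (dec b) v') u) MeasurableSet.empty
    (δ := 5 / T.n) (by positivity) fun ζ _ => ?_).trans (by simp)
  refine uniformOn_univ_real_le (P := fun s => Mismatch T.n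
    (T.fingerprint s (values h enc ζ q)) (T.entryFp s (dataValues h enc P ζ)) u) hinj hdec hN ?_
  simp only [Mismatch, entryFp_dataValues rfl hn]
  have h₁ := card_fingerprint_mod_eq_le hn hHp hT.p_pos
    (values h enc ζ (P ⟨u % T.n, Nat.mod_lt _ hn⟩)) (values h enc ζ q) (u / T.n)
  have h₂ : T.H * (T.H * (2 * T.p + T.n)) ≤ 5 * T.seeds.card := by
    rw [card_seeds]
    have : 2 * T.p + T.n ≤ 5 * T.H := by omega
    calc T.H * (T.H * (2 * T.p + T.n)) ≤ T.H * (T.H * (5 * T.H)) := by gcongr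
      _ = _ := by ring
  have h₃ := (Nat.cast_le (α := ℝ)).2 (h₁.trans h₂)
  push_cast at h₃
  rw [div_mul_eq_mul_div, le_div_iff₀ hn', mul_comm]
  exact h₃

/-- Either all `k₁ + k₂` functions of the table collide, which for distinct independent functions
has probability at most `p₂ ^ (k₁ + k₂)`, or some function separates the points and only a small
fraction of the seeds merges the fingerprints. -/
theorem outcomeLaw_farMatch_le [Finite R] [Fact T.p.Prime] (hT : T.Fits w)
    (hS : T.Spread (1 / p₁) ε) (hh : ∀ x, Measurable fun ω => h ω x)
    (henc : Function.Injective enc) (hsens : IsSensitive dist μ h r₁ r₂ p₁ p₂)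
    (hdec : ∀ b, dec b ∈ T.seeds) (hinj : Function.Injective dec) (hN : T.seeds.card = 2 ^ N)
    (P : Fin T.n → X) (q : X) (hp₂ : 0 < p₂) (hHp : T.H ≤ T.p) (hwH : 2 ^ w ≤ T.H ^ 3) {u : ℕ}
    (hu : u < T.L₁ * T.L₂ * T.n) :
    (outcomeLaw μ T.numHash N).real {z | FarMatch T.n
      (T.fingerprint (dec z.2) (values h enc z.1 q)) (T.entryFp (dec z.2) (dataValues h enc P z.1))
      (nearFlag dist r₂ P q) u} ≤
      p₂ ^ (T.k₁ + T.k₂) + (3 * (T.k₁ + T.k₂ : ℕ) + 1) / T.H := by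
  have hn := hT.n_pos
  have hH' : (0 : ℝ) < T.H := by exact_mod_cast hT.H_pos
  by_cases hfar : nearFlag dist r₂ P q (u % T.n) = false
  swap
  · have : {z : (Fin T.numHash → Ω) × (Fin N → Bool) | FarMatch T.n
        (T.fingerprint (dec z.2) (values h enc z.1 q))
        (T.entryFp (dec z.2) (dataValues h enc P z.1)) (nearFlag dist r₂ P q) u} = ∅ := by
      ext z
      simp [FarMatch, hfar]
    rw [this, measureReal_empty]
    positivity
  set y := P ⟨u % T.n, Nat.mod_lt _ hn⟩ with hy
  set l := u / T.n with hl
  have hlL : l < T.L₁ * T.L₂ := Nat.div_lt_of_lt_mul (by rwa [Nat.mul_comm])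
  have hdiv : l / T.L₂ < T.L₁ := Nat.div_lt_of_lt_mul (by rwa [Nat.mul_comm])
  have hmod : l % T.L₂ < T.L₂ := Nat.mod_lt _ hT.L₂_pos
  have hdist : r₂ ≤ dist q y := by
    rw [nearFlag, dif_pos (Nat.mod_lt _ hn)] at hfar
    simpa using hfar
  have hE := measurableSet_collision hh q y
  refine (prod_real_le _ _ (measurableSet_of_values_of_dataValues hh P q fun v v' b =>
    FarMatch T.n (T.fingerprint (dec b) v) (T.entryFp (dec b) v') (nearFlag dist r₂ P q) u)
    (measurableSet_forall_mem (T.setA (l / T.L₂) ∪ T.setB (l % T.L₂)) hE)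
    (δ := (3 * (T.k₁ + T.k₂ : ℕ) + 1) / T.H) (by positivity) fun ζ hζ => ?_).trans ?_
  · refine (measureReal_mono (fun b hb => ?_)).trans (uniformOn_univ_real_le
      (P := fun s => T.fingerprint s (values h enc ζ q) l = T.fingerprint s (values h enc ζ y) l)
      hinj hdec hN ?_)
    · have hb' := hb.1
      rw [entryFp_dataValues rfl hn] at hb'
      exact hb'.symm
    · have h₁ := card_fingerprint_eq_le_of_separate hT hHp hwH henc hlL hζ
      rw [card_seeds, div_mul_eq_mul_div, le_div_iff₀ hH']
      have h₂ := Nat.mul_le_mul_right T.H h₁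
      calc _ ≤ (((3 * (T.k₁ + T.k₂) + 1) * (T.H * T.H) * T.H : ℕ) : ℝ) := by exact_mod_cast h₂
        _ = _ := by push_cast; ring
  · rw [pi_real_forall_mem, Finset.card_union_of_disjoint (hS.disj _ hdiv _ hmod),
      hS.cardA _ hdiv, hS.cardB _ hmod]
    gcongr
    exact hsens.far q y hdist

/-- The scan of the tables succeeds with high probability. -/
theorem one_sub_le_outcomeLaw_scanEvent [Finite R] [Fact T.p.Prime] (hT : T.Fits w)
    (hS : T.Spread (1 / p₁) ε) (hh : ∀ x, Measurable fun ω => h ω x)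
    (henc : Function.Injective enc) (hsens : IsSensitive dist μ h r₁ r₂ p₁ p₂)
    (hdec : ∀ b, dec b ∈ T.seeds) (hinj : Function.Injective dec) (hN : T.seeds.card = 2 ^ N)
    (P : Fin T.n → X) (q : X) (hr : r₁ < r₂) (hp₁ : 0 < p₁) (hp₂ : 0 < p₂) (hHp : T.H ≤ T.p)
    (hpH : T.p ≤ 2 * T.H) (hnH : T.n ≤ T.H) (hwH : 2 ^ w ≤ T.H ^ 3)
    (hq : ∃ i, dist q (P i) ≤ r₁) :
    1 - (2 * ε + 5 * (T.L₁ * T.L₂ : ℕ) / T.cap₁ + (T.L₁ * T.L₂ : ℕ) * T.n *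
      (p₂ ^ (T.k₁ + T.k₂) + (3 * (T.k₁ + T.k₂ : ℕ) + 1) / T.H) / T.cap₂) ≤
      (outcomeLaw μ T.numHash N).real (T.scanEvent h enc dist r₂ P q dec) := by
  classical
  obtain ⟨i, hi⟩ := hq
  have hn := hT.n_pos
  have hn' : (0 : ℝ) < T.n := by exact_mod_cast hn
  have hc₁ : (0 : ℝ) < T.cap₁ := by exact_mod_cast hT.cap₁_pos
  have hc₂ : (0 : ℝ) < T.cap₂ := by exact_mod_cast hT.cap₂_pos
  set ν := outcomeLaw μ T.numHash N with hν
  set U := Finset.range (T.L₁ * T.L₂ * T.n) with hU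
  set E := {ω | h ω q = h ω (P i)} with hEdef
  have hE : MeasurableSet E := measurableSet_collision hh q (P i)
  set A : Set ((Fin T.numHash → Ω) × (Fin N → Bool)) :=
    {ζ | ∀ l < T.L₁, ¬ ∀ j ∈ T.setA l, ζ j ∈ E} ×ˢ Set.univ with hA
  set B : Set ((Fin T.numHash → Ω) × (Fin N → Bool)) :=
    {ζ | ∀ l < T.L₂, ¬ ∀ j ∈ T.setB l, ζ j ∈ E} ×ˢ Set.univ with hB
  set E₁ : ℕ → Set ((Fin T.numHash → Ω) × (Fin N → Bool)) := fun u => {z | Mismatch T.n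
      (T.fingerprint (dec z.2) (values h enc z.1 q)) (T.entryFp (dec z.2) (dataValues h enc P z.1))
      u} with hE₁
  set E₂ : ℕ → Set ((Fin T.numHash → Ω) × (Fin N → Bool)) := fun u => {z | FarMatch T.n
      (T.fingerprint (dec z.2) (values h enc z.1 q)) (T.entryFp (dec z.2) (dataValues h enc P z.1))
      (nearFlag dist r₂ P q) u} with hE₂
  have mE₁ : ∀ u ∈ U, MeasurableSet (E₁ u) := fun u _ =>
    measurableSet_of_values_of_dataValues hh P q fun v v' b =>
      Mismatch T.n (T.fingerprint (dec b) v) (T.entryFp (dec b) v') u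
  have mE₂ : ∀ u ∈ U, MeasurableSet (E₂ u) := fun u _ =>
    measurableSet_of_values_of_dataValues hh P q fun v v' b =>
      FarMatch T.n (T.fingerprint (dec b) v) (T.entryFp (dec b) v') (nearFlag dist r₂ P q) u
  have mS : MeasurableSet (T.scanEvent h enc dist r₂ P q dec) :=
    measurableSet_of_values_of_dataValues hh P q fun v v' b => ScanSucceeds T.n (T.L₁ * T.L₂)
      (T.fingerprint (dec b) v) (T.entryFp (dec b) v') (nearFlag dist r₂ P q) T.cap₁ T.cap₂
  -- Failure has four possible reasons: no first tuple collides, no second tuple collides, too many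
  -- mismatches, too many far matches.
  have hsub : (T.scanEvent h enc dist r₂ P q dec)ᶜ ⊆ (A ∪ B) ∪
      ({z | (T.cap₁ : ℝ) ≤ numOccur U E₁ z} ∪ {z | (T.cap₂ : ℝ) ≤ numOccur U E₂ z}) := by
    intro z hz
    by_contra hcon
    simp only [Set.mem_union, not_or, hA, hB, Set.mem_prod, Set.mem_univ, and_true,
      Set.mem_ofPred_eq, not_forall, not_le, exists_prop] at hcon
    obtain ⟨⟨⟨l₁, hl₁, hz₁⟩, ⟨l₂, hl₂, hz₂⟩⟩, hz₃, hz₄⟩ := hcon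
    refine hz ⟨?_, ?_, ?_⟩
    · set l := l₁ * T.L₂ + l₂ with hl
      have hlL : l < T.L₁ * T.L₂ := by
        have := Nat.mul_le_mul_right T.L₂ (Nat.succ_le_of_lt hl₁)
        rw [Nat.succ_mul] at this
        omega
      have hdiv : (l * T.n + i) / T.n = l := by
        rw [Nat.mul_comm, Nat.mul_add_div hn, Nat.div_eq_of_lt i.2, Nat.add_zero]
      have hmod : (l * T.n + i) % T.n = i := by
        rw [Nat.mul_comm, Nat.mul_add_mod, Nat.mod_eq_of_lt i.2]
      refine ⟨l * T.n + i, ?_, ?_, ?_⟩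
      · have := Nat.mul_le_mul_right T.n (Nat.succ_le_of_lt hlL)
        rw [Nat.succ_mul] at this
        have := i.2
        omega
      · simp only [entryFp_dataValues rfl hn, hdiv, hmod]
        exact (fingerprint_eq_of_collide hT hl₁ hl₂
          (fun j hj => by_contra fun hne => hz₁ ⟨j, hj, hne⟩)
          (fun j hj => by_contra fun hne => hz₂ ⟨j, hj, hne⟩) _).symm
      · rw [hmod, nearFlag, dif_pos i.2]
        simpa using hi.trans_lt hr
    · have := count_eq_numOccur (fun z : (Fin T.numHash → Ω) × (Fin N → Bool) => Mismatch T.n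
        (T.fingerprint (dec z.2) (values h enc z.1 q))
        (T.entryFp (dec z.2) (dataValues h enc P z.1))) (T.L₁ * T.L₂ * T.n) z
      rw [← this] at hz₃
      exact_mod_cast hz₃
    · have := count_eq_numOccur (fun z : (Fin T.numHash → Ω) × (Fin N → Bool) => FarMatch T.n
        (T.fingerprint (dec z.2) (values h enc z.1 q))
        (T.entryFp (dec z.2) (dataValues h enc P z.1)) (nearFlag dist r₂ P q))
        (T.L₁ * T.L₂ * T.n) z
      rw [← this] at hz₄
      exact_mod_cast hz₄
  have hpE : p₁ ≤ μ.real E := hsens.near q (P i) hi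
  have bA : ν.real A ≤ ε := by
    rw [hA, hν, outcomeLaw, measureReal_prod_prod]
    simp only [probReal_univ, mul_one]
    exact pi_real_forall_exists_notMem_le μ hE hp₁ hpE hT.L₁_pos _ hS.cardA hS.sumA
  have bB : ν.real B ≤ ε := by
    rw [hB, hν, outcomeLaw, measureReal_prod_prod]
    simp only [probReal_univ, mul_one]
    exact pi_real_forall_exists_notMem_le μ hE hp₁ hpE hT.L₂_pos _ hS.cardB hS.sumB
  have bE₁ : ν.real {z | (T.cap₁ : ℝ) ≤ numOccur U E₁ z} ≤
      5 * (T.L₁ * T.L₂ : ℕ) / T.cap₁ := by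
    rw [le_div_iff₀' hc₁]
    refine (mul_measureReal_le_sum ν mE₁ _).trans ((Finset.sum_le_sum fun u _ =>
      outcomeLaw_mismatch_le hT hh hdec hinj hN P q hHp hpH hnH u).trans ?_)
    rw [Finset.sum_const, hU, Finset.card_range, nsmul_eq_mul]
    push_cast
    -- The `n` entries of a table, each a mismatch with probability at most `5 / n`, contribute 5 to
    -- the expectation.
    rw [mul_div_assoc', div_le_iff₀ hn']
    nlinarith
  have bE₂ : ν.real {z | (T.cap₂ : ℝ) ≤ numOccur U E₂ z} ≤ (T.L₁ * T.L₂ : ℕ) * T.n *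
      (p₂ ^ (T.k₁ + T.k₂) + (3 * (T.k₁ + T.k₂ : ℕ) + 1) / T.H) / T.cap₂ := by
    rw [le_div_iff₀' hc₂]
    refine (mul_measureReal_le_sum ν mE₂ _).trans ((Finset.sum_le_sum fun u hu =>
      outcomeLaw_farMatch_le hT hS hh henc hsens hdec hinj hN P q hp₂ hHp hwH
        (Finset.mem_range.1 hu)).trans ?_)
    rw [Finset.sum_const, Finset.card_range, nsmul_eq_mul]
    push_cast
    exact le_rfl
  have hcompl : ν.real (T.scanEvent h enc dist r₂ P q dec)ᶜ ≤ (ε + ε) +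
      (5 * (T.L₁ * T.L₂ : ℕ) / T.cap₁ + (T.L₁ * T.L₂ : ℕ) * T.n *
      (p₂ ^ (T.k₁ + T.k₂) + (3 * (T.k₁ + T.k₂ : ℕ) + 1) / T.H) / T.cap₂) :=
    (measureReal_mono hsub).trans ((measureReal_union_le _ _).trans (add_le_add
      ((measureReal_union_le _ _).trans (add_le_add bA bB))
      ((measureReal_union_le _ _).trans (add_le_add bE₁ bE₂))))
  rw [probReal_compl_eq_one_sub mS] at hcompl
  linarith

end Layout

/-! ## The layouts -/

namespace Layout

/-- All tuples consist of different functions, which are evaluated when they are needed. -/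
def independent (n L₁ L₂ k₁ k₂ H p cap₁ cap₂ : ℕ) : Layout where
  n := n
  L₁ := L₁
  L₂ := L₂
  k₁ := k₁
  k₂ := k₂
  numHash := L₁ * k₁ + L₂ * k₂
  H := H
  p := p
  cap₁ := cap₁
  cap₂ := cap₂
  cached := false
  idxA := fun l i => l * k₁ + i
  idxB := fun l i => L₁ * k₁ + (l * k₂ + i)

/-- For each of the `k₁ + k₂` coordinates there are `m` functions, and coordinate `i` of a tuple is
one of those, as given by the words `f l` and `g l`. -/
def shared (n L₁ L₂ k₁ k₂ H p cap₁ cap₂ m : ℕ) (f : ℕ → Fin k₁ → Fin m) (g : ℕ → Fin k₂ → Fin m) :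
    Layout where
  n := n
  L₁ := L₁
  L₂ := L₂
  k₁ := k₁
  k₂ := k₂
  numHash := (k₁ + k₂) * m
  H := H
  p := p
  cap₁ := cap₁
  cap₂ := cap₂
  cached := true
  idxA := fun l i => if hi : i < k₁ then m * i + f l ⟨i, hi⟩ else 0
  idxB := fun l i => if hi : i < k₂ then m * (k₁ + i) + g l ⟨i, hi⟩ else 0

section Sets

open Finset

/-- The set of the numbers `φ 0, …, φ (k - 1)`. -/
def rangeSet (M k : ℕ) (φ : ℕ → ℕ) : Finset (Fin M) := {j | ∃ i < k, φ i = j}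

variable {M k : ℕ} {φ : ℕ → ℕ}

theorem mem_rangeSet {j : Fin M} : j ∈ rangeSet M k φ ↔ ∃ i < k, φ i = j := by
  simp [rangeSet]

theorem card_rangeSet (hφ : ∀ i < k, φ i < M) (hinj : ∀ i < k, ∀ i' < k, φ i = φ i' → i = i') :
    (rangeSet M k φ).card = k := by
  have : rangeSet M k φ = (univ : Finset (Fin k)).image fun i => ⟨φ i, hφ i i.2⟩ := by
    ext j
    simp only [mem_rangeSet, mem_image, mem_univ, true_and, Fin.ext_iff]
    exact ⟨fun ⟨i, hi, e⟩ => ⟨⟨i, hi⟩, e⟩, fun ⟨i, e⟩ => ⟨i, i.2, e⟩⟩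
  rw [this, card_image_of_injective _ fun i i' e => Fin.ext (hinj i i.2 i' i'.2
    (by simpa using e)), card_univ, Fintype.card_fin]

theorem mul_add_inj {m a a' b b' : ℕ} (hb : b < m) (hb' : b' < m) (h : m * a + b = m * a' + b') :
    a = a' ∧ b = b' := by
  have h₁ := congrArg (· / m) h
  have h₂ := congrArg (· % m) h
  have hm : 0 < m := by omega
  simp only [Nat.mul_add_div hm, Nat.div_eq_of_lt hb, Nat.div_eq_of_lt hb', Nat.mul_add_mod,
    Nat.mod_eq_of_lt hb, Nat.mod_eq_of_lt hb'] at h₁ h₂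
  exact ⟨by omega, h₂⟩

/-- Sets of functions with few intersections: disjoint blocks. -/
theorem sum_blocks_le (x : ℝ) (L c : ℕ) (hM : c + L * k ≤ M) :
    ∑ l ∈ range L, ∑ l' ∈ range L, x ^ (rangeSet M k (fun i => c + (l * k + i)) ∩
      rangeSet M k (fun i => c + (l' * k + i))).card ≤ L * x ^ k + (L : ℝ) ^ 2 := by
  have hblock : ∀ l < L, l * k + k ≤ L * k := fun l hl => by
    rw [← Nat.succ_mul]; exact Nat.mul_le_mul_right _ hl
  -- Distinct blocks are disjoint and contribute `x ^ 0 = 1`.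
  calc _ ≤ ∑ l ∈ range L, ∑ l' ∈ range L, ((if l = l' then x ^ k else 0) + 1) := by
        refine sum_le_sum fun l hl => sum_le_sum fun l' hl' => ?_
        have hb := hblock l (mem_range.1 hl)
        by_cases h : l = l'
        · subst h
          rw [if_pos rfl, inter_self, card_rangeSet (fun i hi => by omega)
            (fun i _ i' _ e => by omega)]
          linarith
        · have : rangeSet M k (fun i => c + (l * k + i)) ∩
              rangeSet M k (fun i => c + (l' * k + i)) = ∅ := by
            ext j
            simp only [mem_inter, mem_rangeSet, notMem_empty, iff_false, not_and]
            rintro ⟨i, hi, e⟩ ⟨i', hi', e'⟩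
            exact h (mul_add_inj (m := k) hi hi' (by rw [Nat.mul_comm k, Nat.mul_comm k]; omega)).1
          rw [this, if_neg h]
          simp
    _ = L * x ^ k + (L : ℝ) ^ 2 := by
        simp only [sum_add_distrib, sum_ite_eq, sum_const, card_range, nsmul_eq_mul, mul_one]
        rw [sum_congr rfl fun l hl => if_pos hl]
        simp only [sum_const, card_range, nsmul_eq_mul]
        ring

/-- Sets of functions with few intersections: words that agree in few positions. -/
theorem card_words_inter_le {m c : ℕ} (f f' : Fin k → Fin m) (hM : m * (c + k) ≤ M) :
    (rangeSet M k (fun i => if hi : i < k then m * (c + i) + f ⟨i, hi⟩ else 0) ∩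
      rangeSet M k (fun i => if hi : i < k then m * (c + i) + f' ⟨i, hi⟩ else 0)).card ≤
      #{i | f i = f' i} := by
  classical
  have hlt : ∀ i : Fin k, m * (c + i) + f i < M := fun i => by
    have h₁ : m * (c + i) + m ≤ m * (c + k) := by
      rw [← Nat.mul_succ]; exact Nat.mul_le_mul_left _ (by have := i.2; omega)
    have := (f i).2
    omega
  refine (card_le_card (t := ({i | f i = f' i} : Finset (Fin k)).image
    fun i => ⟨m * (c + i) + f i, hlt i⟩) fun j hj => ?_).trans card_image_le
  obtain ⟨⟨i, hi, e⟩, ⟨i', hi', e'⟩⟩ := (mem_inter.1 hj).imp mem_rangeSet.1 mem_rangeSet.1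
  rw [dif_pos hi] at e
  rw [dif_pos hi'] at e'
  -- Each coordinate owns a block of `m` numbers, so a common number reveals both the coordinate and
  -- the letter.
  obtain ⟨h₁, h₂⟩ := mul_add_inj (f ⟨i, hi⟩).2 (f' ⟨i', hi'⟩).2 (e.trans e'.symm)
  obtain rfl : i = i' := by omega
  exact mem_image.2 ⟨⟨i, hi⟩, mem_filter.2 ⟨mem_univ _, Fin.ext h₂⟩, Fin.ext e⟩

theorem card_word {m c : ℕ} (f : Fin k → Fin m) (hM : m * (c + k) ≤ M) :
    (rangeSet M k (fun i => if hi : i < k then m * (c + i) + f ⟨i, hi⟩ else 0)).card = k := by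
  refine card_rangeSet (fun i hi => ?_) fun i hi i' hi' e => ?_
  · rw [dif_pos hi]
    have h₁ : m * (c + i) + m ≤ m * (c + k) := by
      rw [← Nat.mul_succ]; exact Nat.mul_le_mul_left _ (by omega)
    have := (f ⟨i, hi⟩).2
    omega
  · rw [dif_pos hi, dif_pos hi'] at e
    have := (mul_add_inj (f ⟨i, hi⟩).2 (f ⟨i', hi'⟩).2 e).1
    omega

end Sets

variable {n L₁ L₂ k₁ k₂ H p cap₁ cap₂ m : ℕ} {x ε : ℝ}

theorem independent_spread
    (h₁ : L₁ * x ^ k₁ + (L₁ : ℝ) ^ 2 ≤ (1 + ε) * (L₁ : ℝ) ^ 2)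
    (h₂ : L₂ * x ^ k₂ + (L₂ : ℝ) ^ 2 ≤ (1 + ε) * (L₂ : ℝ) ^ 2) :
    (independent n L₁ L₂ k₁ k₂ H p cap₁ cap₂).Spread x ε := by
  have hA : ∀ l, (independent n L₁ L₂ k₁ k₂ H p cap₁ cap₂).setA l =
      rangeSet (independent n L₁ L₂ k₁ k₂ H p cap₁ cap₂).numHash k₁
        (fun i => 0 + (l * k₁ + i)) := fun l => by
    simp only [Nat.zero_add]; rfl
  have hB : ∀ l, (independent n L₁ L₂ k₁ k₂ H p cap₁ cap₂).setB l =
      rangeSet (independent n L₁ L₂ k₁ k₂ H p cap₁ cap₂).numHash k₂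
        (fun i => L₁ * k₁ + (l * k₂ + i)) := fun l => rfl
  have b₁ : ∀ l < L₁, l * k₁ + k₁ ≤ L₁ * k₁ := fun l hl => by
    rw [← Nat.succ_mul]; exact Nat.mul_le_mul_right _ hl
  have b₂ : ∀ l < L₂, l * k₂ + k₂ ≤ L₂ * k₂ := fun l hl => by
    rw [← Nat.succ_mul]; exact Nat.mul_le_mul_right _ hl
  have hM₁ : ∀ l < L₁, ∀ i < k₁, 0 + (l * k₁ + i) < L₁ * k₁ + L₂ * k₂ := fun l hl i hi => by
    have := b₁ l hl; omega
  have hM₂ : ∀ l < L₂, ∀ i < k₂, L₁ * k₁ + (l * k₂ + i) < L₁ * k₁ + L₂ * k₂ := fun l hl i hi => by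
    have := b₂ l hl; omega
  refine ⟨fun l hl => ?_, fun l hl => ?_, fun l hl l' hl' => ?_, ?_, ?_⟩
  · exact hA l ▸ card_rangeSet (fun i hi => hM₁ l hl i hi) (fun i _ i' _ e => by omega)
  · exact hB l ▸ card_rangeSet (fun i hi => hM₂ l hl i hi) (fun i _ i' _ e => by omega)
  · rw [hA, hB]
    refine Finset.disjoint_left.2 ?_
    intro j hj hj'
    obtain ⟨i, hi, e⟩ := mem_rangeSet.1 hj
    obtain ⟨i', hi', e'⟩ := mem_rangeSet.1 hj'
    have : l * k₁ + k₁ ≤ L₁ * k₁ := b₁ l hl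
    omega
  · simp only [hA]
    exact (sum_blocks_le x L₁ 0 (by simp [independent])).trans h₁
  · simp only [hB]
    exact (sum_blocks_le x L₂ (L₁ * k₁) le_rfl).trans h₂

/-- The two kinds of tuples draw from different blocks of functions, so a separate design for each
kind suffices. -/
theorem exists_shared_spread (n H p cap₁ cap₂ : ℕ) (hx : 1 ≤ x) (hm : 0 < m)
    (h₁ : L₁ * x ^ k₁ + (L₁ : ℝ) ^ 2 * (1 + x / m) ^ k₁ ≤ (1 + ε) * (L₁ : ℝ) ^ 2)
    (h₂ : L₂ * x ^ k₂ + (L₂ : ℝ) ^ 2 * (1 + x / m) ^ k₂ ≤ (1 + ε) * (L₂ : ℝ) ^ 2) :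
    ∃ f g, (shared n L₁ L₂ k₁ k₂ H p cap₁ cap₂ m f g).Spread x ε := by
  obtain ⟨f, hf⟩ := exists_design k₁ m hm hx L₁
  obtain ⟨g, hg⟩ := exists_design k₂ m hm hx L₂
  refine ⟨f, g, ?_⟩
  have hA : ∀ l, (shared n L₁ L₂ k₁ k₂ H p cap₁ cap₂ m f g).setA l =
      rangeSet (shared n L₁ L₂ k₁ k₂ H p cap₁ cap₂ m f g).numHash k₁
        (fun i => if hi : i < k₁ then m * (0 + i) + f l ⟨i, hi⟩ else 0) := fun l => by
    simp only [Nat.zero_add]; rfl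
  have hB : ∀ l, (shared n L₁ L₂ k₁ k₂ H p cap₁ cap₂ m f g).setB l =
      rangeSet (shared n L₁ L₂ k₁ k₂ H p cap₁ cap₂ m f g).numHash k₂
        (fun i => if hi : i < k₂ then m * (k₁ + i) + g l ⟨i, hi⟩ else 0) := fun l => rfl
  have b₁ : m * (0 + k₁) ≤ (k₁ + k₂) * m := by
    rw [Nat.mul_comm]; exact Nat.mul_le_mul_right _ (by omega)
  have b₂ : m * (k₁ + k₂) ≤ (k₁ + k₂) * m := (Nat.mul_comm _ _).le
  refine ⟨fun l hl => ?_, fun l hl => ?_, fun l hl l' hl' => ?_, ?_, ?_⟩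
  · exact hA l ▸ card_word _ b₁
  · exact hB l ▸ card_word _ b₂
  · rw [hA, hB]
    refine Finset.disjoint_left.2 ?_
    intro j hj hj'
    obtain ⟨i, hi, e⟩ := mem_rangeSet.1 hj
    obtain ⟨i', hi', e'⟩ := mem_rangeSet.1 hj'
    rw [dif_pos hi] at e
    rw [dif_pos hi'] at e'
    have := (mul_add_inj (f l ⟨i, hi⟩).2 (g l' ⟨i', hi'⟩).2 (e.trans e'.symm)).1
    omega
  · simp only [hA]
    refine ((Finset.sum_le_sum fun l _ => Finset.sum_le_sum fun l' _ => ?_).trans hf).trans h₁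
    exact pow_le_pow_right₀ hx (card_words_inter_le _ _ b₁)
  · simp only [hB]
    refine ((Finset.sum_le_sum fun l _ => Finset.sum_le_sum fun l' _ => ?_).trans hg).trans h₂
    exact pow_le_pow_right₀ hx (card_words_inter_le _ _ b₂)

/-- Numerical conditions under which everything fits into words. -/
structure Small (T : Layout) (w : ℕ) : Prop where
  n_pos : 0 < T.n
  L₁_pos : 0 < T.L₁
  L₂_pos : 0 < T.L₂
  p_pos : 0 < T.p
  cap₁_pos : 0 < T.cap₁
  cap₂_pos : 0 < T.cap₂
  H_pos : 0 < T.H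
  space_lt : T.tableSize + T.workSize < 2 ^ w
  positions_lt : T.positions + T.k₁ + T.k₂ < 2 ^ w
  numHash_lt : T.numHash < 2 ^ w
  cap₁_lt : T.cap₁ < 2 ^ w
  cap₂_lt : T.cap₂ < 2 ^ w
  pH_lt : 2 * (T.p * T.H) < 2 ^ w

theorem independent_fits {w : ℕ} (h : (independent n L₁ L₂ k₁ k₂ H p cap₁ cap₂).Small w) :
    (independent n L₁ L₂ k₁ k₂ H p cap₁ cap₂).Fits w where
  __ := h
  idxA_lt := fun l hl i hi => by
    have : l * k₁ + k₁ ≤ L₁ * k₁ := by rw [← Nat.succ_mul]; exact Nat.mul_le_mul_right _ hl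
    simp only [independent] at hi ⊢
    omega
  idxB_lt := fun l hl i hi => by
    have : l * k₂ + k₂ ≤ L₂ * k₂ := by rw [← Nat.succ_mul]; exact Nat.mul_le_mul_right _ hl
    simp only [independent] at hi ⊢
    omega
  idxA_eq := fun _ _ _ _ _ => rfl
  idxB_eq := fun _ _ _ _ _ => rfl
  positions_le := fun _ => le_rfl

theorem shared_fits {w : ℕ} {f : ℕ → Fin k₁ → Fin m} {g : ℕ → Fin k₂ → Fin m}
    (h : (shared n L₁ L₂ k₁ k₂ H p cap₁ cap₂ m f g).Small w) :
    (shared n L₁ L₂ k₁ k₂ H p cap₁ cap₂ m f g).Fits w where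
  __ := h
  idxA_lt := fun l _ i (hi : i < k₁) => by
    have h₁ : m * i + m ≤ (k₁ + k₂) * m := by
      rw [← Nat.mul_succ, Nat.mul_comm]; exact Nat.mul_le_mul_right _ (by omega)
    have := (f l ⟨i, hi⟩).2
    simp only [shared, dif_pos hi]
    omega
  idxB_lt := fun l _ i (hi : i < k₂) => by
    have h₁ : m * (k₁ + i) + m ≤ (k₁ + k₂) * m := by
      rw [← Nat.mul_succ, Nat.mul_comm]; exact Nat.mul_le_mul_right _ (by omega)
    have := (g l ⟨i, hi⟩).2
    simp only [shared, dif_pos hi]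
    omega
  idxA_eq := fun h => absurd h (by simp [shared])
  idxB_eq := fun h => absurd h (by simp [shared])
  positions_le := fun h => absurd h (by simp [shared])

end Layout

/-! ## The parameters -/

namespace Layout

/-- The parameters are in the range that leads to the claimed bounds; `x` stands for `1 / p₁` and
`v` for `n ^ ρ`. -/
structure Moderate (T : Layout) (x v : ℝ) : Prop where
  one_le_x : 1 ≤ x
  one_le_v : 1 ≤ v
  v_le : v ≤ T.n
  pow_le : x ^ (T.k₁ + T.k₂) ≤ v * x
  le_L₁ : 16 * x ^ T.k₁ ≤ T.L₁
  L₁_le : T.L₁ ≤ 17 * x ^ T.k₁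
  le_L₂ : 16 * x ^ T.k₂ ≤ T.L₂
  L₂_le : T.L₂ ≤ 17 * x ^ T.k₂
  cap₁_eq : T.cap₁ = 100 * (T.L₁ * T.L₂)
  le_cap₂ : 9248 * v ≤ T.cap₂
  cap₂_le : T.cap₂ ≤ 9249 * v
  numHash_le : T.numHash ≤ 17 * (((T.k₁ + T.k₂ : ℕ) : ℝ) ^ 2 * x)
  positions_le : T.positions ≤ 9 * (((T.k₁ + T.k₂ : ℕ) : ℝ) ^ 2 * x + v * x)
  listSize_le : T.listSize ≤ 19 * (v * x)
  cacheSize_le : T.cacheSize ≤ 19 * (v * x)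

namespace Moderate

variable {T : Layout} {x v : ℝ}

theorem one_le_vx (h : T.Moderate x v) : 1 ≤ v * x :=
  one_le_mul_of_one_le_of_one_le h.one_le_v h.one_le_x

theorem L_le (h : T.Moderate x v) : ((T.L₁ * T.L₂ : ℕ) : ℝ) ≤ 289 * (v * x) := by
  have hx : 0 ≤ x := zero_le_one.trans h.one_le_x
  push_cast
  calc (T.L₁ : ℝ) * T.L₂ ≤ (17 * x ^ T.k₁) * (17 * x ^ T.k₂) :=
        mul_le_mul h.L₁_le h.L₂_le (by positivity) (by positivity)
    _ = 289 * x ^ (T.k₁ + T.k₂) := by rw [pow_add]; ring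
    _ ≤ _ := by have := h.pow_le; linarith

theorem L_add_le (h : T.Moderate x v) : ((T.L₁ + T.L₂ : ℕ) : ℝ) ≤ 34 * (v * x) := by
  have h₁ : x ^ T.k₁ ≤ v * x := (pow_le_pow_right₀ h.one_le_x (by omega)).trans h.pow_le
  have h₂ : x ^ T.k₂ ≤ v * x := (pow_le_pow_right₀ h.one_le_x (by omega)).trans h.pow_le
  have := h.L₁_le
  have := h.L₂_le
  push_cast
  linarith

theorem L₁_pos (h : T.Moderate x v) : 0 < T.L₁ := by
  have := one_le_pow₀ (n := T.k₁) h.one_le_x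
  have := h.le_L₁
  exact_mod_cast (by linarith : (0 : ℝ) < T.L₁)

theorem L₂_pos (h : T.Moderate x v) : 0 < T.L₂ := by
  have := one_le_pow₀ (n := T.k₂) h.one_le_x
  have := h.le_L₂
  exact_mod_cast (by linarith : (0 : ℝ) < T.L₂)

theorem space_le (h : T.Moderate x v) :
    ((T.tableSize + T.workSize : ℕ) : ℝ) ≤ 1000 * (T.n * v * x) := by
  have h₁ : (T.tableSize + T.workSize : ℕ) =
      21 + T.listSize + 3 * (T.L₁ * T.L₂ * T.n) + T.cacheSize + (T.L₁ + T.L₂) := by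
    simp only [tableSize, nextBase, fpBase, headBase, entries, workSize]
    ring
  have hn : (1 : ℝ) ≤ T.n := h.one_le_v.trans h.v_le
  have h₂ : v * x ≤ T.n * v * x := by
    rw [mul_assoc]; exact le_mul_of_one_le_left (by linarith [h.one_le_vx]) hn
  have h₃ : ((T.L₁ * T.L₂ : ℕ) : ℝ) * T.n ≤ 289 * (v * x) * T.n :=
    mul_le_mul_of_nonneg_right h.L_le (by positivity)
  have := h.listSize_le
  have := h.cacheSize_le
  have := h.L_add_le
  have := h.one_le_vx
  rw [h₁]
  push_cast at *
  linarith

theorem steps_le (h : T.Moderate x v) :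
    ((115 + 5 * T.cacheSize + 24 * T.positions + 9 * (T.L₁ + T.L₂) +
    30 * (T.L₁ * T.L₂ + T.cap₁ + T.cap₂) : ℕ) : ℝ) ≤
    2000000 * (v * x + ((T.k₁ + T.k₂ : ℕ) : ℝ) ^ 2 * x) := by
  have h₁ : ((T.cap₁ : ℕ) : ℝ) = 100 * (T.L₁ * T.L₂ : ℕ) := by rw [h.cap₁_eq]; push_cast; ring
  have h₂ : v ≤ v * x := le_mul_of_one_le_right (by linarith [h.one_le_v]) h.one_le_x
  have h₃ : 0 ≤ ((T.k₁ + T.k₂ : ℕ) : ℝ) ^ 2 * x :=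
    mul_nonneg (sq_nonneg _) (by linarith [h.one_le_x])
  have := h.cacheSize_le
  have := h.positions_le
  have := h.L_add_le
  have := h.L_le
  have := h.cap₂_le
  have := h.one_le_vx
  push_cast at *
  linarith

theorem small (h : T.Moderate x v) {w : ℕ} (hp : 0 < T.p) (hH : 0 < T.H)
    (hpH : 2 * (T.p * T.H) < 2 ^ w)
    (hw : 100000 * (2 * T.n * ((T.k₁ + T.k₂ : ℕ) + 1) * x) ^ 2 < (2 : ℝ) ^ w) : T.Small w := by
  have hx := h.one_le_x
  have hn : (1 : ℝ) ≤ T.n := h.one_le_v.trans h.v_le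
  set k : ℝ := ((T.k₁ + T.k₂ : ℕ) : ℝ) with hk
  have hk0 : 0 ≤ k := by positivity
  set y : ℝ := 2 * T.n * (k + 1) * x with hy
  have b₁ : T.n * v * x ≤ y ^ 2 := by
    -- Every size is at most a constant times `y ^ 2`, where `y` is the argument of the logarithm in
    -- the bound on the word length.
    calc T.n * v * x ≤ T.n * T.n * x := by have := h.v_le; gcongr
      _ ≤ T.n * T.n * x * (4 * (k + 1) ^ 2 * x) :=
          le_mul_of_one_le_right (by positivity) (by nlinarith [mul_nonneg hk0 hk0])
      _ = y ^ 2 := by rw [hy]; ring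
  have b₂ : v * x ≤ y ^ 2 := le_trans (by
    rw [mul_assoc]; exact le_mul_of_one_le_left (by linarith [h.one_le_vx]) hn) b₁
  have b₃ : (k + 1) ^ 2 * x ≤ y ^ 2 := by
    calc (k + 1) ^ 2 * x ≤ (k + 1) ^ 2 * x * (4 * (T.n * T.n) * x) :=
          le_mul_of_one_le_right (by positivity)
            (by nlinarith [one_le_mul_of_one_le_of_one_le hn hn])
      _ = y ^ 2 := by rw [hy]; ring
  have b₄ : k ^ 2 * x + k ≤ (k + 1) ^ 2 * x := by nlinarith
  have b₅ : 0 ≤ k ^ 2 * x := by positivity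
  have b₆ : v ≤ v * x := le_mul_of_one_le_right (by linarith [h.one_le_v]) hx
  have hlt : ∀ a : ℕ, (a : ℝ) ≤ 100000 * y ^ 2 → a < 2 ^ w := fun a ha => by
    exact_mod_cast ha.trans_lt hw
  have hcap : ((T.cap₁ : ℕ) : ℝ) = 100 * (T.L₁ * T.L₂ : ℕ) := by rw [h.cap₁_eq]; push_cast; ring
  have hL := h.L_le
  refine ⟨by exact_mod_cast (by linarith : (0 : ℝ) < T.n), h.L₁_pos, h.L₂_pos, hp, ?_, ?_, hH,
    hlt _ ?_, hlt _ ?_, hlt _ ?_, hlt _ ?_, hlt _ ?_, hpH⟩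
  · rw [h.cap₁_eq]
    have := Nat.mul_pos h.L₁_pos h.L₂_pos
    omega
  · have := h.le_cap₂
    have := h.one_le_v
    exact_mod_cast (by linarith : (0 : ℝ) < T.cap₂)
  · linarith [h.space_le]
  · have := h.positions_le
    rw [Nat.add_assoc, Nat.cast_add]
    linarith
  · linarith [h.numHash_le]
  · linarith
  · linarith [h.cap₂_le]

/-- Mismatches contribute `5 / 100`. Complete far collisions and false fingerprint matches have
expectation at most `289 * v` each, and `2 * 289 / 9248 = 1 / 16`. -/
theorem failure_le (h : T.Moderate x v) {p₂ : ℝ} (hp₂ : 0 ≤ p₂)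
    (hfar : T.n * p₂ ^ (T.k₁ + T.k₂) * x ^ (T.k₁ + T.k₂) ≤ v)
    (hH : 2 * (2 * T.n * ((T.k₁ + T.k₂ : ℕ) + 1) * x) ≤ T.H) :
    2 * (13 / 100) + 5 * ((T.L₁ * T.L₂ : ℕ) : ℝ) / T.cap₁ + (T.L₁ * T.L₂ : ℕ) * T.n *
      (p₂ ^ (T.k₁ + T.k₂) + (3 * (T.k₁ + T.k₂ : ℕ) + 1) / T.H) / T.cap₂ ≤ 1 / 2 := by
  have hx := h.one_le_x
  have hv := h.one_le_v
  have hn : (1 : ℝ) ≤ T.n := hv.trans h.v_le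
  set k : ℝ := ((T.k₁ + T.k₂ : ℕ) : ℝ) with hk
  have hk0 : 0 ≤ k := by positivity
  have hL0 : (0 : ℝ) < (T.L₁ * T.L₂ : ℕ) := by exact_mod_cast Nat.mul_pos h.L₁_pos h.L₂_pos
  have hc₂ : (0 : ℝ) < T.cap₂ := by linarith [h.le_cap₂]
  have hcap : ((T.cap₁ : ℕ) : ℝ) = 100 * (T.L₁ * T.L₂ : ℕ) := by rw [h.cap₁_eq]; push_cast; ring
  have h₁ : 5 * ((T.L₁ * T.L₂ : ℕ) : ℝ) / T.cap₁ = 1 / 20 := by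
    rw [hcap]; field_simp; norm_num
  have hH0 : (0 : ℝ) < T.H := lt_of_lt_of_le (by positivity) hH
  have h₂ : ((T.L₁ * T.L₂ : ℕ) : ℝ) * T.n * p₂ ^ (T.k₁ + T.k₂) ≤ 289 * v := by
    have hL : ((T.L₁ * T.L₂ : ℕ) : ℝ) ≤ 289 * x ^ (T.k₁ + T.k₂) := by
      push_cast
      calc (T.L₁ : ℝ) * T.L₂ ≤ (17 * x ^ T.k₁) * (17 * x ^ T.k₂) :=
            mul_le_mul h.L₁_le h.L₂_le (by positivity) (by positivity)
        _ = _ := by rw [pow_add]; ring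
    calc _ ≤ 289 * x ^ (T.k₁ + T.k₂) * T.n * p₂ ^ (T.k₁ + T.k₂) := by gcongr
      _ = 289 * (T.n * p₂ ^ (T.k₁ + T.k₂) * x ^ (T.k₁ + T.k₂)) := by ring
      _ ≤ _ := by linarith
  -- The number of tables is bounded only by `289 * (v * x)`; the size of `H` absorbs the factor `x`
  -- along with `n` and `k`.
  have h₃ : ((T.L₁ * T.L₂ : ℕ) : ℝ) * T.n * ((3 * k + 1) / T.H) ≤ 289 * v := by
    rw [mul_div_assoc', div_le_iff₀ hH0]
    calc _ ≤ 289 * (v * x) * T.n * (3 * k + 1) := by have := h.L_le; gcongr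
      _ = 289 * v * (T.n * (3 * k + 1) * x) := by ring
      _ ≤ 289 * v * (2 * (2 * T.n * (k + 1) * x)) := by
          have : 0 ≤ T.n * x * (k + 3) := by positivity
          gcongr 289 * v * ?_
          linarith
      _ ≤ _ := by gcongr
  have h₄ : ((T.L₁ * T.L₂ : ℕ) : ℝ) * T.n * (p₂ ^ (T.k₁ + T.k₂) + (3 * k + 1) / T.H) / T.cap₂ ≤
      1 / 16 := by
    rw [div_le_iff₀ hc₂, mul_add]
    linarith [h.le_cap₂]
  rw [h₁]
  linarith

end Moderate

end Layout

/-! ### Choosing between disjoint and shared functions -/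

namespace Layout

variable {n k₁ k₂ H p w : ℕ} {x v : ℝ}

theorem ceil_le_of_one_le {a c : ℝ} (hc : 0 ≤ c) (ha : 1 ≤ a) : (⌈c * a⌉₊ : ℝ) ≤ (c + 1) * a := by
  have := Nat.ceil_lt_add_one (a := c * a) (by positivity)
  linarith

/-- The pool size keeps the exponent in `(1 + x / m) ^ k₁ ≤ exp (k₁ * x / m)` below `1 / 16`. This
is what forces about `k * x` functions per coordinate. -/
theorem one_add_div_pow_le {k m : ℕ} (hk : k₁ ≤ k) (hm0 : 0 < m) (hm : 16 * (k * x) ≤ m)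
    (hx : 0 ≤ x) : (1 + x / m) ^ k₁ ≤ 16 / 15 := by
  have hm' : (0 : ℝ) < m := by exact_mod_cast hm0
  have h₁ : k₁ * (x / m) ≤ 1 / 16 := by
    rw [mul_div_assoc', div_le_iff₀ hm']
    have : (k₁ : ℝ) * x ≤ k * x := by gcongr
    linarith
  calc (1 + x / m) ^ k₁ ≤ Real.exp (x / m) ^ k₁ := by
        gcongr
        rw [add_comm]
        exact Real.add_one_le_exp _
    _ = Real.exp (k₁ * (x / m)) := (Real.exp_nat_mul _ _).symm
    _ ≤ Real.exp (1 / 16) := Real.exp_le_exp.2 h₁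
    _ ≤ 1 / (1 - 1 / 16) := Real.exp_bound_div_one_sub_of_interval (by norm_num) (by norm_num)
    _ = 16 / 15 := by norm_num

/-- With `k₁ = 1 + j`, the inequality `2 * k * x ^ j ≤ k ^ 2 + x ^ (2 * j)` is multiplied by `x`,
and `2 * j + 1 ≤ k₁ + k₂` because the split is even. -/
theorem positions_bound (hx : 1 ≤ x) (hk : 1 ≤ k₁) (h₁ : k₂ ≤ k₁) (h₂ : k₁ ≤ k₂ + 1) :
    2 * (k₁ * x ^ k₁ + k₂ * x ^ k₂) ≤ ((k₁ + k₂ : ℕ) : ℝ) ^ 2 * x + x ^ (k₁ + k₂) := by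
  have hx0 : 0 ≤ x := zero_le_one.trans hx
  obtain ⟨j, rfl⟩ := Nat.exists_eq_add_of_le hk
  have hpow : x ^ k₂ ≤ x ^ (1 + j) := pow_le_pow_right₀ hx h₁
  set k : ℝ := ((1 + j + k₂ : ℕ) : ℝ) with hkdef
  have hsq : 2 * (k * x ^ j) ≤ k ^ 2 + x ^ (2 * j) := by
    have := two_mul_le_add_sq k (x ^ j)
    rw [← pow_mul, mul_comm j 2] at this
    linarith
  calc 2 * (((1 + j : ℕ) : ℝ) * x ^ (1 + j) + k₂ * x ^ k₂)
      ≤ 2 * (((1 + j : ℕ) : ℝ) * x ^ (1 + j) + k₂ * x ^ (1 + j)) := by gcongr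
    _ = (2 * (k * x ^ j)) * x := by rw [hkdef, pow_add]; push_cast; ring
    _ ≤ (k ^ 2 + x ^ (2 * j)) * x := by gcongr
    _ = k ^ 2 * x + x ^ (2 * j + 1) := by ring
    _ ≤ _ := add_le_add_right (pow_le_pow_right₀ hx (by omega)) _

/-- For suitable parameters one of the two layouts works. -/
theorem exists_layout (hx : 1 ≤ x) (hv : 1 ≤ v) (hvn : v ≤ n) (hk : 1 ≤ k₁) (h₁ : k₂ ≤ k₁)
    (h₂ : k₁ ≤ k₂ + 1) (hpow : x ^ (k₁ + k₂) ≤ v * x) (hp : 0 < p) (hH : 0 < H)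
    (hpH : 2 * (p * H) < 2 ^ w)
    (hw : 100000 * (2 * n * ((k₁ + k₂ : ℕ) + 1) * x) ^ 2 < (2 : ℝ) ^ w) :
    ∃ T : Layout, T.n = n ∧ T.k₁ = k₁ ∧ T.k₂ = k₂ ∧ T.H = H ∧ T.p = p ∧ T.Moderate x v ∧
      T.Fits w ∧ T.Spread x (13 / 100) := by
  have hx0 : 0 ≤ x := zero_le_one.trans hx
  set k := k₁ + k₂ with hkdef
  have hk1 : (1 : ℝ) ≤ k := by exact_mod_cast (by omega : 1 ≤ k)
  set L₁ := ⌈16 * x ^ k₁⌉₊ with hL₁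
  set L₂ := ⌈16 * x ^ k₂⌉₊ with hL₂
  set m := ⌈16 * (k * x)⌉₊ with hm
  have l₁ : 16 * x ^ k₁ ≤ L₁ := Nat.le_ceil _
  have l₂ : 16 * x ^ k₂ ≤ L₂ := Nat.le_ceil _
  have lm : 16 * (k * x) ≤ m := Nat.le_ceil _
  have u₁ : (L₁ : ℝ) ≤ 17 * x ^ k₁ :=
    (ceil_le_of_one_le (by norm_num) (one_le_pow₀ hx)).trans_eq (by norm_num)
  have u₂ : (L₂ : ℝ) ≤ 17 * x ^ k₂ :=
    (ceil_le_of_one_le (by norm_num) (one_le_pow₀ hx)).trans_eq (by norm_num)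
  have um : (m : ℝ) ≤ 17 * (k * x) :=
    (ceil_le_of_one_le (by norm_num) (one_le_mul_of_one_le_of_one_le hk1 hx)).trans_eq (by norm_num)
  have lc : 9248 * v ≤ ⌈9248 * v⌉₊ := Nat.le_ceil _
  have uc : (⌈9248 * v⌉₊ : ℝ) ≤ 9249 * v :=
    (ceil_le_of_one_le (by norm_num) hv).trans_eq (by norm_num)
  have hm0 : 0 < m := by
    have := one_le_mul_of_one_le_of_one_le hk1 hx
    exact_mod_cast (by linarith : (0 : ℝ) < m)
  have hvx : 1 ≤ v * x := one_le_mul_of_one_le_of_one_le hv hx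
  have hJ : ((L₁ * k₁ + L₂ * k₂ : ℕ) : ℝ) ≤ 17 / 2 * ((k : ℝ) ^ 2 * x + x ^ k) := by
    have := positions_bound hx hk h₁ h₂
    have b₁ : (L₁ : ℝ) * k₁ ≤ 17 * x ^ k₁ * k₁ := by gcongr
    have b₂ : (L₂ : ℝ) * k₂ ≤ 17 * x ^ k₂ * k₂ := by gcongr
    push_cast
    rw [← hkdef] at this
    linarith
  have hJ' : ((L₁ * k₁ + L₂ * k₂ : ℕ) : ℝ) ≤ 9 * ((k : ℝ) ^ 2 * x + v * x) := by
    have : 0 ≤ (k : ℝ) ^ 2 * x := by positivity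
    linarith
  have hK : ((k * m : ℕ) : ℝ) ≤ 17 * ((k : ℝ) ^ 2 * x) := by
    push_cast
    calc (k : ℝ) * m ≤ k * (17 * (k * x)) := by gcongr
      _ = _ := by ring
  have hK' : 16 * ((k : ℝ) ^ 2 * x) ≤ ((k * m : ℕ) : ℝ) := by
    push_cast
    calc 16 * ((k : ℝ) ^ 2 * x) = k * (16 * (k * x)) := by ring
      _ ≤ _ := by gcongr
  have s₁ : (L₁ : ℝ) * x ^ k₁ ≤ (1 / 16) * (L₁ : ℝ) ^ 2 := by
    rw [sq]; nlinarith [mul_le_mul_of_nonneg_left l₁ (Nat.cast_nonneg (α := ℝ) L₁)]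
  have s₂ : (L₂ : ℝ) * x ^ k₂ ≤ (1 / 16) * (L₂ : ℝ) ^ 2 := by
    rw [sq]; nlinarith [mul_le_mul_of_nonneg_left l₂ (Nat.cast_nonneg (α := ℝ) L₂)]
  have q₁ : 0 ≤ (L₁ : ℝ) ^ 2 := sq_nonneg _
  have q₂ : 0 ≤ (L₂ : ℝ) ^ 2 := sq_nonneg _
  -- Compare the number of functions that disjoint tuples need with the size of the pool.
  by_cases hJK : L₁ * k₁ + L₂ * k₂ ≤ k * m
  · refine ⟨independent n L₁ L₂ k₁ k₂ H p (100 * (L₁ * L₂)) ⌈9248 * v⌉₊,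
      rfl, rfl, rfl, rfl, rfl, ?_⟩
    have hM : (independent n L₁ L₂ k₁ k₂ H p (100 * (L₁ * L₂)) ⌈9248 * v⌉₊).Moderate x v := by
      refine ⟨hx, hv, hvn, hpow, l₁, u₁, l₂, u₂, rfl, lc, uc,
        ((Nat.cast_le (α := ℝ)).2 hJK).trans hK, hJ', ?_, ?_⟩
      · simp [listSize, independent]; linarith
      · simp [cacheSize, independent]; linarith
    refine ⟨hM, independent_fits (hM.small hp hH hpH hw), independent_spread ?_ ?_⟩
    · linarith
    · linarith
  · have hpw₁ := one_add_div_pow_le (k₁ := k₁) (Nat.le_add_right k₁ k₂) hm0 lm hx0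
    have hpw₂ := one_add_div_pow_le (k₁ := k₂) (Nat.le_add_left k₂ k₁) hm0 lm hx0
    obtain ⟨f, g, hfg⟩ := exists_shared_spread (x := x) (ε := 13 / 100) (L₁ := L₁) (L₂ := L₂)
      (k₁ := k₁) (k₂ := k₂) n H p (100 * (L₁ * L₂)) ⌈9248 * v⌉₊ hx hm0
      -- The value of `ε` comes from `1 / 16 + 16 / 15 < 113 / 100`.
      (by nlinarith [mul_le_mul_of_nonneg_left hpw₁ q₁])
      (by nlinarith [mul_le_mul_of_nonneg_left hpw₂ q₂])
    refine ⟨shared n L₁ L₂ k₁ k₂ H p (100 * (L₁ * L₂)) ⌈9248 * v⌉₊ m f g,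
      rfl, rfl, rfl, rfl, rfl, ?_⟩
    have hlt : ((k * m : ℕ) : ℝ) ≤ ((L₁ * k₁ + L₂ * k₂ : ℕ) : ℝ) := by
      exact_mod_cast (not_le.1 hJK).le
    -- If the pool is smaller, then `16 k² x ≤ 17 / 2 * (k² x + x ^ k)`, so `k² x` is at most a
    -- constant times `x ^ k ≤ v * x`. Thus the list and the cache, which exist only in this case,
    -- fit into the memory bound.
    have hJ₂ : ((L₁ * k₁ + L₂ * k₂ : ℕ) : ℝ) ≤ 19 * (v * x) := by linarith
    have hM : (shared n L₁ L₂ k₁ k₂ H p (100 * (L₁ * L₂)) ⌈9248 * v⌉₊ m f g).Moderate x v :=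
      ⟨hx, hv, hvn, hpow, l₁, u₁, l₂, u₂, rfl, lc, uc, hK, hJ', hJ₂, hlt.trans hJ₂⟩
    exact ⟨hM, shared_fits (hM.small hp hH hpH hw), hfg⟩

end Layout

/-! ### Word length and seeds -/

section WordLength

/-- A word length that is a large multiple of the logarithm of `y` leaves enough room for the
arithmetic with fingerprints. -/
theorem exists_seed_range {y : ℝ} {w : ℕ} (hy : 2 ≤ y) (hw : 100 * Real.logb 2 y ≤ w) :
    ∃ t p : ℕ, p.Prime ∧ 2 ^ t ≤ p ∧ p ≤ 2 * 2 ^ t ∧ 2 * (p * 2 ^ t) < 2 ^ w ∧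
      2 ^ w ≤ (2 ^ t) ^ 3 ∧ 2 * y ≤ ((2 ^ t : ℕ) : ℝ) ∧ 100000 * y ^ 2 < (2 : ℝ) ^ w := by
  have hy0 : 0 < y := by linarith
  have hlog : 1 ≤ Real.logb 2 y := by
    rw [Real.le_logb_iff_rpow_le (by norm_num) hy0]
    simpa using hy
  have hw100 : 100 ≤ w := by exact_mod_cast (by linarith : (100 : ℝ) ≤ w)
  -- Since `logb 2 y ≥ 1`, the hypothesis dominates `20 + 3 * logb 2 y`.
  have hbig : 2 ^ 20 * y ^ 3 ≤ (2 : ℝ) ^ w := by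
    have h₁ : Real.logb 2 (2 ^ 20 * y ^ 3) ≤ w := by
      rw [Real.logb_mul (by positivity) (by positivity), Real.logb_pow, Real.logb_pow,
        Real.logb_self_eq_one (by norm_num)]
      push_cast
      linarith
    rw [Real.logb_le_iff_le_rpow (by norm_num) (by positivity)] at h₁
    exact_mod_cast h₁
  have ht : w ≤ (w + 2) / 3 * 3 := by omega
  have ht' : (w + 2) / 3 * 3 ≤ w + 2 := by omega
  -- A third of the word length, rounded up: three digits in base `2 ^ t` cover a word, while
  -- products of two numbers of about `t` bits do not overflow.
  set t := (w + 2) / 3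
  have h3 : 2 ^ w ≤ (2 ^ t) ^ 3 := by
    rw [← pow_mul]; exact Nat.pow_le_pow_right (by norm_num) ht
  -- Bertrand's postulate.
  obtain ⟨p, hp, hlt, hle⟩ := Nat.exists_prime_lt_and_le_two_mul (2 ^ t) (by positivity)
  refine ⟨t, p, hp, hlt.le, hle, ?_, h3, ?_, ?_⟩
  · calc 2 * (p * 2 ^ t) ≤ 2 * (2 * 2 ^ t * 2 ^ t) := by gcongr
      _ = 2 ^ (2 + 2 * t) := by ring
      _ < 2 ^ w := Nat.pow_lt_pow_right (by norm_num) (by omega)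
  · refine le_of_pow_le_pow_left₀ (n := 3) (by norm_num) (by positivity) ?_
    calc (2 * y) ^ 3 ≤ 2 ^ 20 * y ^ 3 := by
          rw [mul_pow]; gcongr <;> norm_num
      _ ≤ (2 : ℝ) ^ w := hbig
      _ ≤ _ := by exact_mod_cast h3
  · have : 0 < y ^ 2 := by positivity
    calc 100000 * y ^ 2 < 2 ^ 20 * (2 * y ^ 2) := by linarith
      _ ≤ 2 ^ 20 * y ^ 3 := by rw [pow_succ y 2, mul_comm (y ^ 2) y]; gcongr
      _ ≤ _ := hbig

theorem exists_injective_bits {α : Type*} {N : ℕ} {Z : Finset α} (hZ : Z.card = 2 ^ N) :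
    ∃ dec : (Fin N → Bool) → α, (∀ b, dec b ∈ Z) ∧ Function.Injective dec := by
  have e : (Fin N → Bool) ≃ Z := Fintype.equivOfCardEq (by simp [hZ])
  exact ⟨fun b => e b, fun b => (e b).2, Subtype.val_injective.comp e.injective⟩

end WordLength

/-! ### The exponent `ρ` -/

section Exponents

variable {n k : ℕ} {p₁ p₂ ρ : ℝ}

theorem rpow_rho (hn : 1 ≤ n) (hp₁ : 0 < p₁) (hρ : ρ = Real.log (1 / p₁) / Real.log (1 / p₂)) :
    (n : ℝ) ^ ρ = (1 / p₁) ^ Real.logb (1 / p₂) n := by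
  have hn0 : (0 : ℝ) < n := by exact_mod_cast hn
  rw [Real.rpow_def_of_pos hn0, Real.rpow_def_of_pos (by positivity), hρ, Real.logb]
  ring_nf

theorem rpow_logb_inv (hn : 1 ≤ n) (hp₂ : 0 < p₂) (hp₂' : p₂ < 1) :
    (1 / p₂) ^ Real.logb (1 / p₂) n = n :=
  Real.rpow_logb (by positivity) (by rw [ne_eq, div_eq_one_iff_eq hp₂.ne']; exact hp₂'.ne')
    (by exact_mod_cast hn)

/-- Without rounding, `1 / p₁` to the exponent `log_{1/p₂} n` is exactly `n ^ ρ`. Rounding the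
exponent up costs at most one factor `1 / p₁`. -/
theorem pow_ceil_le (hn : 1 ≤ n) (hp₁ : 0 < p₁) (hp₁' : p₁ ≤ 1) (hp₂ : 0 < p₂) (hp₂' : p₂ < 1)
    (hρ : ρ = Real.log (1 / p₁) / Real.log (1 / p₂)) (hk : k = ⌈Real.logb (1 / p₂) n⌉₊) :
    (1 / p₁) ^ k ≤ (n : ℝ) ^ ρ * (1 / p₁) := by
  have hx : 1 ≤ 1 / p₁ := by rwa [le_div_iff₀ hp₁, one_mul]
  have hlam : 0 ≤ Real.logb (1 / p₂) n :=
    Real.logb_nonneg (by rwa [lt_div_iff₀ hp₂, one_mul]) (by exact_mod_cast hn)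
  rw [rpow_rho hn hp₁ hρ, ← Real.rpow_add_one (by positivity), ← Real.rpow_natCast]
  exact Real.rpow_le_rpow_of_exponent_le hx (hk ▸ (Nat.ceil_lt_add_one hlam).le)

/-- With `l = log_{1/p₂} n` the left side is `(p₂ / p₁) ^ (k - l) * n ^ ρ`, so here rounding up
costs nothing. This is why the number of distance computations has no factor `1 / p₁`. -/
theorem mul_pow_ceil_le (hn : 1 ≤ n) (hp₁ : 0 < p₁) (hp₂ : 0 < p₂) (hp₂' : p₂ < 1)
    (hlt : p₂ ≤ p₁) (hρ : ρ = Real.log (1 / p₁) / Real.log (1 / p₂))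
    (hk : k = ⌈Real.logb (1 / p₂) n⌉₊) : n * p₂ ^ k * (1 / p₁) ^ k ≤ (n : ℝ) ^ ρ := by
  set l := Real.logb (1 / p₂) n
  have hlk : l ≤ k := hk ▸ Nat.le_ceil _
  have h₁ : (n : ℝ) = (1 / p₂) ^ l := (rpow_logb_inv hn hp₂ hp₂').symm
  have h₂ : (p₂ / p₁) ^ ((k : ℝ) - l) ≤ 1 :=
    Real.rpow_le_one (by positivity) (by rwa [div_le_one hp₁]) (by linarith)
  have h₃ : n * p₂ ^ k * (1 / p₁) ^ k = (p₂ / p₁) ^ ((k : ℝ) - l) * (1 / p₁) ^ l := by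
    rw [Real.rpow_sub (by positivity), Real.rpow_natCast, h₁, Real.div_rpow hp₂.le hp₁.le,
      Real.div_rpow zero_le_one hp₂.le, Real.div_rpow zero_le_one hp₁.le, Real.one_rpow]
    have := Real.rpow_pos_of_pos hp₁ l
    have := Real.rpow_pos_of_pos hp₂ l
    field_simp
    rw [div_pow, div_pow, one_pow, mul_one_div]
  rw [h₃, rpow_rho hn hp₁ hρ]
  exact mul_le_of_le_one_left (by positivity) h₂

theorem rho_nonneg (hp₁ : 0 < p₁) (hp₁' : p₁ ≤ 1) (hp₂ : 0 < p₂) (hp₂' : p₂ < 1)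
    (hρ : ρ = Real.log (1 / p₁) / Real.log (1 / p₂)) : 0 ≤ ρ := by
  rw [hρ]
  exact div_nonneg (Real.log_nonneg (by rwa [le_div_iff₀ hp₁, one_mul]))
    (Real.log_nonneg (by rw [le_div_iff₀ hp₂, one_mul]; exact hp₂'.le))

theorem le_of_rho_lt_one (hp₁ : 0 < p₁) (hp₂ : 0 < p₂) (hp₂' : p₂ < 1)
    (hρ : ρ = Real.log (1 / p₁) / Real.log (1 / p₂)) (h : ρ < 1) : p₂ ≤ p₁ := by
  have h₂ : 0 < Real.log (1 / p₂) := Real.log_pos (by rwa [lt_div_iff₀ hp₂, one_mul])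
  rw [hρ, div_lt_one h₂, Real.log_lt_log_iff (by positivity) (by positivity),
    one_div_lt_one_div hp₁ hp₂] at h
  exact h.le

end Exponents

/-! ### Assembling the data structure -/

namespace Layout

variable {T : Layout} {w N : ℕ} {X R Ω : Type*} {h : Ω → X → R} {enc : R → BitVec w}
  {dist : X → X → ℝ} {r₁ r₂ : ℝ} {dec : (Fin N → Bool) → ℕ × ℕ × ℕ}

theorem Fits.queryWithin (hT : T.Fits w) (hdec : ∀ b, dec b ∈ T.seeds) {a b c : ℝ}
    (ha : T.numHash ≤ a) (hb : T.cap₂ ≤ b)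
    (hc : ((115 + 5 * T.cacheSize + 24 * T.positions + 9 * (T.L₁ + T.L₂) +
      30 * (T.L₁ * T.L₂ + T.cap₁ + T.cap₂) : ℕ) : ℝ) ≤ c) (P : Fin T.n → X) (q : X)
    (z : (T.dataStructure w N dec).Outcome Ω) :
    (T.dataStructure w N dec).QueryWithin Prog.query dist r₂ h enc P q z a b c := by
  intro s hs
  obtain ⟨c, s', he, hs', h₁, h₂, h₃, -⟩ := hT.exec_dataStructure hdec dist r₂ P q z s hs
  exact ⟨c, s', he, hs', ((Nat.cast_le (α := ℝ)).2 h₁).trans ha,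
    ((Nat.cast_le (α := ℝ)).2 h₂).trans hb, ((Nat.cast_le (α := ℝ)).2 h₃).trans hc⟩

variable [MeasurableSpace R] [MeasurableSingletonClass R] [MeasurableSpace Ω] {μ : Measure Ω}
  [IsProbabilityMeasure μ]

theorem Fits.solves [Finite R] (hT : T.Fits w) (hdec : ∀ b, dec b ∈ T.seeds)
    (hh : ∀ x, Measurable fun ω => h ω x) (P : Fin T.n → X)
    (hscan : ∀ q, (∃ i, dist q (P i) ≤ r₁) →
      1 / 2 ≤ (outcomeLaw μ T.numHash N).real (T.scanEvent h enc dist r₂ P q dec)) :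
    (T.dataStructure w N dec).Solves Prog.query dist r₁ r₂ μ h enc P := by
  intro q hq
  refine ⟨?_, (hscan q hq).trans (measureReal_mono fun z hz s hs => ?_)⟩
  -- Table and oracle depend on the outcome only through the values at `P` and `q` and the random
  -- bits.
  · exact measurableSet_of_values hh P q fun a : (Fin T.numHash → Fin T.n → R) ×
      (Fin T.numHash → R) × (Fin N → Bool) => ∀ s : RAMState w,
        (T.dataStructure w N dec).Holds
          ((T.dataStructure w N dec).build (fun j i => enc (a.1 j i)) a.2.2) s →
        ∃ (c : Cost) (s' : RAMState w), Exec ⟨T.numHash, fun j => enc (a.2.1 j), T.n,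
          fun i => decide (dist q (P i) < r₂)⟩ (T.dataStructure w N dec).space Prog.query s c s' ∧
          ∃ i : Fin T.n, (s'.reg 0).toNat = i ∧ dist q (P i) < r₂
  · obtain ⟨c, s', he, -, -, -, -, hs'⟩ := hT.exec_dataStructure hdec dist r₂ P q z s hs
    exact ⟨c, s', he, hs' hz⟩

end Layout

/-! ### The linear scan -/

namespace Layout

variable {n H p w N : ℕ} {X R Ω : Type*} {h : Ω → X → R} {enc : R → BitVec w}
  {dist : X → X → ℝ} {r₁ r₂ : ℝ}

/-- A single table with empty tuples: the query compares the distances to all data points. -/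
abbrev linear (n H p : ℕ) : Layout := independent n 1 1 0 0 H p 1 (n + 1)

theorem linear_tableSize_add_workSize :
    (linear n H p).tableSize + (linear n H p).workSize = 23 + 3 * n := by
  simp only [tableSize, nextBase, fpBase, headBase, entries, workSize, listSize, cacheSize,
    independent]
  simp
  ring

theorem linear_fits (hn : 1 ≤ n) (hp : 0 < p) (hH : 0 < H) (hpH : 2 * (p * H) < 2 ^ w)
    (hw : 100000 * (n : ℝ) ^ 2 < (2 : ℝ) ^ w) : (linear n H p).Fits w := by
  have hw' : 100000 * n ^ 2 < 2 ^ w := by exact_mod_cast hw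
  have hn2 : n ≤ n ^ 2 := Nat.le_self_pow (by norm_num) n
  refine independent_fits ⟨hn, one_pos, one_pos, hp, one_pos, Nat.succ_pos n, hH,
    ?_, ?_, ?_, ?_, ?_, hpH⟩
  · rw [linear_tableSize_add_workSize]; omega
  · simp [positions, independent]
  · simp [independent]
  · simp only [independent]; omega
  · simp only [independent]; omega

/-- Empty tuples have digest 0, so every entry has the fingerprint of the query. There are no
mismatches and at most `n` far matches, so the budgets 1 and `n + 1` are never exhausted. -/
theorem linear_scanEvent (hr : r₁ < r₂) (P : Fin n → X) (q : X)
    (hq : ∃ i, dist q (P i) ≤ r₁) (dec : (Fin N → Bool) → ℕ × ℕ × ℕ) :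
    (linear n H p).scanEvent h enc dist r₂ P q dec = Set.univ := by
  obtain ⟨i, hi⟩ := hq
  refine Set.eq_univ_of_forall fun z => ⟨⟨i, ?_, rfl, ?_⟩, ?_, ?_⟩
  · simp [independent]
  · have : ∀ j, j = (i : ℕ) → nearFlag dist r₂ P q j = true := fun j hj => by
      rw [hj, nearFlag, dif_pos i.2]
      exact decide_eq_true (hi.trans_lt hr)
    exact this _ (Nat.mod_eq_of_lt i.2)
  · refine Nat.lt_one_iff.2 ?_
    rw [Nat.count_iff_forall_not]
    exact fun u _ hu => hu.2 rfl
  · refine lt_of_le_of_lt (Nat.count_le _) ?_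
    simp [independent]

variable [MeasurableSpace R] [MeasurableSingletonClass R] [MeasurableSpace Ω] {μ : Measure Ω}
  [IsProbabilityMeasure μ]

theorem Fits.exists_dataStructure {T : Layout} [Finite R] (hT : T.Fits w)
    {dec : (Fin N → Bool) → ℕ × ℕ × ℕ} (hdec : ∀ b, dec b ∈ T.seeds)
    (hh : ∀ x, Measurable fun ω => h ω x) {a b c d : ℝ} (ha : T.numHash ≤ a) (hb : T.cap₂ ≤ b)
    (hc : ((115 + 5 * T.cacheSize + 24 * T.positions + 9 * (T.L₁ + T.L₂) +
      30 * (T.L₁ * T.L₂ + T.cap₁ + T.cap₂) : ℕ) : ℝ) ≤ c)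
    (hd : ((T.tableSize + T.workSize : ℕ) : ℝ) ≤ d)
    (hscan : ∀ (P : Fin T.n → X) (q : X), (∃ i, dist q (P i) ≤ r₁) →
      1 / 2 ≤ (outcomeLaw μ T.numHash N).real (T.scanEvent h enc dist r₂ P q dec)) :
    ∃ D : DataStructure T.n w, (D.numHash : ℝ) ≤ a ∧ (D.space : ℝ) ≤ d ∧
      ∀ P : Fin T.n → X, D.Solves Prog.query dist r₁ r₂ μ h enc P ∧
        ∀ (q : X) (z : D.Outcome Ω), D.QueryWithin Prog.query dist r₂ h enc P q z a b c :=
  ⟨T.dataStructure w N dec, ha, hd, fun P => ⟨hT.solves hdec hh P (hscan P),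
    fun q z => hT.queryWithin hdec ha hb hc P q z⟩⟩

end Layout

theorem mainTheorem1 :
    ∃ (prog : Prog) (C : ℝ), 0 < C ∧
      ∀ (X : Type*) (dist : X → X → ℝ)
        (R : Type*) [MeasurableSpace R] [MeasurableSingletonClass R]
        (Ω : Type*) [MeasurableSpace Ω] (μ : Measure Ω) [IsProbabilityMeasure μ]
        (h : Ω → X → R) (_ : ∀ x, Measurable fun ω => h ω x)
        (r₁ r₂ p₁ p₂ : ℝ) (_ : r₁ < r₂) (_ : 0 < p₁) (_ : p₁ ≤ 1) (_ : 0 < p₂) (_ : p₂ < 1)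
        (_ : IsSensitive dist μ h r₁ r₂ p₁ p₂)
        (n : ℕ) (_ : 1 ≤ n) (ρ : ℝ) (_ : ρ = Real.log (1 / p₁) / Real.log (1 / p₂))
        (k : ℕ) (_ : k = ⌈Real.logb (1 / p₂) n⌉₊)
        (w : ℕ) (_ : C * Real.logb 2 (2 * n * (k + 1) / p₁) ≤ w)
        (enc : R → BitVec w) (_ : Function.Injective enc),
      ∃ D : DataStructure n w,
        (D.numHash : ℝ) ≤ C * ((k : ℝ) ^ 2 / p₁) ∧
        (D.space : ℝ) ≤ C * ((n : ℝ) ^ (1 + ρ) / p₁) ∧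
        ∀ P : Fin n → X,
          D.Solves prog dist r₁ r₂ μ h enc P ∧
          ∀ (q : X) (z : D.Outcome Ω),
            D.QueryWithin prog dist r₂ h enc P q z
              (C * ((k : ℝ) ^ 2 / p₁))
              (C * (n : ℝ) ^ ρ)
              (C * ((n : ℝ) ^ ρ / p₁ + (k : ℝ) ^ 2 / p₁)) := by
  refine ⟨Prog.query, 10000000, by norm_num, ?_⟩
  intro X dist R _ _ Ω _ μ _ h hh r₁ r₂ p₁ p₂ hr hp₁ hp₁' hp₂ hp₂' hsens n hn ρ hρ k hk w hw enc
    henc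
  -- Values that fit into one word form a finite set, on which all measurability arguments rest.
  have : Finite R := Finite.of_injective enc henc
  have hx : 1 ≤ 1 / p₁ := by rwa [le_div_iff₀ hp₁, one_mul]
  have hn' : (1 : ℝ) ≤ n := by exact_mod_cast hn
  have hk0 : (0 : ℝ) ≤ k := by positivity
  have hρ0 : 0 ≤ ρ := rho_nonneg hp₁ hp₁' hp₂ hp₂' hρ
  have hv : 1 ≤ (n : ℝ) ^ ρ := Real.one_le_rpow hn' hρ0
  have hvx : (n : ℝ) ^ (1 + ρ) / p₁ = n * (n : ℝ) ^ ρ * (1 / p₁) := by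
    rw [Real.rpow_add (by linarith), Real.rpow_one, div_eq_mul_one_div]
  simp only [hvx]
  rw [div_eq_mul_one_div] at hw
  simp only [div_eq_mul_one_div ((k : ℝ) ^ 2) p₁, div_eq_mul_one_div ((n : ℝ) ^ ρ) p₁]
  set x := 1 / p₁ with hxdef
  have hy : (n : ℝ) ≤ 2 * n * (k + 1) * x := by
    have : (n : ℝ) * 1 ≤ n * (2 * (k + 1) * x) := by gcongr; nlinarith
    linarith
  have hy2 : 2 ≤ 2 * (n : ℝ) * (k + 1) * x := by
    have : 1 * 1 ≤ (n : ℝ) * ((k + 1) * x) := by gcongr; nlinarith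
    linarith
  have hlog : 0 ≤ Real.logb 2 (2 * n * (k + 1) * x) := Real.logb_nonneg (by norm_num) (by linarith)
  obtain ⟨t, p, hp, hHp, hpH, hpHw, hwH, hyH, hyw⟩ :=
    exists_seed_range hy2 (w := w) (by linarith)
  have hH : 0 < 2 ^ t := by positivity
  -- This case includes `n = 1`, hence `k = 0`. Its negation gives `ρ < 1`, and so `p₂ ≤ p₁`.
  by_cases hlin : (n : ℝ) ≤ (n : ℝ) ^ ρ
  · have hT := Layout.linear_fits (H := 2 ^ t) hn hp.pos hH hpHw
      (lt_of_le_of_lt (by gcongr) hyw)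
    obtain ⟨dec, hdec, -⟩ := exists_injective_bits (N := t + (t + t))
      (Z := (Layout.linear n (2 ^ t) p).seeds)
      (by rw [Layout.card_seeds]; simp only [Layout.independent]; ring)
    have hnv : (n : ℝ) * 1 * 1 ≤ n * (n : ℝ) ^ ρ * x := by gcongr
    have hkx : 0 ≤ (k : ℝ) ^ 2 * x := by positivity
    have hvx' : (n : ℝ) ^ ρ ≤ (n : ℝ) ^ ρ * x := le_mul_of_one_le_right (by linarith) hx
    refine hT.exists_dataStructure hdec hh ?_ ?_ ?_ ?_ fun P q hq => ?_
    · simp only [Layout.independent]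
      push_cast
      linarith
    · simp only [Layout.independent]
      push_cast
      linarith
    · simp only [Layout.independent, Layout.cacheSize, Layout.positions]
      push_cast
      linarith
    · rw [Layout.linear_tableSize_add_workSize]
      push_cast
      linarith
    · rw [Layout.linear_scanEvent (n := n) hr P q hq, probReal_univ]
      norm_num
  · have hvn := (not_le.1 hlin).le
    have hρ1 : ρ < 1 := by
      by_contra hcon
      exact hlin (Real.self_le_rpow_of_one_le hn' (not_lt.1 hcon))
    have hk1 : 1 ≤ k := by
      have hn1 : (1 : ℝ) < n := lt_of_le_of_ne hn' fun e => hlin (by simp [← e])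
      rw [hk, Nat.one_le_ceil_iff]
      exact Real.logb_pos (by rwa [lt_div_iff₀ hp₂, one_mul]) hn1
    have hpow := pow_ceil_le hn hp₁ hp₁' hp₂ hp₂' hρ hk
    have hfar := mul_pow_ceil_le hn hp₁ hp₂ hp₂' (le_of_rho_lt_one hp₁ hp₂ hp₂' hρ hρ1) hρ hk
    clear hk
    -- The even split makes both numbers of tuples about the square root of the number of tables.
    obtain ⟨k₁, k₂, rfl, hk₁, h₁, h₂⟩ : ∃ k₁ k₂, k = k₁ + k₂ ∧ 1 ≤ k₁ ∧ k₂ ≤ k₁ ∧ k₁ ≤ k₂ + 1 :=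
      ⟨(k + 1) / 2, k / 2, by omega⟩
    obtain ⟨T, rfl, rfl, rfl, hTH, rfl, hM, hT, hS⟩ :=
      Layout.exists_layout hx hv hvn hk₁ h₁ h₂ hpow hp.pos hH hpHw hyw
    rw [← hTH] at hHp hpH hwH hyH
    obtain ⟨dec, hdec, hinj⟩ := exists_injective_bits (N := t + (t + t)) (Z := T.seeds)
      (by rw [Layout.card_seeds, hTH]; ring)
    have : Fact T.p.Prime := ⟨hp⟩
    have hkx : 0 ≤ ((T.k₁ + T.k₂ : ℕ) : ℝ) ^ 2 * x := by positivity
    have hvx' := hM.one_le_vx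
    refine hT.exists_dataStructure hdec hh ?_ ?_ ?_ ?_ fun P q hq => ?_
    · linarith [hM.numHash_le]
    · linarith [hM.cap₂_le]
    · linarith [hM.steps_le]
    · have : 0 ≤ (T.n : ℝ) * (T.n : ℝ) ^ ρ * x := by positivity
      linarith [hM.space_le]
    · have hnH : T.n ≤ T.H := by
        exact_mod_cast (by linarith : (T.n : ℝ) ≤ T.H)
      have := hM.failure_le hp₂.le hfar hyH
      refine le_trans ?_ (Layout.one_sub_le_outcomeLaw_scanEvent hT hS hh henc hsens hdec hinj
        (by rw [Layout.card_seeds, hTH]; ring) P q hr hp₁ hp₂ hHp hpH hnH hwH hq)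
      linarith
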